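/- Let $G$ be a chordal graph (every cycle of length at least $4$ has a chord) on $\{1,\dots,p\}$, $p\ge 1$, with set $C$ of maximal cliques and treewidth $w$ (the smallest width of a junction tree of $G$). Let $\mathcal D(G)$ be the class of unnormalized densities $\Phi(x)=\prod_{c\in C}\phi_c(x_c)$ on $\mathbb R^p$ with measurable $\phi_c\ge 0$ and $0<\int\Phi<\infty$. A procedure in the oracle model is given $X\sim\Phi/\int\Phi$, knows $G$ and the support $\{\Phi\ne 0\}$, may use internal randomness independent of $X$, and can learn about $\Phi$ only by evaluating it, adaptively, at points of $\mathbb R^p$. Knockoffs are random vectors $\tilde X$ such that the law of $(X,\tilde X)$ is invariant under exchanging $X_j$ and $\tilde X_j$, for each $j$. Metro processes the coordinates in some order. For each $j$ in turn it draws $X_j^*$ from a proposal density $q_j$, which may depend on $X$ and on the earlier proposals and acceptances, symmetrically in each previously sampled pair $(X_k,\tilde X_k)$ ("faithful"). It accepts $X^*_j$ with the Metropolis–Hastings probability whose target is the conditional law of $X_j$ given the other coordinates of $X$ and the earlier $\tilde X_k$ and $X_k^*$. It sets $\tilde X_j=X_j^*$ upon acceptance and $\tilde X_j=X_j$ otherwise.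 **Upper bound.** There is a universal constant $K$ such that for every such $p$ and $G$ there are an order of the coordinates and an oracle procedure with the following properties for every $\Phi\in\mathcal D(G)$. The procedure makes at most $K(p^2+p2^w)$ queries of $\Phi$. Its output $(X^*,U)$, the vector of proposals and the vector of acceptances, has jointly with $X$ exactly the law of a run of Metro with some faithful, everywhere positive proposal densities, and the resulting $\tilde X$ are knockoffs for $X$. If moreover $\Phi(x)=W\exp(-x\Sigma^{-1}x^\top/2)$ for all $x$, with $W>0$ and $\Sigma$ positive definite, then the proposals are the covariance-guided ones for $\Sigma$ and some $s\in(0,\infty)^p$ for which $$\Gamma(s)=\begin{pmatrix}\Sigma&\Sigma-\mathrm{diag}(s)\\ \Sigma-\mathrm{diag}(s)&\Sigma\end{pmatrix}$$ is positive definite. That is, $q_j$ is the conditional density of $Z'_j$ given $Z=X$ and $Z'_k=X^*_k$ for all previously processed $k$, where $(Z,Z')\sim\mathcal N(0,\Gamma(s))$. In this case $X_j\ne\tilde X_j$ for all $j$ with probability $1$. **Lower bound.** Let $G$ be as above and $D\subseteq\mathbb R^p$. Consider an oracle procedure which, for every $\Phi\in\mathcal D(G)$ with support $D$, almost surely makes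 finitely many queries and returns knockoffs $\tilde X$ for $X$. If, for some $\Phi\in\mathcal D(G)$ with support $D$, $\tilde X_j\ne X_j$ for all $j$ with probability $\varepsilon>0$, then for this $\Phi$ the procedure makes at least $2^w-1$ queries with probability at least $\varepsilon$. -/

import Mathlib

open MeasureTheory ProbabilityTheory
open scoped ENNReal NNReal Matrix

namespace Knockoff

/-! ### Graphs: chordality, junction trees, treewidth -/

/-- Every cycle of length at least four has a chord: an edge of the graph which joins two vertices
of the cycle and is not an edge of the cycle. -/
def IsChordal {V : Type*} (G : SimpleGraph V) : Prop :=
  ∀ (v : V) (c : G.Walk v v), c.IsCycle → 4 ≤ c.length →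
    ∃ a ∈ c.support, ∃ b ∈ c.support, G.Adj a b ∧ s(a, b) ∉ c.edges

/-- A junction tree: a tree whose vertices (`nodes`) are sets of vertices of `G`. -/
structure JunctionTree {p : ℕ} (G : SimpleGraph (Fin p)) where
  nodes : Finset (Finset (Fin p))
  tree : SimpleGraph nodes
  isTree : tree.IsTree
  covers : ∀ j : Fin p, ∃ V ∈ nodes, j ∈ V
  covers_edge : ∀ j k : Fin p, G.Adj j k → ∃ V ∈ nodes, j ∈ V ∧ k ∈ V
  running_intersection : ∀ (V V' : nodes) (P : tree.Walk V V'), P.IsPath →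
    ∀ j ∈ V.1 ∩ V'.1, ∀ U ∈ P.support, j ∈ U.1

/-- Size of the largest vertex of the tree, minus one. -/
def JunctionTree.width {p : ℕ} {G : SimpleGraph (Fin p)} (T : JunctionTree G) : ℕ :=
  T.nodes.sup Finset.card - 1

/-- The smallest width of a junction tree of `G`. -/
noncomputable def treewidth {p : ℕ} (G : SimpleGraph (Fin p)) : ℕ :=
  sInf {w : ℕ | ∃ T : JunctionTree G, T.width = w}

open Classical in
/-- The set of maximal cliques. -/
noncomputable def maxCliques {p : ℕ} (G : SimpleGraph (Fin p)) : Finset (Finset (Fin p)) :=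
  Finset.univ.filter (Maximal fun c : Finset (Fin p) => G.IsClique (c : Set (Fin p)))

/-! ### Densities over a graph -/

/-- `Φ` is an unnormalized density, with respect to Lebesgue measure on `ℝ^p`, of the form
`Φ x = ∏ φ_c (x_c)`, the product being over the maximal cliques `c` of `G`. -/
structure IsGraphicalDensity {p : ℕ} (G : SimpleGraph (Fin p)) (Φ : (Fin p → ℝ) → ℝ) : Prop where
  factors : ∃ φ : (c : Finset (Fin p)) → (c → ℝ) → ℝ,
    (∀ c, Measurable (φ c)) ∧ (∀ c z, 0 ≤ φ c z) ∧
      ∀ x, Φ x = ∏ c ∈ maxCliques G, φ c (c.restrict x)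
  pos : 0 < ∫⁻ x, ENNReal.ofReal (Φ x)
  finite : ∫⁻ x, ENNReal.ofReal (Φ x) < ∞

/-- The probability distribution with density proportional to `Φ`. -/
noncomputable def law {p : ℕ} (Φ : (Fin p → ℝ) → ℝ) : Measure (Fin p → ℝ) :=
  (∫⁻ x, ENNReal.ofReal (Φ x))⁻¹ • volume.withDensity fun x => ENNReal.ofReal (Φ x)

/-! ### Knockoffs -/

/-- Exchange the `j`-th coordinates of `x` and `x̃`. -/
def swap {p : ℕ} (j : Fin p) (a : (Fin p → ℝ) × (Fin p → ℝ)) : (Fin p → ℝ) × (Fin p → ℝ) :=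
  (Function.update a.1 j (a.2 j), Function.update a.2 j (a.1 j))

/-- The joint law `ν` of `(X, X̃)` is invariant under every coordinate swap. -/
def PairwiseExchangeable {p : ℕ} (ν : Measure ((Fin p → ℝ) × (Fin p → ℝ))) : Prop :=
  ∀ j : Fin p, ν.map (swap j) = ν

/-! ### The oracle model -/

/-- A randomized procedure in the oracle model on `ℝ^p` with outputs in `β`. All internal randomness
is contained in a random seed. Given the input vector, the seed, and the list of the
answers received so far, `step` gives either the next query point (`Sum.inl`) or the final output
(`Sum.inr`). The density `Φ` enters only through the answers; anything which is known in advance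
(the graph, the support) may be built into the procedure. -/
structure OracleProcedure (p : ℕ) (β : Type) [MeasurableSpace β] where
  Seed : Type
  measurableSpaceSeed : MeasurableSpace Seed
  seedLaw : Measure Seed
  isProbabilityMeasure_seedLaw : IsProbabilityMeasure seedLaw
  step : (Fin p → ℝ) → Seed → List ℝ → (Fin p → ℝ) ⊕ β
  measurable_step : ∀ n : ℕ, Measurable
    fun a : (Fin p → ℝ) × Seed × (Fin n → ℝ) => step a.1 a.2.1 (List.ofFn a.2.2)

namespace OracleProcedure

attribute [instance] measurableSpaceSeed isProbabilityMeasure_seedLaw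

variable {p : ℕ} {β : Type} [MeasurableSpace β]

/-- The answers of the oracle `Φ` after at most `n` queries. -/
def answers (A : OracleProcedure p β) (Φ : (Fin p → ℝ) → ℝ) (x : Fin p → ℝ) (ω : A.Seed) :
    ℕ → List ℝ
  | 0 => []
  | n + 1 =>
    match A.step x ω (answers A Φ x ω n) with
    | Sum.inl z => answers A Φ x ω n ++ [Φ z]
    | Sum.inr _ => answers A Φ x ω n

/-- The output, if the procedure stops after at most `n` queries. -/
def result (A : OracleProcedure p β) (Φ : (Fin p → ℝ) → ℝ) (x : Fin p → ℝ) (ω : A.Seed) (n : ℕ) :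
    Option β :=
  (A.step x ω (A.answers Φ x ω n)).getRight?

/-- The number of queries made before stopping (`⊤` if the procedure never stops). -/
noncomputable def numQueries (A : OracleProcedure p β) (Φ : (Fin p → ℝ) → ℝ) (x : Fin p → ℝ)
    (ω : A.Seed) : ℕ∞ :=
  ⨅ n : ℕ, ⨅ _ : (A.result Φ x ω n).isSome, (n : ℕ∞)

open Classical in
/-- The output of the procedure (an arbitrary value if it never stops). -/
noncomputable def output [Inhabited β] (A : OracleProcedure p β) (Φ : (Fin p → ℝ) → ℝ)
    (x : Fin p → ℝ) (ω : A.Seed) : β :=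
  if h : ∃ n, (A.result Φ x ω n).isSome then (A.result Φ x ω (Nat.find h)).get (Nat.find_spec h)
  else default

/-- The joint law of the input `X`, with density proportional to `Φ`, and the independent seed. -/
noncomputable def runLaw (A : OracleProcedure p β) (Φ : (Fin p → ℝ) → ℝ) :
    Measure ((Fin p → ℝ) × A.Seed) :=
  (law Φ).prod A.seedLaw

end OracleProcedure

/-! ### Metropolized knockoff sampling

The coordinates are processed in the order `σ 0, σ 1, …, σ (p - 1)`. A run is recorded by
`x` (the input), `y` (with `y j` the proposal `x*_j`), and `u` (with `u j = true` if and only if the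
proposal for coordinate `j` is accepted). -/

/-- The knockoff vector: `x̃_j = x*_j` upon acceptance and `x̃_j = x_j` otherwise. -/
def knockoff {p : ℕ} (x y : Fin p → ℝ) (u : Fin p → Bool) : Fin p → ℝ :=
  fun j => if u j then y j else x j

/-- `q n x y u t` is the density at `t` of the proposal for coordinate `σ n`, given the input `x` and
the earlier proposals and acceptances. It is a probability density, it does not depend on
later proposals and acceptances, and it is faithful: it is symmetric in each
previously sampled pair `(x_j, x̃_j)`. (If the proposal for `j` was rejected, then `x̃_j = x_j`,
so that only accepted coordinates, where `x̃_j = x*_j`, matter.) -/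
structure IsFaithfulProposal {p : ℕ} (σ : Equiv.Perm (Fin p))
    (q : Fin p → (Fin p → ℝ) → (Fin p → ℝ) → (Fin p → Bool) → ℝ → ℝ) : Prop where
  measurable : ∀ n, Measurable
    fun a : (Fin p → ℝ) × (Fin p → ℝ) × (Fin p → Bool) × ℝ => q n a.1 a.2.1 a.2.2.1 a.2.2.2
  nonneg : ∀ n x y u t, 0 ≤ q n x y u t
  lintegral_eq_one : ∀ n x y u, ∫⁻ t, ENNReal.ofReal (q n x y u t) = 1
  causal : ∀ n x y y' u u', (∀ k < n, y (σ k) = y' (σ k) ∧ u (σ k) = u' (σ k)) →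
    q n x y u = q n x y' u'
  faithful : ∀ n x y u, ∀ k < n, u (σ k) = true →
    q n (Function.update x (σ k) (y (σ k))) (Function.update y (σ k) (x (σ k))) u = q n x y u

/-- The Metropolis–Hastings acceptance probability of step `n`, where `g` is the (unnormalized) joint
density of the input and of the proposals and acceptances of the earlier steps. -/
noncomputable def acceptProb {p : ℕ} (σ : Equiv.Perm (Fin p))
    (q : Fin p → (Fin p → ℝ) → (Fin p → ℝ) → (Fin p → Bool) → ℝ → ℝ)
    (g : (Fin p → ℝ) → (Fin p → ℝ) → (Fin p → Bool) → ℝ)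
    (n : Fin p) (x y : Fin p → ℝ) (u : Fin p → Bool) : ℝ :=
  let x' := Function.update x (σ n) (y (σ n))
  min 1 ((q n x' y u (x (σ n)) * g x' y u) / (q n x y u (y (σ n)) * g x y u))

/-- The unnormalized joint density, with respect to Lebesgue and counting measure, of the input and
of the proposals and acceptances of the first `n` steps of Metro: the
proposal is drawn from `q n` and then accepted with probability `acceptProb`. -/
noncomputable def metroDensity {p : ℕ} (Φ : (Fin p → ℝ) → ℝ) (σ : Equiv.Perm (Fin p))
    (q : Fin p → (Fin p → ℝ) → (Fin p → ℝ) → (Fin p → Bool) → ℝ → ℝ) :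
    ℕ → (Fin p → ℝ) → (Fin p → ℝ) → (Fin p → Bool) → ℝ
  | 0 => fun x _ _ => Φ x
  | n + 1 => fun x y u =>
    if h : n < p then
      let m : Fin p := ⟨n, h⟩
      let α := acceptProb σ q (metroDensity Φ σ q n) m x y u
      metroDensity Φ σ q n x y u * (q m x y u (y (σ m)) * (if u (σ m) then α else 1 - α))
    else metroDensity Φ σ q n x y u

/-- The law of `(X, (X*, U))` for a complete run of Metro with input `X` distributed according to
`Φ`: `X*` is the vector of proposals and `U` the vector of acceptances. -/
noncomputable def metroLaw {p : ℕ} (Φ : (Fin p → ℝ) → ℝ) (σ : Equiv.Perm (Fin p))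
    (q : Fin p → (Fin p → ℝ) → (Fin p → ℝ) → (Fin p → Bool) → ℝ → ℝ) :
    Measure ((Fin p → ℝ) × (Fin p → ℝ) × (Fin p → Bool)) :=
  (∫⁻ x, ENNReal.ofReal (Φ x))⁻¹ •
    ((volume : Measure (Fin p → ℝ)).prod
      ((volume : Measure (Fin p → ℝ)).prod (Measure.count : Measure (Fin p → Bool)))).withDensity
      fun a => ENNReal.ofReal (metroDensity Φ σ q p a.1 a.2.1 a.2.2)

/-! ### Covariance-guided proposals -/

/-- The matrix `Γ(s)` with blocks `Σ`, `Σ - diag s`, `Σ - diag s`, `Σ`. -/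
def Gam {p : ℕ} (S : Matrix (Fin p) (Fin p) ℝ) (s : Fin p → ℝ) :
    Matrix (Fin p ⊕ Fin p) (Fin p ⊕ Fin p) ℝ :=
  Matrix.fromBlocks S (S - Matrix.diagonal s) (S - Matrix.diagonal s) S

/-- The density at `t` of the covariance-guided proposal of step `n` (for mean zero and positive
definite `Γ(s)`): the conditional density, for a `N(0, Γ(s))` vector `(Z, Z')`, of
`Z'_{σ n}` given `Z = x` and `Z'_{σ k} = y_{σ k}` for `k < n`. -/
noncomputable def covGuided {p : ℕ} (S : Matrix (Fin p) (Fin p) ℝ) (s : Fin p → ℝ)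
    (σ : Equiv.Perm (Fin p)) (n : Fin p) (x y : Fin p → ℝ) (t : ℝ) : ℝ :=
  let I := {i : Fin p ⊕ Fin p // ∀ j, i = Sum.inr j → σ.symm j < n}
  let Γ₁₁ : Matrix I I ℝ := (Gam S s).submatrix Subtype.val Subtype.val
  let Γ₁₂ : I → ℝ := fun i => Gam S s i.1 (Sum.inr (σ n))
  let Γ₂₂ : ℝ := Gam S s (Sum.inr (σ n)) (Sum.inr (σ n))
  let z : I → ℝ := fun i => Sum.elim x y i.1
  gaussianPDFReal (Γ₁₂ ⬝ᵥ (Γ₁₁⁻¹ *ᵥ z)) (Γ₂₂ - Γ₁₂ ⬝ᵥ (Γ₁₁⁻¹ *ᵥ Γ₁₂)).toNNReal t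

end Knockoff

namespace Knockoff

/-! ### Chordal graphs have perfect elimination orderings -/

section Chordal

open SimpleGraph

variable {V : Type*} {G : SimpleGraph V}

/-! Upper bound. A junction tree of minimal width gives an order in which every coordinate has at
most `w` later neighbours (`IsChordal.exists_elimination_order`). The proposals are Gaussian and
covariance-guided for a precision matrix `P` which is read off from `1 + p + p²` values of `Φ` at
fixed points. `P` is replaced by the identity if the reading is not positive definite, and `s` is
the constant `1 / trace P`. These proposals do not depend on the acceptances, so the whole vector
`y` can be drawn in advance. Every acceptance probability is then a function of the values of `Φ` at
the `2 ^ p` points which mix coordinates of `x` and `y`.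

These values are tabulated with `1 + p 2 ^ w` queries. Let `A` be a set of coordinates later than
`k`. When `k` is moved from `x` to `y`, only clique factors containing `k` change, so the ratio of
the values of `Φ` for `A ∪ {k}` and `A` depends on `A` only through the later neighbours of `k`
(`IsGraphicalDensity.mul_eq_mul`). One query for each subset of these neighbours is enough. The
ratio is undefined where `Φ` vanishes, and the table may contain false zeros beyond such points.
They are harmless: the recursion for the density of Metro moves coordinates from late to early and
returns zero as soon as it meets a zero of `Φ` (`metroDensity_tableDensity`).

Metro yields knockoffs because the density of an accepted step is the minimum of two expressions
which are exchanged by the swap, and later steps preserve this symmetry by faithfulness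
(`metroDensity_swap`). In the Gaussian case the density after each step is that of a marginal of
`N(0, Γ(s))`. It is invariant under the swaps, so all acceptance probabilities equal one
(`exists_metroDensity_covGuided`).

Lower bound. Take a maximal clique `c` with at least `w` elements and a nonempty `B ⊆ c`. If all
coordinates of `X` and `X̃` differ, the procedure must almost surely query a point which agrees on
`c` with `X` after the coordinates in `B` have been exchanged (`ae_exists_queried`). Otherwise
multiply `Φ` by a small `δ` near such points. This is a change of the factor of `c`; it keeps the
support and is not noticed by the run. Exchangeability for the new density equates the probability
of the run's outcome with that of the exchanged outcome, which is of order `δ`. Different `B`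
require different queries, which gives `2 ^ |c| - 1` of them. -/

theorem edge_mem_of_splits {s t a b : V} {P : G.Walk s t} (hP : P.length = G.dist s t)
    {q : G.Walk s a} {r₁ : G.Walk a b} {r₂ : G.Walk b t} (h : P = q.append (r₁.append r₂))
    (hab : G.Adj a b) : s(a, b) ∈ P.edges := by
  have h1 := G.dist_le (q.append (Walk.cons hab r₂))
  rw [← hP, h] at h1
  simp only [Walk.length_append, Walk.length_cons] at h1
  have hlen : r₁.length ≤ 1 := by omega
  match r₁, hlen with
  | .nil, _ => exact absurd hab (G.loopless.irrefl _)
  | .cons h' .nil, _ => simp [h]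
  | .cons _ (.cons _ _), hl => simp at hl

/-- A shortest path has no chords, since a chord would be a shortcut. -/
theorem edge_mem_of_geodesic {s t a b : V} {P : G.Walk s t} (hP : P.length = G.dist s t)
    (ha : a ∈ P.support) (hb : b ∈ P.support) (hab : G.Adj a b) : s(a, b) ∈ P.edges := by
  obtain ⟨q, r, rfl⟩ := P.mem_support_iff_exists_append.mp ha
  rcases (Walk.mem_support_append_iff _ _).mp hb with hb | hb
  · obtain ⟨q₁, q₂, rfl⟩ := q.mem_support_iff_exists_append.mp hb
    rw [Sym2.eq_swap]
    exact edge_mem_of_splits hP (Walk.append_assoc ..).symm hab.symm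
  · obtain ⟨r₁, r₂, rfl⟩ := r.mem_support_iff_exists_append.mp hb
    exact edge_mem_of_splits hP rfl hab

/-- The graph on the same vertices whose edges are those of `G` with both ends in `T`. -/
def inside (G : SimpleGraph V) (T : Set V) : SimpleGraph V where
  Adj a b := G.Adj a b ∧ a ∈ T ∧ b ∈ T
  symm := ⟨fun _ _ h => ⟨h.1.symm, h.2.2, h.2.1⟩⟩
  loopless := ⟨fun _ h => G.loopless.irrefl _ h.1⟩

theorem inside_le (T : Set V) : inside G T ≤ G := fun _ _ h => h.1

theorem inside_mono {T T' : Set V} (h : T ⊆ T') : inside G T ≤ inside G T' :=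
  fun _ _ h' => ⟨h'.1, h h'.2.1, h h'.2.2⟩

theorem mem_of_mem_support_inside {T : Set V} {a b : V} (P : (inside G T).Walk a b) (ha : a ∈ T) :
    ∀ x ∈ P.support, x ∈ T := by
  induction P with
  | nil => simpa using ha
  | cons h P ih =>
    intro x hx
    rcases List.mem_cons.mp (by simpa using hx) with rfl | hx
    · exact ha
    · exact ih h.2.2 x hx

/-- If `s` and `t` were not adjacent, a shortest path between them through `W` would close up at `v`
to a cycle of length at least four. It has no chord: the inner vertices of the path are not
neighbours of `v`, and a shortest path has no chord itself. -/
theorem IsChordal.adj_of_reachable (hG : IsChordal G) {W : Set V} {v s t : V}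
    (hW : ∀ c ∈ W, c ≠ v ∧ ¬ G.Adj v c) (hs : G.Adj v s) (ht : G.Adj v t) (hst : s ≠ t)
    (hr : (inside G (W ∪ {s, t})).Reachable s t) : G.Adj s t := by
  by_contra hnst
  obtain ⟨P, hPath, hP⟩ := hr.exists_path_of_dist
  have hT := mem_of_mem_support_inside P (by simp)
  have hv : v ∉ P.support := fun h => by
    rcases hT v h with h | h | h
    · exact (hW v h).1 rfl
    · exact hs.ne h
    · exact ht.ne h
  have hlen : 2 ≤ P.length := by
    match P with
    | .nil => exact absurd rfl hst
    | .cons h .nil => exact absurd h.1 hnst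
    | .cons _ (.cons _ _) => simp
  set Q := P.mapLe (inside_le _) with hQ
  have hQs : Q.support = P.support := Walk.support_mapLe_eq_support _ _
  have hQe : Q.edges = P.edges := Walk.edges_mapLe_eq_edges _ _
  have hQl : Q.length = P.length := by simp [hQ]
  have hc : (Walk.cons hs (Q.concat ht.symm)).IsCycle := by
    rw [Walk.cons_isCycle_iff]
    refine ⟨(hPath.mapLe _).concat (by rwa [hQs]) _, ?_⟩
    rw [Walk.edges_concat, List.concat_eq_append, List.mem_append]
    rintro (h | h)
    · exact hv (hQs ▸ Q.fst_mem_support_of_mem_edges h)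
    · simp only [List.mem_singleton, Sym2.eq_iff] at h
      rcases h with ⟨h, -⟩ | ⟨-, h⟩
      · exact ht.ne h
      · exact hst h
  obtain ⟨a, ha, b, hb, hab, he⟩ := hG v _ hc (by simp [hQl]; omega)
  have hsupp : ∀ x, x ∈ (Walk.cons hs (Q.concat ht.symm)).support → x = v ∨ x ∈ P.support := by
    intro x hx
    simp only [Walk.support_cons, Walk.support_concat, hQs, List.mem_cons,
      List.mem_append] at hx
    tauto
  simp only [Walk.edges_cons, Walk.edges_concat, hQe, List.mem_cons, List.concat_eq_append,
    List.mem_append, not_or] at he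
  have key : ∀ y ∈ P.support, G.Adj v y → y = s ∨ y = t := fun y hy hvy => by
    rcases hT y hy with h | h | h
    · exact absurd hvy (hW y h).2
    · exact .inl h
    · exact .inr h
  rcases hsupp a ha with rfl | ha
  · rcases hsupp b hb with rfl | hb
    · exact G.loopless.irrefl _ hab
    · rcases key b hb hab with rfl | rfl
      · exact he.1 rfl
      · exact he.2.2.1 Sym2.eq_swap
  · rcases hsupp b hb with rfl | hb
    · rcases key a (by assumption) hab.symm with rfl | rfl
      · exact he.1 Sym2.eq_swap
      · exact he.2.2.1 rfl
    · exact he.2.1 (edge_mem_of_geodesic hP ha hb ⟨hab, hT a ha, hT b hb⟩)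

/-- The neighbours of `x` in `H` are pairwise adjacent. -/
def IsSimplicialIn (G : SimpleGraph V) (H : Finset V) (x : V) : Prop :=
  ∀ a ∈ H, ∀ b ∈ H, G.Adj x a → G.Adj x b → a ≠ b → G.Adj a b

/-- Dirac's argument. Let `C` be the component of `u` among the non-neighbours of `v`, and let `S`
be the set of neighbours of `v` which are adjacent to `C`. Then `S` is a clique, and a vertex of `C`
has all its neighbours in `C ∪ S`. Hence it suffices to find a vertex of `C` which is simplicial in
the smaller set `C ∪ S`. Prescribing a non-neighbour in the statement is what lets the induction
place the vertex in `C`. -/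
theorem IsChordal.exists_isSimplicialIn_not_adj [DecidableEq V] (hG : IsChordal G) (n : ℕ) :
    ∀ H : Finset V, H.card = n → ∀ v ∈ H, (∃ u ∈ H, u ≠ v ∧ ¬ G.Adj v u) →
      ∃ x ∈ H, x ≠ v ∧ ¬ G.Adj v x ∧ IsSimplicialIn G H x := by
  classical
  induction n using Nat.strong_induction_on with
  | _ n ih =>
  rintro H hn v hv ⟨u, hu, huv, hvu⟩
  set W : Set V := {x | x ∈ H ∧ x ≠ v ∧ ¬ G.Adj v x} with hW
  have huW : u ∈ W := ⟨hu, huv, hvu⟩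
  set C : Finset V := H.filter fun x => (inside G W).Reachable u x with hC
  have hCW : ∀ c ∈ C, c ∈ W := fun c hc => by
    obtain ⟨P⟩ := (Finset.mem_filter.mp hc).2
    exact mem_of_mem_support_inside P huW c P.end_mem_support
  have hCH : C ⊆ H := Finset.filter_subset _ _
  set S : Finset V := H.filter fun s => G.Adj v s ∧ ∃ c ∈ C, G.Adj c s with hS
  have huC : u ∈ C := by simp [hC, hu]
  have hSclique : ∀ s ∈ S, ∀ t ∈ S, s ≠ t → G.Adj s t := by
    intro s hs t ht hst
    obtain ⟨-, hvs, c, hc, hcs⟩ := Finset.mem_filter.mp hs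
    obtain ⟨-, hvt, d, hd, hdt⟩ := Finset.mem_filter.mp ht
    refine hG.adj_of_reachable (W := W) (fun c hc => hc.2) hvs hvt hst ?_
    have h1 : (inside G (W ∪ {s, t})).Reachable c d :=
      (((Finset.mem_filter.mp hc).2.symm.trans (Finset.mem_filter.mp hd).2)).mono
        (inside_mono Set.subset_union_left)
    have h2 : (inside G (W ∪ {s, t})).Adj s c := ⟨hcs.symm, by simp, .inl (hCW c hc)⟩
    have h3 : (inside G (W ∪ {s, t})).Adj d t := ⟨hdt, .inl (hCW d hd), by simp⟩
    exact h2.reachable.trans (h1.trans h3.reachable)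
  have hnb : ∀ x ∈ C, ∀ a ∈ H, G.Adj x a → a ∈ C ∪ S := by
    intro x hx a ha hxa
    have hxW := hCW x hx
    by_cases hva : G.Adj v a
    · exact Finset.mem_union_right _ (Finset.mem_filter.mpr ⟨ha, hva, x, hx, hxa⟩)
    · have hav : a ≠ v := by rintro rfl; exact hxW.2.2 hxa.symm
      have : (inside G W).Adj x a := ⟨hxa, hxW, ha, hav, hva⟩
      exact Finset.mem_union_left _
        (Finset.mem_filter.mpr ⟨ha, (Finset.mem_filter.mp hx).2.trans this.reachable⟩)
  have hvK : v ∉ C ∪ S := by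
    rw [Finset.mem_union, not_or]
    refine ⟨fun h => (hCW v h).2.1 rfl, fun h => ?_⟩
    exact G.loopless.irrefl _ (Finset.mem_filter.mp h).2.1
  have hKH : C ∪ S ⊆ H := Finset.union_subset hCH (Finset.filter_subset _ _)
  have hcard : (C ∪ S).card < n := hn ▸ Finset.card_lt_card ⟨hKH, fun h => hvK (h hv)⟩
  have finish : ∀ x ∈ C, IsSimplicialIn G (C ∪ S) x →
      ∃ x ∈ H, x ≠ v ∧ ¬ G.Adj v x ∧ IsSimplicialIn G H x := fun x hx hsx =>
    ⟨x, hCH hx, (hCW x hx).2.1, (hCW x hx).2.2, fun a ha b hb hxa hxb =>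
      hsx a (hnb x hx a ha hxa) b (hnb x hx b hb hxb) hxa hxb⟩
  by_cases h1 : ∃ s ∈ S, ∃ k ∈ C ∪ S, k ≠ s ∧ ¬ G.Adj s k
  · obtain ⟨s, hs, hk⟩ := h1
    -- The vertex found is not adjacent to `s`, and `S` is a clique, so it lies in `C`.
    obtain ⟨x, hx, hxs, hsx, hsimp⟩ := ih _ hcard _ rfl s (Finset.mem_union_right _ hs) hk
    rcases Finset.mem_union.mp hx with hx | hx
    · exact finish x hx hsimp
    · exact absurd (hSclique s hs x hx hxs.symm) hsx
  -- Now the vertices of `S` are adjacent to everything in `C ∪ S`, so being simplicial in `C` is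
  -- enough.
  · push Not at h1
    obtain ⟨x, hx, hsimp⟩ : ∃ x ∈ C, IsSimplicialIn G C x := by
      by_cases h2 : ∃ c ∈ C, ∃ k ∈ C, k ≠ c ∧ ¬ G.Adj c k
      · obtain ⟨c, hc, hk⟩ := h2
        obtain ⟨x, hx, -, -, h⟩ := ih _
          ((Finset.card_le_card Finset.subset_union_left).trans_lt hcard) C rfl c hc hk
        exact ⟨x, hx, h⟩
      · push Not at h2
        exact ⟨u, huC, fun a ha b hb _ _ hab => h2 a ha b hb hab.symm⟩
    refine finish x hx fun a ha b hb hxa hxb hab => ?_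
    rcases Finset.mem_union.mp ha with ha' | ha'
    · rcases Finset.mem_union.mp hb with hb' | hb'
      · exact hsimp a ha' b hb' hxa hxb hab
      · exact (h1 b hb' a ha hab).symm
    · exact h1 a ha' b hb hab.symm

theorem IsChordal.exists_isSimplicialIn [DecidableEq V] (hG : IsChordal G) {H : Finset V}
    (hH : H.Nonempty) : ∃ x ∈ H, IsSimplicialIn G H x := by
  by_cases h : ∃ v ∈ H, ∃ u ∈ H, u ≠ v ∧ ¬ G.Adj v u
  · obtain ⟨v, hv, h⟩ := h
    obtain ⟨x, hx, -, -, h⟩ := hG.exists_isSimplicialIn_not_adj _ H rfl v hv h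
    exact ⟨x, hx, h⟩
  · push Not at h
    obtain ⟨x, hx⟩ := hH
    exact ⟨x, hx, fun a ha b hb _ _ hab => h a ha b hb hab.symm⟩

/-- A simplicial vertex receives rank zero and the ranks of the remaining vertices are shifted by
one. -/
theorem IsChordal.exists_rank_of_finset [DecidableEq V] (hG : IsChordal G) (H : Finset V) :
    ∃ r : V → ℕ, Set.InjOn r H ∧ ∀ v ∈ H, ∀ a ∈ H, ∀ b ∈ H, r v < r a → r v < r b →
      G.Adj v a → G.Adj v b → a ≠ b → G.Adj a b := by
  induction H using Finset.strongInduction with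
  | _ H ih =>
  rcases H.eq_empty_or_nonempty with rfl | hH
  · exact ⟨fun _ => 0, by simp, by simp⟩
  obtain ⟨x, hx, hsx⟩ := hG.exists_isSimplicialIn hH
  obtain ⟨r, hinj, hr⟩ := ih (H.erase x) (Finset.erase_ssubset hx)
  refine ⟨fun u => if u = x then 0 else r u + 1, ?_, ?_⟩
  · intro a ha b hb hab
    by_cases h1 : a = x <;> by_cases h2 : b = x <;> simp only [h1, h2, if_true, if_false] at hab ⊢
    · omega
    · omega
    · exact hinj (by simp_all) (by simp_all) (by omega)
  · intro v hv a ha b hb hva hvb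
    by_cases h1 : v = x
    · subst h1; exact hsx a ha b hb
    by_cases h2 : a = x
    · simp [h2] at hva
    by_cases h3 : b = x
    · simp [h3] at hvb
    simp only [h1, h2, h3, if_false] at hva hvb
    exact hr v (by simp [*]) a (by simp [*]) b (by simp [*]) (by omega) (by omega)

theorem IsChordal.exists_rank [Fintype V] (hG : IsChordal G) :
    ∃ r : V → ℕ, Function.Injective r ∧ ∀ v a b, r v < r a → r v < r b →
      G.Adj v a → G.Adj v b → a ≠ b → G.Adj a b := by
  classical
  obtain ⟨r, h1, h2⟩ := hG.exists_rank_of_finset Finset.univ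
  exact ⟨r, fun a b => h1 (by simp) (by simp), fun v a b => h2 v (by simp) a (by simp) b (by simp)⟩

/-! ### Trees given by a parent function -/

/-- The graph which joins every vertex other than `ρ` to its parent. -/
def parentGraph (ρ : V) (pa : V → V) : SimpleGraph V :=
  SimpleGraph.fromRel fun a b => a ≠ ρ ∧ b = pa a

/-- Ranks increase towards parents, so every vertex is connected to the root. There are at most `|V|
- 1` edges, as each non-root vertex contributes one. -/
theorem parentGraph_isTree [Finite V] {ρ : V} {pa : V → V} {r : V → ℕ}
    (h : ∀ v ≠ ρ, r v < r (pa v)) : (parentGraph ρ pa).IsTree := by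
  classical
  have := Fintype.ofFinite V
  have hadj : ∀ v ≠ ρ, (parentGraph ρ pa).Adj v (pa v) := fun v hv => by
    refine ⟨fun e => ?_, .inl ⟨hv, rfl⟩⟩
    have := h v hv
    rw [← e] at this
    exact lt_irrefl _ this
  have hreach : ∀ n v, (Finset.univ.sup r) - r v = n → (parentGraph ρ pa).Reachable v ρ := by
    intro n
    induction n using Nat.strong_induction_on with
    | _ n ih =>
    intro v hv
    by_cases hvρ : v = ρ
    · rw [hvρ]
    · refine (hadj v hvρ).reachable.trans (ih _ ?_ _ rfl)
      have h1 := h v hvρ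
      have h2 : r (pa v) ≤ Finset.univ.sup r := Finset.le_sup (Finset.mem_univ _)
      omega
  have hconn : (parentGraph ρ pa).Connected :=
    { preconnected := fun a b => (hreach _ a rfl).trans (hreach _ b rfl).symm
      nonempty := ⟨ρ⟩ }
  rw [isTree_iff_connected_and_card]
  refine ⟨hconn, le_antisymm ?_ hconn.card_vert_le_card_edgeSet_add_one⟩
  have hsub : (parentGraph ρ pa).edgeSet ⊆ ((Finset.univ.erase ρ).image fun v => s(v, pa v)) := by
    intro e
    induction e using Sym2.ind with
    | _ a b =>
    rintro ⟨-, ⟨ha, hb⟩ | ⟨hb, ha⟩⟩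
    all_goals dsimp only at ha hb
    · exact Finset.mem_coe.mpr (Finset.mem_image.mpr ⟨a, by simpa using ha, by rw [hb]⟩)
    · exact Finset.mem_coe.mpr
        (Finset.mem_image.mpr ⟨b, by simpa using hb, by rw [ha]; exact Sym2.eq_swap⟩)
  have h1 := Nat.card_mono (Finset.finite_toSet _) hsub
  have h2 : ((Finset.univ.erase ρ).image fun v => s(v, pa v)).card ≤ Fintype.card V - 1 :=
    Finset.card_image_le.trans (by simp)
  have h3 : 0 < Fintype.card V := Fintype.card_pos_iff.mpr ⟨ρ⟩
  have h4 : Nat.card ↑(((Finset.univ.erase ρ).image fun v => s(v, pa v) : Finset (Sym2 V)) :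
      Set (Sym2 V)) = ((Finset.univ.erase ρ).image fun v => s(v, pa v)).card :=
    Nat.card_eq_card_toFinset _ |>.trans (by rw [Finset.toFinset_coe])
  rw [Nat.card_eq_fintype_card (α := V)]
  omega

end Chordal

end Knockoff

namespace Knockoff

/-! ### The treewidth of a chordal graph is at most its clique number -/

section Treewidth

open SimpleGraph

variable {p : ℕ} {G : SimpleGraph (Fin p)}

open Classical in
/-- The vertex `v` together with its neighbours of larger rank. -/
noncomputable def bag (G : SimpleGraph (Fin p)) (r : Fin p → ℕ) (v : Fin p) : Finset (Fin p) :=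
  Finset.univ.filter fun u => u = v ∨ (r v < r u ∧ G.Adj v u)

theorem mem_bag {r : Fin p → ℕ} {u v : Fin p} :
    u ∈ bag G r v ↔ u = v ∨ (r v < r u ∧ G.Adj v u) := by
  simp [bag]

theorem self_mem_bag {r : Fin p → ℕ} {v : Fin p} : v ∈ bag G r v := mem_bag.mpr (.inl rfl)

theorem rank_le_of_mem_bag {r : Fin p → ℕ} {u v : Fin p} (h : u ∈ bag G r v) : r v ≤ r u := by
  rcases mem_bag.mp h with rfl | h
  · exact le_rfl
  · exact h.1.le

theorem bag_injective {r : Fin p → ℕ} (hr : Function.Injective r) :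
    Function.Injective (bag G r) := fun v w h =>
  hr (le_antisymm (rank_le_of_mem_bag (by rw [h]; exact self_mem_bag))
    (rank_le_of_mem_bag (by rw [← h]; exact self_mem_bag)))

/-- The parent of `v` is its later neighbour of least rank. The later neighbours of `v` form a
clique, so the others are later neighbours of the parent. A vertex without later neighbours is
attached to the root, the vertex of largest rank. -/
theorem exists_parent (hp : 0 < p) {r : Fin p → ℕ} (hinj : Function.Injective r)
    (hr : ∀ v a b, r v < r a → r v < r b → G.Adj v a → G.Adj v b → a ≠ b → G.Adj a b) :
    ∃ (ρ : Fin p) (pa : Fin p → Fin p), (∀ v ≠ ρ, r v < r (pa v)) ∧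
      ∀ v, ∀ j ∈ bag G r v, j ≠ v → v ≠ ρ ∧ j ∈ bag G r (pa v) := by
  classical
  obtain ⟨ρ, -, hρ⟩ := Finset.exists_max_image Finset.univ r ⟨⟨0, hp⟩, Finset.mem_univ _⟩
  have hex : ∀ v, ∃ u, (v ≠ ρ → r v < r u) ∧ ∀ j ∈ bag G r v, j ≠ v → j ∈ bag G r u := by
    intro v
    rcases ((bag G r v).erase v).eq_empty_or_nonempty with h | h
    · refine ⟨ρ, fun hv => lt_of_le_of_ne (hρ v (Finset.mem_univ _)) fun e => hv (hinj e), ?_⟩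
      intro j hj hjv
      have : j ∈ (bag G r v).erase v := Finset.mem_erase.mpr ⟨hjv, hj⟩
      simp [h] at this
    · obtain ⟨u, hu, hmin⟩ := Finset.exists_min_image _ r h
      obtain ⟨huv, hu⟩ := Finset.mem_erase.mp hu
      have hu' := (mem_bag.mp hu).resolve_left huv
      refine ⟨u, fun _ => hu'.1, fun j hj hjv => ?_⟩
      have hj' := (mem_bag.mp hj).resolve_left hjv
      have hle := hmin j (Finset.mem_erase.mpr ⟨hjv, hj⟩)
      by_cases hju : j = u
      · exact mem_bag.mpr (.inl hju)
      · exact mem_bag.mpr (.inr ⟨lt_of_le_of_ne hle fun e => hju (hinj e).symm,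
          hr v u j hu'.1 hj'.1 hu'.2 hj'.2 (Ne.symm hju)⟩)
  choose pa h1 h2 using hex
  refine ⟨ρ, pa, h1, fun v j hj hjv => ⟨?_, h2 v j hj hjv⟩⟩
  rintro rfl
  have := ((mem_bag.mp hj).resolve_left hjv).1
  exact absurd (hρ j (Finset.mem_univ _)) (not_le.mpr this)

/-- Passing to parents leads from any vertex whose bag contains `j` up to `j` itself without leaving
such bags. This is the running intersection property for paths which only climb. -/
theorem exists_climbing_walk {r : Fin p → ℕ} {ρ : Fin p} {pa : Fin p → Fin p}
    (h1 : ∀ v ≠ ρ, r v < r (pa v))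
    (h2 : ∀ v, ∀ j ∈ bag G r v, j ≠ v → v ≠ ρ ∧ j ∈ bag G r (pa v)) (j : Fin p) (n : ℕ) :
    ∀ v, r j - r v = n → j ∈ bag G r v →
      ∃ Q : (parentGraph ρ pa).Walk v j, ∀ u ∈ Q.support, j ∈ bag G r u := by
  induction n using Nat.strong_induction_on with
  | _ n ih =>
  intro v hn hj
  by_cases hjv : j = v
  · subst hjv
    exact ⟨.nil, by simpa using hj⟩
  obtain ⟨hvρ, hj'⟩ := h2 v j hj hjv
  have hlt := h1 v hvρ
  have hle := rank_le_of_mem_bag hj'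
  obtain ⟨Q, hQ⟩ := ih (r j - r (pa v)) (by omega) (pa v) rfl hj'
  have hadj : (parentGraph ρ pa).Adj v (pa v) :=
    ⟨fun e => by rw [← e] at hlt; exact lt_irrefl _ hlt, .inl ⟨hvρ, rfl⟩⟩
  refine ⟨.cons hadj Q, fun u hu => ?_⟩
  rcases List.mem_cons.mp (by simpa using hu) with rfl | hu
  · exact hj
  · exact hQ u hu

/-- In a tree, the path from `a` to `b` is obtained by shortening the walk which climbs from `a` to
`j` and descends to `b`. -/
theorem mem_bag_of_mem_path {r : Fin p → ℕ} {ρ : Fin p} {pa : Fin p → Fin p}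
    (h1 : ∀ v ≠ ρ, r v < r (pa v))
    (h2 : ∀ v, ∀ j ∈ bag G r v, j ≠ v → v ≠ ρ ∧ j ∈ bag G r (pa v)) {a b j : Fin p}
    {P : (parentGraph ρ pa).Walk a b} (hP : P.IsPath) (ha : j ∈ bag G r a) (hb : j ∈ bag G r b) :
    ∀ u ∈ P.support, j ∈ bag G r u := by
  obtain ⟨Qa, hQa⟩ := exists_climbing_walk h1 h2 j _ a rfl ha
  obtain ⟨Qb, hQb⟩ := exists_climbing_walk h1 h2 j _ b rfl hb
  have heq : P = (Qa.append Qb.reverse).bypass :=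
    ((parentGraph_isTree h1).existsUnique_path a b).unique hP (Walk.bypass_isPath _)
  intro u hu
  rw [heq] at hu
  have := Walk.support_bypass_subset_support _ hu
  rw [Walk.mem_support_append_iff, Walk.support_reverse, List.mem_reverse] at this
  exact this.elim (hQa u) (hQb u)

/-- The junction tree of a perfect elimination ordering. -/
theorem IsChordal.exists_junctionTree (hp : 0 < p) (hG : IsChordal G) :
    ∃ T : JunctionTree G, ∀ V ∈ T.nodes, G.IsClique (V : Set (Fin p)) := by
  classical
  obtain ⟨r, hinj, hr⟩ := hG.exists_rank
  obtain ⟨ρ, pa, h1, h2⟩ := exists_parent hp hinj hr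
  let e : Fin p ≃ (Finset.univ.image (bag G r)) :=
    Equiv.ofBijective (fun v => ⟨bag G r v, Finset.mem_image_of_mem _ (Finset.mem_univ v)⟩)
      ⟨fun a b h => bag_injective hinj (Subtype.ext_iff.mp h), fun ⟨V, hV⟩ => by
        obtain ⟨v, -, rfl⟩ := Finset.mem_image.mp hV
        exact ⟨v, rfl⟩⟩
  have he : ∀ V, bag G r (e.symm V) = V.1 := fun V => congrArg Subtype.val (e.apply_symm_apply V)
  let I := SimpleGraph.Iso.comap e.symm (parentGraph ρ pa)
  refine ⟨⟨Finset.univ.image (bag G r), (parentGraph ρ pa).comap e.symm,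
    I.isTree_iff.mpr (parentGraph_isTree h1), ?_, ?_, ?_⟩, ?_⟩
  · exact fun j => ⟨bag G r j, Finset.mem_image_of_mem _ (Finset.mem_univ j), self_mem_bag⟩
  · intro j k hjk
    rcases lt_or_gt_of_ne (hinj.ne hjk.ne) with h | h
    · exact ⟨bag G r j, Finset.mem_image_of_mem _ (Finset.mem_univ j), self_mem_bag,
        mem_bag.mpr (.inr ⟨h, hjk⟩)⟩
    · exact ⟨bag G r k, Finset.mem_image_of_mem _ (Finset.mem_univ k),
        mem_bag.mpr (.inr ⟨h, hjk.symm⟩), self_mem_bag⟩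
  · intro V V' P hP j hj U hU
    obtain ⟨hj1, hj2⟩ := Finset.mem_inter.mp hj
    have hpath : (P.map I.toHom).IsPath := hP.map I.injective
    have := mem_bag_of_mem_path h1 h2 hpath (j := j) (by
      show j ∈ bag G r (e.symm V); rwa [he]) (by show j ∈ bag G r (e.symm V'); rwa [he])
      (e.symm U) (by
        rw [Walk.support_map]
        exact List.mem_map_of_mem (f := I.toHom) hU)
    rwa [he] at this
  · intro V hV a ha b hb hab
    obtain ⟨v, -, rfl⟩ := Finset.mem_image.mp hV
    rcases mem_bag.mp ha with rfl | ha
    · exact ((mem_bag.mp hb).resolve_left hab.symm).2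
    · rcases mem_bag.mp hb with rfl | hb
      · exact ha.2.symm
      · exact hr v a b ha.1 hb.1 ha.2 hb.2 hab

/-- The largest node of a junction tree whose nodes are cliques extends to a maximal clique. The `-
1` in the width is given away; the lower bound does not need it. -/
theorem IsChordal.exists_maxClique (hp : 0 < p) (hG : IsChordal G) :
    ∃ c ∈ maxCliques G, treewidth G ≤ c.card := by
  classical
  obtain ⟨T, hT⟩ := hG.exists_junctionTree hp
  obtain ⟨V, hV, -⟩ := T.covers ⟨0, hp⟩
  obtain ⟨W, hW, hsup⟩ := Finset.exists_mem_eq_sup _ ⟨V, hV⟩ Finset.card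
  have h1 : treewidth G ≤ W.card :=
    (Nat.sInf_le (s := {w : ℕ | ∃ T : JunctionTree G, T.width = w}) ⟨T, rfl⟩).trans ((Nat.sub_le _ _).trans hsup.le)
  have hfin : {c : Finset (Fin p) | G.IsClique (c : Set (Fin p))}.Finite := Set.toFinite _
  obtain ⟨c, hWc, hc⟩ := hfin.exists_le_maximal (a := W) (hT W hW)
  exact ⟨c, by simpa [maxCliques] using hc, h1.trans (Finset.card_le_card hWc)⟩

/-- The nodes containing `v` form a subtree, and any path from the root enters it at its node `W`
nearest to the root. Indeed, let `M` be the first node of `R` containing `v`. The path from `M` to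
`W` stays among nodes containing `v`, hence continues the initial part of `R` to a path from the
root to `W`. Minimality of the distance of `W` leaves no room between `M` and `W`. -/
theorem JunctionTree.mem_support_of_minimal (T : JunctionTree G) {r₀ U W : T.nodes} {v : Fin p}
    (hW : v ∈ W.1) (hmin : ∀ V : T.nodes, v ∈ V.1 → T.tree.dist r₀ W ≤ T.tree.dist r₀ V)
    {R : T.tree.Walk r₀ U} (hR : R.IsPath) (hU : v ∈ U.1) : W ∈ R.support := by
  classical
  have hex : ∃ i, v ∈ (R.getVert i).1 := ⟨R.length, by rwa [R.getVert_length]⟩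
  set i := Nat.find hex with hi
  have hM : v ∈ (R.getVert i).1 := Nat.find_spec hex
  obtain ⟨Q, hQ, -⟩ := T.isTree.existsUnique_path (R.getVert i) W
  have hQv := T.running_intersection _ _ Q hQ v (Finset.mem_inter.mpr ⟨hM, hW⟩)
  have hpath : ((R.take i).append Q).IsPath := by
    rw [Walk.isPath_def, Walk.support_append, List.nodup_append']
    refine ⟨(hR.take i).support_nodup, hQ.support_nodup.tail, ?_⟩
    intro x hx hxQ
    obtain ⟨k, rfl, hk⟩ := Walk.mem_support_iff_exists_getVert.mp hx
    rw [Walk.take_getVert] at hxQ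
    have hle : i ≤ i ⊓ k := Nat.find_min' hex (hQv _ (List.mem_of_mem_tail hxQ))
    have : i ⊓ k = i := le_antisymm inf_le_left hle
    rw [this] at hxQ
    have hnd := hQ.support_nodup
    rw [← Walk.cons_tail_support, List.nodup_cons] at hnd
    exact hnd.1 hxQ
  have hlen : ((R.take i).append Q).length = T.tree.dist r₀ W := by
    obtain ⟨P, hP, hPl⟩ := (T.isTree.connected r₀ W).exists_path_of_dist
    rw [← hPl, (T.isTree.existsUnique_path r₀ W).unique hpath hP]
  rw [Walk.length_append] at hlen
  have h1 := hmin _ hM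
  have h2 := T.tree.dist_le (R.take i)
  have hQ0 : Q.length = 0 := by omega
  rw [← Walk.eq_of_length_eq_zero hQ0]
  exact R.getVert_mem_support i

/-- Both `Wu` and `Wv` lie on the path from the root to the common node `U`. If `Wu` comes first,
`Wv` lies between two nodes containing `u`. In the other order the distances force `Wu = Wv`. -/
theorem JunctionTree.mem_of_dist_le (T : JunctionTree G) {r₀ U Wu Wv : T.nodes} {u v : Fin p}
    (hu : u ∈ Wu.1) (humin : ∀ V : T.nodes, u ∈ V.1 → T.tree.dist r₀ Wu ≤ T.tree.dist r₀ V)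
    (hv : v ∈ Wv.1) (hvmin : ∀ V : T.nodes, v ∈ V.1 → T.tree.dist r₀ Wv ≤ T.tree.dist r₀ V)
    (huU : u ∈ U.1) (hvU : v ∈ U.1) (hle : T.tree.dist r₀ Wu ≤ T.tree.dist r₀ Wv) :
    u ∈ Wv.1 := by
  obtain ⟨R, hR, -⟩ := T.isTree.existsUnique_path r₀ U
  have h1 := T.mem_support_of_minimal hu humin hR huU
  have h2 := T.mem_support_of_minimal hv hvmin hR hvU
  obtain ⟨R₁, R₂, hR₁, hR₂, rfl⟩ := hR.mem_support_iff_exists_append.mp h1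
  rcases (Walk.mem_support_append_iff _ _).mp h2 with h2 | h2
  · obtain ⟨A, B, hA, hB, rfl⟩ := hR₁.mem_support_iff_exists_append.mp h2
    obtain ⟨P, hP, hPl⟩ := (T.isTree.connected r₀ Wu).exists_path_of_dist
    rw [(T.isTree.existsUnique_path r₀ Wu).unique hP hR₁, Walk.length_append] at hPl
    have h3 := T.tree.dist_le A
    have hB0 : B.length = 0 := by omega
    rwa [Walk.eq_of_length_eq_zero hB0]
  · exact T.running_intersection _ _ R₂ hR₂ u (Finset.mem_inter.mpr ⟨hu, huU⟩) _ h2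

/-- The vertices of a chordal graph can be ordered so that each has at most `treewidth G`
neighbours which come later. -/
theorem IsChordal.exists_elimination_order (hp : 0 < p) (hG : IsChordal G) :
    ∃ σ : Equiv.Perm (Fin p), ∀ n, ∃ L : Finset (Fin p), L.card ≤ treewidth G ∧
      ∀ k, n < k → G.Adj (σ n) (σ k) → σ k ∈ L := by
  classical
  obtain ⟨T, hT⟩ : treewidth G ∈ {w : ℕ | ∃ T : JunctionTree G, T.width = w} :=
    Nat.sInf_mem ((hG.exists_junctionTree hp).elim fun T _ => ⟨T.width, T, rfl⟩)
  obtain ⟨V₀, hV₀, -⟩ := T.covers ⟨0, hp⟩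
  let r₀ : T.nodes := ⟨V₀, hV₀⟩
  have htop : ∀ v, ∃ W : T.nodes, v ∈ W.1 ∧
      ∀ V : T.nodes, v ∈ V.1 → T.tree.dist r₀ W ≤ T.tree.dist r₀ V := by
    intro v
    obtain ⟨V, hV, hvV⟩ := T.covers v
    obtain ⟨W, hW, hmin⟩ := Finset.exists_min_image
      (Finset.univ.filter fun V : T.nodes => v ∈ V.1) (T.tree.dist r₀)
      ⟨⟨V, hV⟩, by simpa using hvV⟩
    exact ⟨W, (Finset.mem_filter.mp hW).2, fun V hV => hmin V (by simpa using hV)⟩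
  choose top htop hmin using htop
  -- The order dual makes the sorting decreasing: vertices whose highest node is far from the root
  -- come first. Their later neighbours then all lie in that node.
  let d : Fin p → ℕᵒᵈ := fun v => OrderDual.toDual (T.tree.dist r₀ (top v))
  refine ⟨Tuple.sort d, fun n => ⟨(top (Tuple.sort d n)).1.erase (Tuple.sort d n), ?_, ?_⟩⟩
  · rw [Finset.card_erase_of_mem (htop _), ← hT, JunctionTree.width]
    exact Nat.sub_le_sub_right (Finset.le_sup (f := Finset.card) (top (Tuple.sort d n)).2) 1
  · intro k hnk hadj
    refine Finset.mem_erase.mpr ⟨hadj.ne', ?_⟩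
    obtain ⟨V, hV, h1, h2⟩ := T.covers_edge _ _ hadj
    have hle : d (Tuple.sort d n) ≤ d (Tuple.sort d k) := Tuple.monotone_sort d hnk.le
    exact T.mem_of_dist_le (U := ⟨V, hV⟩) (htop _) (hmin _) (htop _) (hmin _) h2 h1 hle

end Treewidth

end Knockoff

namespace Knockoff

/-! ### Runs of oracle procedures -/

namespace OracleProcedure

variable {p : ℕ} {β : Type} [MeasurableSpace β] (A : OracleProcedure p β)
  {Φ Φ' : (Fin p → ℝ) → ℝ} {x : Fin p → ℝ} {ω : A.Seed}

theorem answers_succ_of_inl {n : ℕ} {z : Fin p → ℝ} (h : A.step x ω (A.answers Φ x ω n) = .inl z) :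
    A.answers Φ x ω (n + 1) = A.answers Φ x ω n ++ [Φ z] := by
  simp only [answers, h]

theorem answers_succ_of_inr {n : ℕ} {b : β} (h : A.step x ω (A.answers Φ x ω n) = .inr b) :
    A.answers Φ x ω (n + 1) = A.answers Φ x ω n := by
  simp only [answers, h]

theorem answers_eq_of_result_isSome {n : ℕ} (h : (A.result Φ x ω n).isSome) (m : ℕ) :
    A.answers Φ x ω (n + m) = A.answers Φ x ω n := by
  induction m with
  | zero => rfl
  | succ m ih =>
    rw [result, Sum.isSome_getRight?_iff_isRight] at h
    obtain ⟨b, hb⟩ := Sum.isRight_iff.mp h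
    rw [← add_assoc, A.answers_succ_of_inr (b := b) (by rw [ih, hb]), ih]

/-- The points at which the density is evaluated. -/
def queried (Φ : (Fin p → ℝ) → ℝ) (x : Fin p → ℝ) (ω : A.Seed) : Set (Fin p → ℝ) :=
  {z | ∃ n, A.step x ω (A.answers Φ x ω n) = .inl z}

/-- A run cannot distinguish two densities which agree at all points queried. -/
theorem answers_congr (h : ∀ z ∈ A.queried Φ x ω, Φ' z = Φ z) (n : ℕ) :
    A.answers Φ' x ω n = A.answers Φ x ω n := by
  induction n with
  | zero => rfl
  | succ n ih =>
    cases hs : A.step x ω (A.answers Φ x ω n) with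
    | inl z =>
      rw [A.answers_succ_of_inl hs, A.answers_succ_of_inl (z := z) (by rw [ih, hs]), ih,
        h z ⟨n, hs⟩]
    | inr b =>
      rw [A.answers_succ_of_inr hs, A.answers_succ_of_inr (b := b) (by rw [ih, hs]), ih]

theorem output_congr [Inhabited β] (h : ∀ z ∈ A.queried Φ x ω, Φ' z = Φ z) :
    A.output Φ' x ω = A.output Φ x ω := by
  have : A.result Φ' x ω = A.result Φ x ω := funext fun n => by
    rw [result, result, A.answers_congr h]
  classical
  -- The proof inside `Option.get` depends on the sequence of results, so the sequence is
  -- generalized before the equality is used.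
  have aux : ∀ r r' : ℕ → Option β, r = r' →
      (if h : ∃ n, (r n).isSome then (r (Nat.find h)).get (Nat.find_spec h) else default) =
        if h : ∃ n, (r' n).isSome then (r' (Nat.find h)).get (Nat.find_spec h) else default := by
    rintro r _ rfl
    rfl
  unfold output
  convert aux _ _ this

theorem exists_result_isSome (h : A.numQueries Φ x ω < ⊤) : ∃ n, (A.result Φ x ω n).isSome := by
  by_contra hne
  push Not at hne
  simp [numQueries, hne] at h

theorem queried_subset {n : ℕ} (h : (A.result Φ x ω n).isSome) :
    A.queried Φ x ω ⊆ (fun k => (A.step x ω (A.answers Φ x ω k)).elim id fun _ => 0) ''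
      (Finset.range n : Set ℕ) := by
  rintro z ⟨m, hm⟩
  have hlt : m < n := by
    by_contra hge
    obtain ⟨k, rfl⟩ := Nat.exists_eq_add_of_le (not_lt.mp hge)
    rw [A.answers_eq_of_result_isSome h] at hm
    rw [result, hm] at h
    simp at h
  exact ⟨m, by simpa using hlt, by simp [hm]⟩

theorem finite_queried (h : A.numQueries Φ x ω < ⊤) : (A.queried Φ x ω).Finite := by
  obtain ⟨n, hn⟩ := A.exists_result_isSome h
  exact ((Finset.finite_toSet _).image _).subset (A.queried_subset hn)

theorem encard_queried_le : (A.queried Φ x ω).encard ≤ A.numQueries Φ x ω := by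
  refine le_iInf₂ fun n hn => ?_
  refine (Set.encard_le_encard (A.queried_subset hn)).trans ((Set.encard_image_le _ _).trans ?_)
  rw [Set.encard_coe_eq_coe_finsetCard, Finset.card_range]

/-! ### Measurability of the output. -/

/-- The first `n` answers, if the procedure does not stop earlier. -/
noncomputable def answerVec (Φ : (Fin p → ℝ) → ℝ) : (n : ℕ) → (Fin p → ℝ) × A.Seed → Fin n → ℝ
  | 0, _ => Fin.elim0
  | n + 1, a => Fin.snoc (answerVec Φ n a)
      (Φ ((A.step a.1 a.2 (List.ofFn (answerVec Φ n a))).elim id fun _ => 0))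

theorem measurable_step_answerVec {n : ℕ} (h : Measurable (A.answerVec Φ n)) :
    Measurable fun a : (Fin p → ℝ) × A.Seed => A.step a.1 a.2 (List.ofFn (A.answerVec Φ n a)) :=
  (A.measurable_step n).comp (measurable_fst.prodMk (measurable_snd.prodMk h))

theorem measurable_answerVec (hΦ : Measurable Φ) (n : ℕ) : Measurable (A.answerVec Φ n) := by
  induction n with
  | zero => exact measurable_pi_lambda _ fun i => i.elim0
  | succ n ih =>
    refine measurable_pi_lambda _ fun i => ?_
    induction i using Fin.lastCases with
    | last =>
      simp only [answerVec, Fin.snoc_last]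
      exact hΦ.comp ((measurable_id.sumElim measurable_const).comp (A.measurable_step_answerVec ih))
    | cast i =>
      simp only [answerVec, Fin.snoc_castSucc]
      exact (measurable_pi_apply i).comp ih

theorem answers_eq_ofFn {n : ℕ} (h : ∀ k < n, ¬ (A.result Φ x ω k).isSome) :
    A.answers Φ x ω n = List.ofFn (A.answerVec Φ n (x, ω)) := by
  induction n with
  | zero => simp [answers]
  | succ n ih =>
    have ih := ih fun k hk => h k (hk.trans n.lt_succ_self)
    have hn := h n n.lt_succ_self
    rw [result, Sum.isSome_getRight?_iff_isRight, Sum.not_isRight, Sum.isLeft_iff] at hn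
    obtain ⟨z, hz⟩ := hn
    rw [A.answers_succ_of_inl hz, List.ofFn_succ']
    simp only [answerVec, Fin.snoc_castSucc, Fin.snoc_last, ← ih, hz, Sum.elim_inl, id_eq,
      List.concat_eq_append]

/-- The number of answers is random, whereas measurability of `step` is known only for lists of
fixed length. The vector `answerVec` has fixed length, since it uses the dummy query `0` when there
is nothing to ask, and it agrees with the answers until the procedure stops. The output is then
assembled over the events that the procedure first stops after `n` queries. -/
theorem measurable_output [Inhabited β] (hΦ : Measurable Φ) :
    Measurable fun a : (Fin p → ℝ) × A.Seed => A.output Φ a.1 a.2 := by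
  classical
  let f : ℕ → (Fin p → ℝ) × A.Seed → (Fin p → ℝ) ⊕ β := fun n a =>
    A.step a.1 a.2 (List.ofFn (A.answerVec Φ n a))
  have hf : ∀ n, Measurable (f n) := fun n =>
    A.measurable_step_answerVec (A.measurable_answerVec hΦ n)
  have hresult : ∀ a n, (∀ k < n, ¬ (A.result Φ a.1 a.2 k).isSome) →
      A.result Φ a.1 a.2 n = (f n a).getRight? := fun a n h => by
    rw [result, A.answers_eq_ofFn h]
  -- The first time at which `f` returns an output is the stopping time, because up to then the
  -- surrogate answers are the true ones.
  have hiff : ∀ a n, (∃ k ≤ n, (A.result Φ a.1 a.2 k).isSome) ↔ ∃ k ≤ n, (f k a).isRight := by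
    intro a n
    constructor
    · intro hex
      have h : ∃ k, (A.result Φ a.1 a.2 k).isSome := hex.imp fun _ h => h.2
      obtain ⟨k, hkn, hk⟩ := hex
      refine ⟨Nat.find h, (Nat.find_min' h hk).trans hkn, ?_⟩
      have hs := Nat.find_spec h
      rwa [hresult a _ fun m hm => Nat.find_min h hm, Sum.isSome_getRight?_iff_isRight] at hs
    · rintro ⟨k, hkn, hk⟩
      by_contra hne
      have := hresult a k fun m hm h => hne ⟨m, hm.le.trans hkn, h⟩
      refine hne ⟨k, hkn, ?_⟩
      rwa [this, Sum.isSome_getRight?_iff_isRight]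
  have hright : ∀ n, MeasurableSet {a | (f n a).isRight} := fun n => by
    have : {a | (f n a).isRight} = f n ⁻¹' (Set.range Sum.inr) := by
      ext a; simp only [Set.mem_ofPred_eq, Sum.isRight_iff, Set.mem_preimage, Set.mem_range,
        @eq_comm _ (Sum.inr _)]
    rw [this]
    exact hf n (measurableSet_range_inr)
  have hhalt : ∀ n, MeasurableSet {a : (Fin p → ℝ) × A.Seed |
      ∃ k ≤ n, (A.result Φ a.1 a.2 k).isSome} := fun n => by
    simp only [hiff]
    have : {a | ∃ k ≤ n, (f k a).isRight} = ⋃ k ≤ n, {a | (f k a).isRight} := by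
      ext a; simp
    rw [this]
    exact .biUnion (Set.to_countable _) fun k _ => hright k
  let g : ℕ → (Fin p → ℝ) × A.Seed → β := fun n a => (f n a).elim (fun _ => default) id
  have hg : ∀ n, Measurable (g n) := fun n => (measurable_const.sumElim measurable_id).comp (hf n)
  let S : ℕ → Set ((Fin p → ℝ) × A.Seed) := fun n =>
    {a | ∃ k ≤ n, (A.result Φ a.1 a.2 k).isSome}
  intro t ht
  have hset : (fun a : (Fin p → ℝ) × A.Seed => A.output Φ a.1 a.2) ⁻¹' t =
      (⋃ n, ({a | (f n a).isRight} ∩ g n ⁻¹' t) \ ⋃ k < n, S k) ∪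
        ((⋃ n, S n)ᶜ ∩ {_a | (default : β) ∈ t}) := by
    ext a
    by_cases hex : ∃ n, (A.result Φ a.1 a.2 n).isSome
    · have hout : A.output Φ a.1 a.2 = g (Nat.find hex) a := by
        have h1 := hresult a _ fun m hm => Nat.find_min hex hm
        rw [output, dif_pos hex]
        have h2 := Nat.find_spec hex
        apply Option.some_injective
        rw [Option.some_get, h1]
        rw [h1, Sum.isSome_getRight?_iff_isRight, Sum.isRight_iff] at h2
        obtain ⟨b, hb⟩ := h2
        simp [g, hb]
      have hr : (f (Nat.find hex) a).isRight := by
        have h1 := hresult a _ fun m hm => Nat.find_min hex hm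
        have h2 := Nat.find_spec hex
        rwa [h1, Sum.isSome_getRight?_iff_isRight] at h2
      simp only [Set.mem_preimage, hout, Set.mem_union, Set.mem_iUnion, Set.mem_sdiff,
        Set.mem_inter_iff, Set.mem_compl_iff, Set.mem_ofPred_eq, S]
      constructor
      · intro h
        refine .inl ⟨Nat.find hex, ⟨hr, h⟩, ?_⟩
        rintro ⟨k, hk, m, hm, hm'⟩
        exact Nat.find_min hex (hm.trans_lt hk) hm'
      · rintro (⟨n, ⟨h1, h2⟩, h3⟩ | ⟨h1, -⟩)
        · have : n = Nat.find hex := by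
            push Not at h3
            have hle : Nat.find hex ≤ n := by
              obtain ⟨k, hk, hk'⟩ := (hiff a n).mpr ⟨n, le_rfl, h1⟩
              exact (Nat.find_min' hex hk').trans hk
            by_contra hne
            have hlt : Nat.find hex < n := lt_of_le_of_ne hle (Ne.symm hne)
            have h4 := h3 _ hlt _ le_rfl
            exact h4 (Nat.find_spec hex)
          rwa [← this]
        · exact absurd ⟨_, _, le_rfl, Nat.find_spec hex⟩ h1
    · have hout : A.output Φ a.1 a.2 = default := by rw [output, dif_neg hex]
      have hnot : ∀ n, a ∉ S n := fun n ⟨k, _, hk⟩ => hex ⟨k, hk⟩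
      have hnot' : ∀ n, ¬ (f n a).isRight := fun n hn =>
        hnot n ((hiff a n).mpr ⟨n, le_rfl, hn⟩)
      simp [hout, hnot, hnot']
  rw [hset]
  refine .union (.iUnion fun n => ((hright n).inter (hg n ht)).diff
    (.iUnion fun k => .iUnion fun _ => hhalt k)) ((MeasurableSet.iUnion hhalt).compl.inter
      (.const _))

end OracleProcedure

theorem IsGraphicalDensity.measurable {p : ℕ} {G : SimpleGraph (Fin p)} {Φ : (Fin p → ℝ) → ℝ}
    (h : IsGraphicalDensity G Φ) : Measurable Φ := by
  obtain ⟨φ, h1, -, h3⟩ := h.factors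
  rw [funext h3]
  exact Finset.measurable_prod _ fun c _ => (h1 c).comp (Finset.measurable_restrict c)

theorem IsGraphicalDensity.nonneg {p : ℕ} {G : SimpleGraph (Fin p)} {Φ : (Fin p → ℝ) → ℝ}
    (h : IsGraphicalDensity G Φ) (x : Fin p → ℝ) : 0 ≤ Φ x := by
  obtain ⟨φ, -, h2, h3⟩ := h.factors
  rw [h3]
  exact Finset.prod_nonneg fun c _ => h2 c _

end Knockoff

namespace Knockoff

/-! ### The lower bound -/

section LowerBound

variable {p : ℕ} {G : SimpleGraph (Fin p)} {Φ : (Fin p → ℝ) → ℝ}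

/-- The points whose coordinates in `c` are within `ρ` of those of `t`. -/
def cylinder (c : Finset (Fin p)) (t : Fin p → ℝ) (ρ : ℝ) : Set (Fin p → ℝ) :=
  {z | ∀ j ∈ c, |z j - t j| < ρ}

theorem measurableSet_cylinder (c : Finset (Fin p)) (t : Fin p → ℝ) (ρ : ℝ) :
    MeasurableSet (cylinder c t ρ) := by
  have : cylinder c t ρ = ⋂ j ∈ c, {z : Fin p → ℝ | |z j - t j| < ρ} := by ext; simp [cylinder]
  rw [this]
  exact .biInter (Set.to_countable _) fun j _ =>
    measurableSet_lt (by fun_prop) measurable_const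

open Classical in
/-- The density `Φ` multiplied by `δ` on a cylinder. -/
noncomputable def damp (Φ : (Fin p → ℝ) → ℝ) (c : Finset (Fin p)) (t : Fin p → ℝ) (ρ δ : ℝ) :
    (Fin p → ℝ) → ℝ :=
  fun z => (if z ∈ cylinder c t ρ then δ else 1) * Φ z

theorem damp_of_notMem {c : Finset (Fin p)} {t : Fin p → ℝ} {ρ δ : ℝ} {z : Fin p → ℝ}
    (h : z ∉ cylinder c t ρ) : damp Φ c t ρ δ z = Φ z := by
  simp [damp, h]

theorem support_damp {c : Finset (Fin p)} {t : Fin p → ℝ} {ρ δ : ℝ} (hδ : 0 < δ) :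
    Function.support (damp Φ c t ρ δ) = Function.support Φ := by
  ext z
  by_cases h : z ∈ cylinder c t ρ <;> simp [damp, h, hδ.ne']

theorem IsGraphicalDensity.damp (hΦ : IsGraphicalDensity G Φ) {c : Finset (Fin p)}
    (hc : c ∈ maxCliques G) (t : Fin p → ℝ) (ρ : ℝ) {δ : ℝ} (hδ : 0 < δ) (hδ1 : δ ≤ 1) :
    IsGraphicalDensity G (damp Φ c t ρ δ) := by
  classical
  refine ⟨?_, ?_, ?_⟩
  · obtain ⟨φ, h1, h2, h3⟩ := hΦ.factors
    refine ⟨fun d w => (if d = c ∧ ∀ j : d, |w j - t j| < ρ then δ else 1) * φ d w, ?_, ?_, ?_⟩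
    · intro d
      refine Measurable.mul (Measurable.ite ?_ measurable_const measurable_const) (h1 d)
      have : {w : d → ℝ | d = c ∧ ∀ j : d, |w j - t j| < ρ} =
          {_w | d = c} ∩ ⋂ j : d, {w | |w j - t j| < ρ} := by ext; simp
      rw [this]
      exact (MeasurableSet.const _).inter (.iInter fun j =>
        measurableSet_lt (by fun_prop) measurable_const)
    · intro d w
      refine mul_nonneg ?_ (h2 d w)
      split_ifs
      · exact hδ.le
      · exact zero_le_one
    · intro x
      rw [Finset.prod_mul_distrib, ← h3, Finset.prod_eq_single_of_mem c hc]
      · by_cases h : x ∈ cylinder c t ρ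
        · rw [if_pos ⟨rfl, fun j => h j j.2⟩, Knockoff.damp, if_pos h]
        · rw [if_neg fun h' => h fun j hj => h'.2 ⟨j, hj⟩, Knockoff.damp, if_neg h]
      · intro d _ hd
        simp [hd]
  · refine lt_of_lt_of_le (ENNReal.mul_pos (ENNReal.ofReal_pos.mpr hδ).ne' hΦ.pos.ne') ?_
    rw [← lintegral_const_mul _ hΦ.measurable.ennreal_ofReal]
    refine lintegral_mono fun z => ?_
    dsimp only
    rw [← ENNReal.ofReal_mul hδ.le]
    refine ENNReal.ofReal_le_ofReal (mul_le_mul_of_nonneg_right ?_ (hΦ.nonneg z))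
    split_ifs
    · exact le_rfl
    · exact hδ1
  · refine lt_of_le_of_lt (lintegral_mono fun z => ?_) hΦ.finite
    refine ENNReal.ofReal_le_ofReal (mul_le_of_le_one_left (hΦ.nonneg z) ?_)
    split_ifs
    · exact hδ1
    · exact le_rfl

theorem measurable_swap (j : Fin p) : Measurable (swap j) := by
  unfold swap
  refine Measurable.prodMk ?_ ?_
  · exact measurable_update'.comp
      (measurable_fst.prodMk ((measurable_pi_apply j).comp measurable_snd))
  · exact measurable_update'.comp
      (measurable_snd.prodMk ((measurable_pi_apply j).comp measurable_fst))

/-- The pairs whose components are within `ρ`, coordinatewise, of `a` and `b`. -/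
def boxAt (a b : Fin p → ℝ) (ρ : ℝ) : Set ((Fin p → ℝ) × (Fin p → ℝ)) :=
  {z | ∀ j, |z.1 j - a j| < ρ ∧ |z.2 j - b j| < ρ}

theorem measurableSet_boxAt (a b : Fin p → ℝ) (ρ : ℝ) : MeasurableSet (boxAt a b ρ) := by
  have : boxAt a b ρ = ⋂ j, ({z : (Fin p → ℝ) × (Fin p → ℝ) | |z.1 j - a j| < ρ} ∩
      {z | |z.2 j - b j| < ρ}) := by ext; simp [boxAt]
  rw [this]
  exact .iInter fun j => (measurableSet_lt (by fun_prop) measurable_const).inter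
    (measurableSet_lt (by fun_prop) measurable_const)

/-- The coordinates of `B` are swapped one at a time. -/
theorem PairwiseExchangeable.boxAt_eq {ν : Measure ((Fin p → ℝ) × (Fin p → ℝ))}
    (h : PairwiseExchangeable ν) (a b : Fin p → ℝ) (ρ : ℝ) (B : Finset (Fin p)) :
    ν (boxAt (B.piecewise b a) (B.piecewise a b) ρ) = ν (boxAt a b ρ) := by
  classical
  induction B using Finset.induction_on with
  | empty => simp
  | insert j B hj ih =>
    rw [← ih, ← h j, Measure.map_apply (measurable_swap j) (measurableSet_boxAt _ _ _), h j]
    congr 1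
    ext z
    simp only [Set.mem_preimage, boxAt, Set.mem_ofPred_eq, swap]
    refine forall_congr' fun k => ?_
    by_cases hk : k = j
    · subst hk
      simp [hj, and_comm]
    · by_cases hkB : k ∈ B <;> simp [Finset.piecewise, hk, hkB]

/-- The runs which stop, with input near `a` and output near `b`, without a query in a cylinder. -/
def avoidingRuns (A : OracleProcedure p (Fin p → ℝ)) (Φ : (Fin p → ℝ) → ℝ) (c : Finset (Fin p))
    (a b t : Fin p → ℝ) (ρ : ℝ) : Set ((Fin p → ℝ) × A.Seed) :=
  {w | (w.1, A.output Φ w.1 w.2) ∈ boxAt a b ρ ∧ ∀ z ∈ A.queried Φ w.1 w.2, z ∉ cylinder c t ρ}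

/-- Runs which avoid the cylinder are the same for `Φ` and for its damped version. For the latter,
exchanging the coordinates in `B` turns an outcome near `(a, b)` into one whose input lies in the
cylinder, where the density has been multiplied by `δ`. -/
theorem runLaw_avoidingRuns_le (A : OracleProcedure p (Fin p → ℝ)) (hΦ : IsGraphicalDensity G Φ)
    {c B : Finset (Fin p)} (hc : c ∈ maxCliques G) (hB : B.Nonempty) (hBc : B ⊆ c)
    {a b : Fin p → ℝ} {ρ δ : ℝ} (hρ : ∀ j, 2 * ρ ≤ |a j - b j|) (hδ : 0 < δ) (hδ1 : δ ≤ 1)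
    (hex : PairwiseExchangeable ((A.runLaw (damp Φ c (B.piecewise b a) ρ δ)).map
      fun w => (w.1, A.output (damp Φ c (B.piecewise b a) ρ δ) w.1 w.2))) :
    A.runLaw Φ (avoidingRuns A Φ c a b (B.piecewise b a) ρ) ≤ ENNReal.ofReal δ := by
  classical
  set t := B.piecewise b a with ht
  set R := cylinder c t ρ with hR
  set Φ' := damp Φ c t ρ δ with hΦ'
  set E := avoidingRuns A Φ c a b t ρ with hE
  have hΦ'g : IsGraphicalDensity G Φ' := hΦ.damp hc t ρ hδ hδ1
  have hRm : MeasurableSet R := measurableSet_cylinder _ _ _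
  set μ := volume.withDensity fun z => ENNReal.ofReal (Φ z) with hμ
  set μ' := volume.withDensity fun z => ENNReal.ofReal (Φ' z) with hμ'
  set Z := ∫⁻ z, ENNReal.ofReal (Φ z) with hZ
  set Z' := ∫⁻ z, ENNReal.ofReal (Φ' z) with hZ'
  have hrestr : μ.restrict Rᶜ = μ'.restrict Rᶜ := by
    rw [hμ, hμ', restrict_withDensity hRm.compl, restrict_withDensity hRm.compl]
    refine withDensity_congr_ae ?_
    filter_upwards [ae_restrict_mem hRm.compl] with z hz
    rw [hΦ', damp_of_notMem hz]
  have hμ'R : μ' R ≤ ENNReal.ofReal δ * Z := by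
    rw [hμ', withDensity_apply _ hRm, hZ, ← lintegral_const_mul _ hΦ.measurable.ennreal_ofReal]
    refine (setLIntegral_mono_ae (hΦ.measurable.ennreal_ofReal.const_mul _).aemeasurable ?_).trans
      (setLIntegral_le_lintegral R _)
    refine Filter.Eventually.of_forall fun z hz => ?_
    rw [hΦ', ← ENNReal.ofReal_mul hδ.le]
    simp [damp, ← hR, hz]
  have hμfin : IsFiniteMeasure μ := ⟨by
    rw [hμ, withDensity_apply _ .univ, Measure.restrict_univ]; exact hΦ.finite⟩
  have hμ'fin : IsFiniteMeasure μ' := ⟨by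
    rw [hμ', withDensity_apply _ .univ, Measure.restrict_univ]; exact hΦ'g.finite⟩
  have hrun : A.runLaw Φ = Z⁻¹ • μ.prod A.seedLaw := by
    rw [OracleProcedure.runLaw, law, Measure.prod_smul_left]
  have hrun' : A.runLaw Φ' = Z'⁻¹ • μ'.prod A.seedLaw := by
    rw [OracleProcedure.runLaw, law, Measure.prod_smul_left]
  -- Here `B` must be nonempty: on `B` the centre of the cylinder has the coordinates of `b`, which
  -- are at distance at least `2 * ρ` from those of `a`. Hence the inputs of avoiding runs lie where
  -- the two densities agree.
  have hER : E ⊆ Rᶜ ×ˢ Set.univ := by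
    rintro ⟨x, ω⟩ ⟨h1, -⟩
    refine ⟨fun hx => ?_, Set.mem_univ _⟩
    obtain ⟨j, hj⟩ := hB
    have h2 := hx j (hBc hj)
    have h3 := (h1 j).1
    have h4 := hρ j
    simp only [ht, Finset.piecewise_eq_of_mem _ _ _ hj] at h2
    dsimp only at h2 h3
    rw [abs_lt] at h2 h3
    rcases le_abs.mp h4 with h4 | h4 <;> linarith
  have hEprod : μ.prod A.seedLaw E = μ'.prod A.seedLaw E := by
    rw [← Measure.restrict_eq_self _ hER, ← Measure.restrict_eq_self (μ'.prod _) hER,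
      ← Measure.prod_restrict, ← Measure.prod_restrict, hrestr]
  have hEsub : E ⊆ (fun w => (w.1, A.output Φ' w.1 w.2)) ⁻¹' boxAt a b ρ := by
    rintro ⟨x, ω⟩ ⟨h1, h2⟩
    have : A.output Φ' x ω = A.output Φ x ω :=
      A.output_congr fun z hz => damp_of_notMem (h2 z hz)
    simpa [this] using h1
  have hm : Measurable fun w : (Fin p → ℝ) × A.Seed => (w.1, A.output Φ' w.1 w.2) :=
    measurable_fst.prodMk (A.measurable_output hΦ'g.measurable)
  have hZ'0 : Z' ≠ 0 := hΦ'g.pos.ne'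
  have hZ'top : Z' ≠ ∞ := hΦ'g.finite.ne
  have hbound : A.runLaw Φ' E ≤ Z'⁻¹ * μ' R := by
    calc A.runLaw Φ' E ≤ A.runLaw Φ' ((fun w => (w.1, A.output Φ' w.1 w.2)) ⁻¹' boxAt a b ρ) :=
          measure_mono hEsub
      _ = (A.runLaw Φ').map (fun w => (w.1, A.output Φ' w.1 w.2)) (boxAt a b ρ) :=
          (Measure.map_apply hm (measurableSet_boxAt _ _ _)).symm
      _ = (A.runLaw Φ').map (fun w => (w.1, A.output Φ' w.1 w.2))
            (boxAt (B.piecewise b a) (B.piecewise a b) ρ) := (hex.boxAt_eq a b ρ B).symm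
      _ = A.runLaw Φ' ((fun w => (w.1, A.output Φ' w.1 w.2)) ⁻¹'
            boxAt (B.piecewise b a) (B.piecewise a b) ρ) :=
          Measure.map_apply hm (measurableSet_boxAt _ _ _)
      _ ≤ A.runLaw Φ' (R ×ˢ Set.univ) :=
          measure_mono fun w hw => ⟨fun j _ => (hw j).1, Set.mem_univ _⟩
      _ = Z'⁻¹ * μ' R := by
          rw [hrun', Measure.smul_apply, Measure.prod_prod, measure_univ, mul_one, smul_eq_mul]
  -- The normalizing constant of the damped density cancels, so no bound for it is needed.
  have hprod : μ'.prod A.seedLaw E ≤ μ' R := by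
    rw [hrun', Measure.smul_apply, smul_eq_mul] at hbound
    exact (ENNReal.mul_le_mul_iff_right (ENNReal.inv_ne_zero.mpr hZ'top)
      (ENNReal.inv_ne_top.mpr hZ'0)).mp hbound
  rw [hrun, Measure.smul_apply, smul_eq_mul, hEprod]
  calc Z⁻¹ * μ'.prod A.seedLaw E ≤ Z⁻¹ * (ENNReal.ofReal δ * Z) :=
        mul_le_mul_right (hprod.trans hμ'R) _
    _ = ENNReal.ofReal δ := by
        rw [mul_comm, mul_assoc, ENNReal.mul_inv_cancel hΦ.pos.ne' hΦ.finite.ne, mul_one]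

/-- The relevant gaps are made at least `4 * ρ`. Rational approximation moves each coordinate by
less than `ρ`, which leaves boxes separated by `2 * ρ` and keeps the finitely many queries out of
the cylinder. Rational centres make the family of exceptional events countable. -/
theorem exists_rat_box {a b : Fin p → ℝ} (h : ∀ j, a j ≠ b j) {Q : Set (Fin p → ℝ)}
    (hQ : Q.Finite) {c B : Finset (Fin p)} (hne : ∀ z ∈ Q, ∃ j ∈ c, z j ≠ B.piecewise b a j) :
    ∃ (n : ℕ) (r s : Fin p → ℚ),
      (∀ j, 2 * (1 / ((n : ℝ) + 1)) ≤ |(r j : ℝ) - s j|) ∧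
      (∀ j, |a j - r j| < 1 / ((n : ℝ) + 1) ∧ |b j - s j| < 1 / ((n : ℝ) + 1)) ∧
      ∀ z ∈ Q, z ∉ cylinder c (B.piecewise (fun j => (s j : ℝ)) fun j => (r j : ℝ))
        (1 / ((n : ℝ) + 1)) := by
  classical
  have key : ∀ ε : ℝ, 0 < ε → ∀ᶠ n : ℕ in Filter.atTop, 4 * (1 / ((n : ℝ) + 1)) ≤ ε := by
    intro ε hε
    have h0 : (0 : ℝ) < ε / 4 := by positivity
    filter_upwards [(tendsto_one_div_add_atTop_nhds_zero_nat (𝕜 := ℝ)).eventually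
      (ge_mem_nhds h0)] with n hn
    linarith
  have h1 : ∀ᶠ n : ℕ in Filter.atTop, ∀ j, 4 * (1 / ((n : ℝ) + 1)) ≤ |a j - b j| :=
    Filter.eventually_all.mpr fun j => key _ (abs_pos.mpr (sub_ne_zero.mpr (h j)))
  have h2 : ∀ᶠ n : ℕ in Filter.atTop, ∀ z ∈ Q, ∃ j ∈ c,
      4 * (1 / ((n : ℝ) + 1)) ≤ |z j - B.piecewise b a j| := by
    refine (Filter.eventually_all_finite hQ).mpr fun z hz => ?_
    obtain ⟨j, hj, hzj⟩ := hne z hz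
    filter_upwards [key _ (abs_pos.mpr (sub_ne_zero.mpr hzj))] with n hn
    exact ⟨j, hj, hn⟩
  obtain ⟨n, h1, h2⟩ := (h1.and h2).exists
  have hρ : 0 < 1 / ((n : ℝ) + 1) := by positivity
  set ρ := 1 / ((n : ℝ) + 1) with hρdef
  have hr : ∀ x : ℝ, ∃ q : ℚ, |x - q| < ρ := fun x => by
    obtain ⟨q, hq1, hq2⟩ := exists_rat_btwn (lt_add_of_pos_right x hρ)
    exact ⟨q, by rw [abs_lt]; constructor <;> linarith⟩
  choose f hf using hr
  refine ⟨n, fun j => f (a j), fun j => f (b j), fun j => ?_, fun j => ⟨hf _, hf _⟩, ?_⟩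
  · have ha := hf (a j)
    have hb := hf (b j)
    have hab := h1 j
    rw [abs_lt] at ha hb
    rcases le_abs.mp hab with hab | hab
    · exact le_abs.mpr (.inl (by linarith))
    · exact le_abs.mpr (.inr (by linarith))
  · intro z hz hzc
    obtain ⟨j, hj, hzj⟩ := h2 z hz
    have h3 := hzc j hj
    have ha := hf (a j)
    have hb := hf (b j)
    rw [abs_lt] at ha hb h3
    by_cases hjB : j ∈ B
    · simp only [Finset.piecewise_eq_of_mem _ _ _ hjB] at h3 hzj
      rcases le_abs.mp hzj with hzj | hzj <;> linarith
    · simp only [Finset.piecewise_eq_of_notMem _ _ _ hjB] at h3 hzj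
      rcases le_abs.mp hzj with hzj | hzj <;> linarith

/-- Each avoiding event with rational data has probability at most `δ` for every `δ > 0`, hence
zero. A run with finitely many queries which violates the claim belongs to one of these countably
many events. -/
theorem ae_exists_queried (A : OracleProcedure p (Fin p → ℝ)) {D : Set (Fin p → ℝ)}
    (hA : ∀ Φ : (Fin p → ℝ) → ℝ, IsGraphicalDensity G Φ → Function.support Φ = D →
        (∀ᵐ a ∂(A.runLaw Φ), A.numQueries Φ a.1 a.2 < ⊤) ∧
        PairwiseExchangeable ((A.runLaw Φ).map fun a => (a.1, A.output Φ a.1 a.2)))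
    (hΦ : IsGraphicalDensity G Φ) (hD : Function.support Φ = D)
    {c B : Finset (Fin p)} (hc : c ∈ maxCliques G) (hB : B.Nonempty) (hBc : B ⊆ c) :
    ∀ᵐ a ∂(A.runLaw Φ), (∀ j, a.1 j ≠ A.output Φ a.1 a.2 j) → ∃ z ∈ A.queried Φ a.1 a.2,
      ∀ j ∈ c, z j = B.piecewise (A.output Φ a.1 a.2) a.1 j := by
  classical
  have hnull : ∀ᵐ a ∂(A.runLaw Φ), ∀ (n : ℕ) (r s : Fin p → ℚ),
      (∀ j, 2 * (1 / ((n : ℝ) + 1)) ≤ |(r j : ℝ) - s j|) →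
      a ∉ avoidingRuns A Φ c (fun j => (r j : ℝ)) (fun j => (s j : ℝ))
        (B.piecewise (fun j => (s j : ℝ)) fun j => (r j : ℝ)) (1 / ((n : ℝ) + 1)) := by
    rw [ae_all_iff]; intro n
    rw [ae_all_iff]; intro r
    rw [ae_all_iff]; intro s
    by_cases hrs : ∀ j, 2 * (1 / ((n : ℝ) + 1)) ≤ |(r j : ℝ) - s j|
    · suffices h : A.runLaw Φ (avoidingRuns A Φ c (fun j => (r j : ℝ)) (fun j => (s j : ℝ))
          (B.piecewise (fun j => (s j : ℝ)) fun j => (r j : ℝ)) (1 / ((n : ℝ) + 1))) = 0 by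
        filter_upwards [measure_eq_zero_iff_ae_notMem.mp h] with a ha _ using ha
      refine le_antisymm (ENNReal.le_of_forall_pos_le_add fun ε hε _ => ?_) zero_le
      rw [zero_add]
      have hδ : 0 < min (ε : ℝ) 1 := lt_min hε one_pos
      refine (runLaw_avoidingRuns_le A hΦ hc hB hBc hrs hδ (min_le_right _ _)
        (hA _ (hΦ.damp hc _ _ hδ (min_le_right _ _)) ((support_damp hδ).trans hD)).2).trans ?_
      exact (ENNReal.ofReal_le_ofReal (min_le_left _ _)).trans (by simp)
    · exact Filter.Eventually.of_forall fun a h => absurd h hrs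
  filter_upwards [hnull, (hA Φ hΦ hD).1] with a ha hfin hne
  by_contra hno
  push Not at hno
  obtain ⟨n, r, s, h1, h2, h3⟩ := exists_rat_box hne (A.finite_queried hfin) hno
  exact ha n r s h1 ⟨h2, h3⟩

theorem lower_bound (hp : 0 < p) (hG : IsChordal G) (A : OracleProcedure p (Fin p → ℝ))
    {D : Set (Fin p → ℝ)}
    (hA : ∀ Φ : (Fin p → ℝ) → ℝ, IsGraphicalDensity G Φ → Function.support Φ = D →
        (∀ᵐ a ∂(A.runLaw Φ), A.numQueries Φ a.1 a.2 < ⊤) ∧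
        PairwiseExchangeable ((A.runLaw Φ).map fun a => (a.1, A.output Φ a.1 a.2)))
    (hΦ : IsGraphicalDensity G Φ) (hD : Function.support Φ = D) :
    ∀ᵐ a ∂(A.runLaw Φ), (∀ j, a.1 j ≠ A.output Φ a.1 a.2 j) →
      ((2 ^ treewidth G - 1 : ℕ) : ℕ∞) ≤ A.numQueries Φ a.1 a.2 := by
  classical
  obtain ⟨c, hc, hcard⟩ := hG.exists_maxClique hp
  have hall : ∀ᵐ a ∂(A.runLaw Φ), ∀ B : Finset (Fin p), B.Nonempty → B ⊆ c →
      (∀ j, a.1 j ≠ A.output Φ a.1 a.2 j) → ∃ z ∈ A.queried Φ a.1 a.2,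
        ∀ j ∈ c, z j = B.piecewise (A.output Φ a.1 a.2) a.1 j := by
    rw [ae_all_iff]; intro B
    by_cases hB : B.Nonempty
    · by_cases hBc : B ⊆ c
      · filter_upwards [ae_exists_queried A hA hΦ hD hc hB hBc] with a ha _ _ using ha
      · exact Filter.Eventually.of_forall fun a _ h => absurd h hBc
    · exact Filter.Eventually.of_forall fun a h => absurd h hB
  filter_upwards [hall] with a ha hne
  refine le_trans ?_ A.encard_queried_le
  choose! f hf1 hf2 using fun B (hB : B ∈ c.powerset.erase ∅) =>
    ha B (Finset.nonempty_iff_ne_empty.mpr (Finset.mem_erase.mp hB).1)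
      (Finset.mem_powerset.mp (Finset.mem_erase.mp hB).2) hne
  -- The query for `B` determines `B`, since input and output differ in every coordinate.
  have hinj : Set.InjOn f (c.powerset.erase ∅ : Finset (Finset (Fin p))) := by
    intro B hB B' hB' h
    have hBc := Finset.mem_powerset.mp (Finset.mem_erase.mp hB).2
    have hBc' := Finset.mem_powerset.mp (Finset.mem_erase.mp hB').2
    ext j
    by_cases hj : j ∈ c
    · have h1 := hf2 B hB j hj
      have h2 := hf2 B' hB' j hj
      rw [h, h2] at h1
      by_cases hjB : j ∈ B <;> by_cases hjB' : j ∈ B' <;> simp [hjB, hjB'] at h1 ⊢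
      · exact hne j h1
      · exact hne j h1.symm
    · exact iff_of_false (fun h => hj (hBc h)) (fun h => hj (hBc' h))
  have hsub : f '' (c.powerset.erase ∅ : Finset (Finset (Fin p))) ⊆ A.queried Φ a.1 a.2 := by
    rintro _ ⟨B, hB, rfl⟩
    exact hf1 B hB
  refine le_trans ?_ (Set.encard_le_encard hsub)
  rw [hinj.encard_image, Set.encard_coe_eq_coe_finsetCard,
    Finset.card_erase_of_mem (Finset.empty_mem_powerset c), Finset.card_powerset]
  exact_mod_cast Nat.sub_le_sub_right (Nat.pow_le_pow_right two_pos hcard) 1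

end LowerBound

end Knockoff

namespace Knockoff

/-! ### Exchangeability of Metro -/

section Metro

variable {p : ℕ} {Φ : (Fin p → ℝ) → ℝ} {σ : Equiv.Perm (Fin p)}
  {q : Fin p → (Fin p → ℝ) → (Fin p → ℝ) → (Fin p → Bool) → ℝ → ℝ}

theorem acceptProb_le_one (g : (Fin p → ℝ) → (Fin p → ℝ) → (Fin p → Bool) → ℝ) (n : Fin p)
    (x y : Fin p → ℝ) (u : Fin p → Bool) : acceptProb σ q g n x y u ≤ 1 := min_le_left _ _

theorem acceptProb_nonneg {g : (Fin p → ℝ) → (Fin p → ℝ) → (Fin p → Bool) → ℝ}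
    (hq : ∀ n x y u t, 0 ≤ q n x y u t) (hg : ∀ x y u, 0 ≤ g x y u) (n : Fin p)
    (x y : Fin p → ℝ) (u : Fin p → Bool) : 0 ≤ acceptProb σ q g n x y u :=
  le_min zero_le_one (div_nonneg (mul_nonneg (hq ..) (hg ..)) (mul_nonneg (hq ..) (hg ..)))

theorem metroDensity_succ (n : Fin p) (x y : Fin p → ℝ) (u : Fin p → Bool) :
    metroDensity Φ σ q (n + 1) x y u = metroDensity Φ σ q n x y u * (q n x y u (y (σ n)) *
      (if u (σ n) then acceptProb σ q (metroDensity Φ σ q n) n x y u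
        else 1 - acceptProb σ q (metroDensity Φ σ q n) n x y u)) := by
  conv_lhs => rw [metroDensity]
  simp

theorem metroDensity_succ_of_not_lt {n : ℕ} (h : ¬ n < p) :
    metroDensity Φ σ q (n + 1) = metroDensity Φ σ q n := by
  funext x y u
  conv_lhs => rw [metroDensity]
  simp [h]

theorem metroDensity_nonneg (hΦ : ∀ x, 0 ≤ Φ x) (hq : ∀ n x y u t, 0 ≤ q n x y u t) (n : ℕ) :
    ∀ x y u, 0 ≤ metroDensity Φ σ q n x y u := by
  induction n with
  | zero => exact fun x _ _ => hΦ x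
  | succ n ih =>
    intro x y u
    by_cases h : n < p
    · rw [show n + 1 = (⟨n, h⟩ : Fin p).val + 1 from rfl, metroDensity_succ]
      refine mul_nonneg (ih x y u) (mul_nonneg (hq ..) ?_)
      split_ifs
      · exact acceptProb_nonneg hq ih _ x y u
      · exact sub_nonneg.mpr (acceptProb_le_one _ _ x y u)
    · rw [metroDensity_succ_of_not_lt h]
      exact ih x y u

theorem metroDensity_eq_prod (x y : Fin p → ℝ) (u : Fin p → Bool) :
    metroDensity Φ σ q p x y u = Φ x * ∏ n, (q n x y u (y (σ n)) *
      (if u (σ n) then acceptProb σ q (metroDensity Φ σ q n) n x y u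
        else 1 - acceptProb σ q (metroDensity Φ σ q n) n x y u)) := by
  have key : ∀ m ≤ p, metroDensity Φ σ q m x y u = Φ x * ∏ n ∈ Finset.univ.filter
      (fun n : Fin p => n.val < m), (q n x y u (y (σ n)) *
      (if u (σ n) then acceptProb σ q (metroDensity Φ σ q n) n x y u
        else 1 - acceptProb σ q (metroDensity Φ σ q n) n x y u)) := by
    intro m
    induction m with
    | zero => intro _; simp [metroDensity]
    | succ m ih =>
      intro hm
      have hf : Finset.univ.filter (fun n : Fin p => n.val < m + 1) =
          insert ⟨m, hm⟩ (Finset.univ.filter fun n : Fin p => n.val < m) := by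
        ext k; simp [Fin.ext_iff]; omega
      rw [hf, Finset.prod_insert (by simp), show m + 1 = (⟨m, hm⟩ : Fin p).val + 1 from rfl,
        metroDensity_succ, ih (by omega)]
      ring
  rw [key p le_rfl]
  congr 2
  ext n
  simp

theorem metroDensity_causal (hq : IsFaithfulProposal σ q) (n : ℕ) (x : Fin p → ℝ)
    {y y' : Fin p → ℝ} {u u' : Fin p → Bool}
    (h : ∀ k : Fin p, k.val < n → y (σ k) = y' (σ k) ∧ u (σ k) = u' (σ k)) :
    metroDensity Φ σ q n x y u = metroDensity Φ σ q n x y' u' := by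
  induction n generalizing x with
  | zero => rfl
  | succ n ih =>
    have ih := fun x => ih x fun k hk => h k (hk.trans n.lt_succ_self)
    by_cases hn : n < p
    · have hy := h ⟨n, hn⟩ n.lt_succ_self
      have hcausal : ∀ x, q ⟨n, hn⟩ x y u = q ⟨n, hn⟩ x y' u' := fun x =>
        hq.causal ⟨n, hn⟩ x y y' u u' fun k hk => h k (Nat.lt_succ_of_lt hk)
      rw [show n + 1 = (⟨n, hn⟩ : Fin p).val + 1 from rfl, metroDensity_succ, metroDensity_succ]
      simp only [acceptProb, ih, hcausal, hy]
    · rw [metroDensity_succ_of_not_lt hn, ih]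

/-- This is detailed balance: the Metropolis–Hastings ratio turns the density of an accepted
proposal into the minimum of the flows in both directions. If the denominator of the ratio is zero,
both sides vanish. -/
theorem metroDensity_succ_of_true (hΦ : ∀ x, 0 ≤ Φ x) (hq : IsFaithfulProposal σ q) (n : Fin p)
    (x y : Fin p → ℝ) {u : Fin p → Bool} (hu : u (σ n) = true) :
    metroDensity Φ σ q (n + 1) x y u = min (metroDensity Φ σ q n x y u * q n x y u (y (σ n)))
      (metroDensity Φ σ q n (Function.update x (σ n) (y (σ n))) y u *
        q n (Function.update x (σ n) (y (σ n))) y u (x (σ n))) := by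
  rw [metroDensity_succ, if_pos hu, acceptProb]
  set g := metroDensity Φ σ q n
  have hg := metroDensity_nonneg (σ := σ) (q := q) hΦ hq.nonneg n
  set x' := Function.update x (σ n) (y (σ n))
  have h1 : 0 ≤ g x y u * q n x y u (y (σ n)) := mul_nonneg (hg ..) (hq.nonneg ..)
  have h2 : 0 ≤ g x' y u * q n x' y u (x (σ n)) := mul_nonneg (hg ..) (hq.nonneg ..)
  rw [← mul_assoc, mul_comm (q n x' y u _), mul_comm (q n x y u _)]
  rcases h1.eq_or_lt with h | h
  · rw [← h, zero_mul, min_eq_left h2]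
  · rw [mul_min_of_nonneg _ _ h.le, mul_one, mul_div_cancel₀ _ h.ne']

/-- At step `m` itself the swap exchanges the two arguments of the minimum. At later steps it
commutes with the update of the current coordinate, and the factors are invariant by faithfulness
and induction. -/
theorem metroDensity_swap (hΦ : ∀ x, 0 ≤ Φ x) (hq : IsFaithfulProposal σ q) (m : Fin p) (n : ℕ)
    (hmn : m.val < n) (x y : Fin p → ℝ) {u : Fin p → Bool} (hu : u (σ m) = true) :
    metroDensity Φ σ q n (Function.update x (σ m) (y (σ m)))
      (Function.update y (σ m) (x (σ m))) u = metroDensity Φ σ q n x y u := by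
  induction n generalizing x y with
  | zero => omega
  | succ n ih =>
    by_cases hn : n < p
    · rcases Nat.lt_succ_iff_lt_or_eq.mp hmn with hlt | heq
      · have hne : σ ⟨n, hn⟩ ≠ σ m := fun h => by
          have := congrArg Fin.val (σ.injective h); simp at this; omega
        rw [show n + 1 = (⟨n, hn⟩ : Fin p).val + 1 from rfl, metroDensity_succ, metroDensity_succ]
        have hupd : ∀ t, Function.update (Function.update x (σ m) (y (σ m))) (σ ⟨n, hn⟩) t =
            Function.update (Function.update x (σ ⟨n, hn⟩) t) (σ m) (y (σ m)) := fun t =>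
          Function.update_comm hne.symm _ _ _
        have hx : ∀ t, x (σ m) = Function.update x (σ ⟨n, hn⟩) t (σ m) := fun t => by
          simp [Function.update_of_ne hne.symm]
        have hf : ∀ t, q ⟨n, hn⟩ (Function.update (Function.update x (σ ⟨n, hn⟩) t) (σ m) (y (σ m)))
            (Function.update y (σ m) (x (σ m))) u =
              q ⟨n, hn⟩ (Function.update x (σ ⟨n, hn⟩) t) y u := fun t => by
          have := hq.faithful ⟨n, hn⟩ (Function.update x (σ ⟨n, hn⟩) t) y u m hlt hu
          rwa [← hx] at this
        have hg : ∀ t, metroDensity Φ σ q n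
            (Function.update (Function.update x (σ ⟨n, hn⟩) t) (σ m) (y (σ m)))
            (Function.update y (σ m) (x (σ m))) u =
              metroDensity Φ σ q n (Function.update x (σ ⟨n, hn⟩) t) y u := fun t => by
          have := ih hlt (Function.update x (σ ⟨n, hn⟩) t) y
          rwa [← hx] at this
        simp only [acceptProb, ih hlt, Function.update_of_ne hne, hupd, hf, hg,
          hq.faithful ⟨n, hn⟩ x y u m hlt hu]
      · have hmn' : m = ⟨n, hn⟩ := Fin.ext heq
        subst hmn'
        rw [metroDensity_succ_of_true hΦ hq _ _ _ hu, metroDensity_succ_of_true hΦ hq _ _ _ hu]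
        have hc : ∀ z, metroDensity Φ σ q n z (Function.update y (σ ⟨n, hn⟩) (x (σ ⟨n, hn⟩))) u =
            metroDensity Φ σ q n z y u := fun z => metroDensity_causal hq _ _ fun k hk => by
          have : σ k ≠ σ ⟨n, hn⟩ := fun h => by
            have := congrArg Fin.val (σ.injective h); simp at this; omega
          simp [Function.update_of_ne this]
        have hc' : ∀ z, q ⟨n, hn⟩ z (Function.update y (σ ⟨n, hn⟩) (x (σ ⟨n, hn⟩))) u =
            q ⟨n, hn⟩ z y u := fun z => hq.causal _ _ _ _ _ _ fun k hk => by
          have : σ k ≠ σ ⟨n, hn⟩ := fun h => by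
            rw [σ.injective h] at hk; exact lt_irrefl _ hk
          simp [Function.update_of_ne this]
        simp only [hc, hc', Function.update_self, Function.update_idem, Function.update_eq_self]
        exact min_comm _ _
    · rw [metroDensity_succ_of_not_lt hn]
      exact ih (by omega) x y

section Measurability

variable {E : Type*} [MeasurableSpace E] {Ψ : E → (Fin p → ℝ) → ℝ}
  {r : E → Fin p → (Fin p → ℝ) → (Fin p → ℝ) → (Fin p → Bool) → ℝ → ℝ}

theorem measurable_acceptProb
    {g : E → (Fin p → ℝ) → (Fin p → ℝ) → (Fin p → Bool) → ℝ} (n : Fin p)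
    (hr : Measurable fun a : E × (Fin p → ℝ) × (Fin p → ℝ) × (Fin p → Bool) × ℝ =>
      r a.1 n a.2.1 a.2.2.1 a.2.2.2.1 a.2.2.2.2)
    (hg : Measurable fun a : E × (Fin p → ℝ) × (Fin p → ℝ) × (Fin p → Bool) =>
      g a.1 a.2.1 a.2.2.1 a.2.2.2) :
    Measurable fun a : E × (Fin p → ℝ) × (Fin p → ℝ) × (Fin p → Bool) =>
      acceptProb σ (r a.1) (g a.1) n a.2.1 a.2.2.1 a.2.2.2 := by
  have hx' : Measurable fun a : E × (Fin p → ℝ) × (Fin p → ℝ) × (Fin p → Bool) =>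
      Function.update a.2.1 (σ n) (a.2.2.1 (σ n)) :=
    measurable_update'.comp ((by fun_prop : Measurable fun a :
      E × (Fin p → ℝ) × (Fin p → ℝ) × (Fin p → Bool) => (a.2.1, a.2.2.1 (σ n))))
  have h1 := hr.comp (f := fun a : E × (Fin p → ℝ) × (Fin p → ℝ) × (Fin p → Bool) =>
    (a.1, Function.update a.2.1 (σ n) (a.2.2.1 (σ n)), a.2.2.1, a.2.2.2, a.2.1 (σ n)))
    (by fun_prop)
  have h2 := hr.comp (f := fun a : E × (Fin p → ℝ) × (Fin p → ℝ) × (Fin p → Bool) =>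
    (a.1, a.2.1, a.2.2.1, a.2.2.2, a.2.2.1 (σ n))) (by fun_prop)
  have h3 := hg.comp (f := fun a : E × (Fin p → ℝ) × (Fin p → ℝ) × (Fin p → Bool) =>
    (a.1, Function.update a.2.1 (σ n) (a.2.2.1 (σ n)), a.2.2.1, a.2.2.2)) (by fun_prop)
  exact measurable_const.min ((h1.mul h3).div (h2.mul hg))

/-- The parameter space `E` is needed since the procedure evaluates this density with a table and
with proposals which themselves depend on the input, the seed and the answers. -/
theorem measurable_metroDensity
    (hΨ : Measurable fun a : E × (Fin p → ℝ) => Ψ a.1 a.2)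
    (hr : ∀ n, Measurable fun a : E × (Fin p → ℝ) × (Fin p → ℝ) × (Fin p → Bool) × ℝ =>
      r a.1 n a.2.1 a.2.2.1 a.2.2.2.1 a.2.2.2.2) (n : ℕ) :
    Measurable fun a : E × (Fin p → ℝ) × (Fin p → ℝ) × (Fin p → Bool) =>
      metroDensity (Ψ a.1) σ (r a.1) n a.2.1 a.2.2.1 a.2.2.2 := by
  induction n with
  | zero => exact hΨ.comp (measurable_fst.prodMk (measurable_fst.comp measurable_snd))
  | succ n ih =>
    by_cases hn : n < p
    · have h1 := measurable_acceptProb (σ := σ) (r := r)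
        (g := fun e => metroDensity (Ψ e) σ (r e) n) ⟨n, hn⟩ (hr ⟨n, hn⟩) ih
      have h2 := (hr ⟨n, hn⟩).comp (f := fun a : E × (Fin p → ℝ) × (Fin p → ℝ) × (Fin p → Bool) =>
        (a.1, a.2.1, a.2.2.1, a.2.2.2, a.2.2.1 (σ ⟨n, hn⟩))) (by fun_prop)
      simp only [show n + 1 = (⟨n, hn⟩ : Fin p).val + 1 from rfl, metroDensity_succ]
      refine ih.mul (h2.mul (Measurable.ite ?_ h1 (measurable_const.sub h1)))
      exact (by fun_prop : Measurable fun a : E × (Fin p → ℝ) × (Fin p → ℝ) × (Fin p → Bool) =>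
        a.2.2.2 (σ ⟨n, hn⟩)) (measurableSet_singleton true)
    · simp only [metroDensity_succ_of_not_lt hn]
      exact ih

end Measurability

theorem measurable_metroDensity_const (hΦ : Measurable Φ) (hq : IsFaithfulProposal σ q) (n : ℕ) :
    Measurable fun a : (Fin p → ℝ) × (Fin p → ℝ) × (Fin p → Bool) =>
      metroDensity Φ σ q n a.1 a.2.1 a.2.2 :=
  (measurable_metroDensity (E := Unit) (Ψ := fun _ => Φ) (r := fun _ => q)
    (hΦ.comp measurable_snd) (fun n => (hq.measurable n).comp measurable_snd) n).comp
    (measurable_const (a := ()) |>.prodMk measurable_id)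

theorem lintegral_prod_prod_count {h : (Fin p → ℝ) × (Fin p → ℝ) × (Fin p → Bool) → ℝ≥0∞}
    (hh : Measurable h) :
    ∫⁻ a, h a ∂((volume : Measure (Fin p → ℝ)).prod ((volume : Measure (Fin p → ℝ)).prod
      (Measure.count : Measure (Fin p → Bool)))) =
    ∑ u, ∫⁻ z : (Fin p → ℝ) × (Fin p → ℝ), h (z.1, z.2, u) := by
  have hpres := measurePreserving_prodAssoc (volume : Measure (Fin p → ℝ))
    (volume : Measure (Fin p → ℝ)) (Measure.count : Measure (Fin p → Bool))
  rw [← hpres.lintegral_comp hh,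
    lintegral_prod_symm' (fun z => h (MeasurableEquiv.prodAssoc z)) (hh.comp hpres.measurable),
    lintegral_count, tsum_fintype]
  rfl

/-- The swap is a transposition of two of the `2 * p` coordinates. -/
theorem measurePreserving_swap (j : Fin p) :
    MeasurePreserving (swap j) (volume : Measure ((Fin p → ℝ) × (Fin p → ℝ))) volume := by
  have h1 := volume_measurePreserving_sumPiEquivProdPi (fun _ : Fin p ⊕ Fin p => ℝ)
  have h2 := volume_preserving_arrowCongr' (Equiv.swap (Sum.inl j : Fin p ⊕ Fin p) (Sum.inr j))
    (MeasurableEquiv.refl ℝ) (MeasurePreserving.id _)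
  have h3 := volume_measurePreserving_sumPiEquivProdPi_symm (fun _ : Fin p ⊕ Fin p => ℝ)
  convert h1.comp (h2.comp h3) using 1
  ext z k
  · change _ = Sum.elim z.1 z.2 (Equiv.swap (Sum.inl j) (Sum.inr j) (Sum.inl k))
    by_cases hk : k = j
    · subst hk
      simp [swap]
    · rw [Equiv.swap_apply_of_ne_of_ne (by simpa using hk) (by simp)]
      simp [swap, hk]
  · change _ = Sum.elim z.1 z.2 (Equiv.swap (Sum.inl j) (Sum.inr j) (Sum.inr k))
    by_cases hk : k = j
    · subst hk
      simp [swap]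
    · rw [Equiv.swap_apply_of_ne_of_ne (by simp) (by simpa using hk)]
      simp [swap, hk]

theorem measurable_knockoff :
    Measurable fun a : (Fin p → ℝ) × (Fin p → ℝ) × (Fin p → Bool) =>
      (a.1, knockoff a.1 a.2.1 a.2.2) := by
  refine measurable_fst.prodMk (measurable_pi_lambda _ fun j => ?_)
  refine Measurable.ite ?_ (by fun_prop) (by fun_prop)
  exact (by fun_prop : Measurable fun a : (Fin p → ℝ) × (Fin p → ℝ) × (Fin p → Bool) =>
    a.2.2 j) (measurableSet_singleton true)

theorem metroLaw_apply (s : Set ((Fin p → ℝ) × (Fin p → ℝ) × (Fin p → Bool)))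
    (hs : MeasurableSet s) (hΦ : Measurable Φ) (hq : IsFaithfulProposal σ q) :
    metroLaw Φ σ q s = (∫⁻ x, ENNReal.ofReal (Φ x))⁻¹ *
      ∑ u, ∫⁻ z : (Fin p → ℝ) × (Fin p → ℝ), s.indicator (fun a => ENNReal.ofReal
        (metroDensity Φ σ q p a.1 a.2.1 a.2.2)) (z.1, z.2, u) := by
  rw [metroLaw, Measure.smul_apply, smul_eq_mul, withDensity_apply _ hs, ← lintegral_indicator hs,
    lintegral_prod_prod_count]
  exact (measurable_metroDensity_const hΦ hq p).ennreal_ofReal.indicator hs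

/-- The acceptance vector `u` is fixed. If `u j` holds, the swap of `x j` and `y j` preserves
Lebesgue measure and the density and induces the swap of `x j` and the knockoff. Otherwise both
coordinates are equal and the swap does nothing. -/
theorem pairwiseExchangeable_metroLaw (hΦ : ∀ x, 0 ≤ Φ x) (hΦm : Measurable Φ)
    (hq : IsFaithfulProposal σ q) :
    PairwiseExchangeable ((metroLaw Φ σ q).map fun a => (a.1, knockoff a.1 a.2.1 a.2.2)) := by
  classical
  intro j
  rw [Measure.map_map (measurable_swap j) measurable_knockoff]
  ext s hs
  rw [Measure.map_apply ((measurable_swap j).comp measurable_knockoff) hs,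
    Measure.map_apply measurable_knockoff hs,
    metroLaw_apply _ (((measurable_swap j).comp measurable_knockoff) hs) hΦm hq,
    metroLaw_apply _ (measurable_knockoff hs) hΦm hq]
  congr 1
  refine Finset.sum_congr rfl fun u _ => ?_
  have hmeas : Measurable fun z : (Fin p → ℝ) × (Fin p → ℝ) =>
      ((fun a : (Fin p → ℝ) × (Fin p → ℝ) × (Fin p → Bool) =>
        (a.1, knockoff a.1 a.2.1 a.2.2)) ⁻¹' s).indicator (fun a => ENNReal.ofReal
          (metroDensity Φ σ q p a.1 a.2.1 a.2.2)) (z.1, z.2, u) :=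
    ((measurable_metroDensity_const hΦm hq p).ennreal_ofReal.indicator
      (measurable_knockoff hs)).comp (by fun_prop)
  by_cases hu : u j = true
  · rw [← (measurePreserving_swap j).lintegral_comp hmeas]
    refine lintegral_congr fun z => ?_
    have h1 : metroDensity Φ σ q p (swap j z).1 (swap j z).2 u =
        metroDensity Φ σ q p z.1 z.2 u := by
      have := metroDensity_swap hΦ hq (σ.symm j) p (σ.symm j).isLt z.1 z.2 (u := u) (by simpa)
      simpa [swap] using this
    have h2 : swap j (z.1, knockoff z.1 z.2 u) =
        ((swap j z).1, knockoff (swap j z).1 (swap j z).2 u) := by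
      ext k
      · by_cases hk : k = j
        · subst hk; simp [swap, knockoff, hu]
        · simp [swap, hk]
      · by_cases hk : k = j
        · subst hk; simp [swap, knockoff, hu]
        · simp [swap, hk, knockoff]
    rw [Set.indicator_apply, Set.indicator_apply]
    refine if_congr ?_ (by rw [h1]) rfl
    show swap j (z.1, knockoff z.1 z.2 u) ∈ s ↔ _
    rw [h2]
    rfl
  · refine lintegral_congr fun z => ?_
    have h2 : swap j (z.1, knockoff z.1 z.2 u) = (z.1, knockoff z.1 z.2 u) := by
      simp [swap, knockoff, hu]
    rw [Set.indicator_apply, Set.indicator_apply]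
    refine if_congr ?_ rfl rfl
    show swap j (z.1, knockoff z.1 z.2 u) ∈ s ↔ _
    rw [h2]
    rfl

end Metro

end Knockoff

namespace Knockoff

/-! ### Functionals which can be computed with a given number of queries -/

section Queryable

variable {p : ℕ} {β γ : Type} [MeasurableSpace β] [MeasurableSpace γ]

/-- `F Φ e` can be computed, in a measurable way, from `e` and `N` adaptive evaluations of `Φ`. -/
def Queryable {p : ℕ} {β : Type} [MeasurableSpace β] : (N : ℕ) → (E : Type) →
    [MeasurableSpace E] → (((Fin p → ℝ) → ℝ) → E → β) → Prop
  | 0, E, _, F => ∃ g : E → β, Measurable g ∧ ∀ Φ e, F Φ e = g e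
  | N + 1, E, _, F => ∃ z : E → (Fin p → ℝ), Measurable z ∧
      ∃ H : ((Fin p → ℝ) → ℝ) → E × ℝ → β, Queryable N (E × ℝ) H ∧
        ∀ Φ e, F Φ e = H Φ (e, Φ (z e))

theorem Queryable.of_measurable {E : Type} [MeasurableSpace E] {g : E → β} (hg : Measurable g) :
    Queryable (p := p) 0 E fun _ e => g e := ⟨g, hg, fun _ _ => rfl⟩

theorem Queryable.comp {N : ℕ} : ∀ {E E' : Type} [MeasurableSpace E] [MeasurableSpace E']
    {F : ((Fin p → ℝ) → ℝ) → E → β} {f : E' → E}, Queryable N E F → Measurable f →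
      Queryable N E' fun Φ e => F Φ (f e) := by
  induction N with
  | zero =>
    rintro E E' _ _ F f ⟨g, hg, h⟩ hf
    exact ⟨fun e => g (f e), hg.comp hf, fun Φ e => h Φ (f e)⟩
  | succ N ih =>
    rintro E E' _ _ F f ⟨z, hz, H, hH, h⟩ hf
    exact ⟨fun e => z (f e), hz.comp hf, fun Φ a => H Φ (f a.1, a.2),
      ih hH ((hf.comp measurable_fst).prodMk measurable_snd), fun Φ e => h Φ (f e)⟩

/-- Numbers of queries add up under composition, and the second functional may use the result of the
first. This lets the procedure be assembled from measurable pieces without handling lists of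
answers. -/
theorem Queryable.bind {N M : ℕ} : ∀ {E : Type} [MeasurableSpace E]
    {F : ((Fin p → ℝ) → ℝ) → E → β} {K : ((Fin p → ℝ) → ℝ) → E × β → γ}, Queryable N E F →
      Queryable M (E × β) K → Queryable (M + N) E fun Φ e => K Φ (e, F Φ e) := by
  induction N with
  | zero =>
    rintro E _ F K ⟨g, hg, h⟩ hK
    simp only [h]
    exact hK.comp (measurable_id.prodMk hg)
  | succ N ih =>
    rintro E _ F K ⟨z, hz, H, hH, h⟩ hK
    have hm : Measurable fun a : (E × ℝ) × β => (a.1.1, a.2) := by fun_prop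
    exact ⟨z, hz, fun Φ a => K Φ (a.1, H Φ a),
      ih (K := fun Φ a => K Φ (a.1.1, a.2)) hH (hK.comp hm), fun Φ e => by simp only [h]⟩

theorem Queryable.map {N : ℕ} {E : Type} [MeasurableSpace E]
    {F : ((Fin p → ℝ) → ℝ) → E → β} {g : E × β → γ} (h : Queryable N E F) (hg : Measurable g) :
    Queryable N E fun Φ e => g (e, F Φ e) := by
  have := h.bind (Queryable.of_measurable hg)
  rwa [zero_add] at this

theorem Queryable.mono {N M : ℕ} (hNM : N ≤ M) {E : Type} [MeasurableSpace E]
    {F : ((Fin p → ℝ) → ℝ) → E → β} (h : Queryable N E F) : Queryable M E F := by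
  induction M, hNM using Nat.le_induction with
  | base => exact h
  | succ M _ ih =>
    -- A superfluous query at `0` is prepended, as the definition counts exactly `N` queries.
    exact ⟨fun _ => 0, measurable_const, fun Φ a => F Φ a.1, ih.comp measurable_fst,
      fun _ _ => rfl⟩

theorem Queryable.eval {E : Type} [MeasurableSpace E] {z : E → Fin p → ℝ} (hz : Measurable z) :
    Queryable 1 E fun Φ e => Φ (z e) :=
  ⟨z, hz, fun _ a => a.2, ⟨Prod.snd, measurable_snd, fun _ _ => rfl⟩, fun _ _ => rfl⟩

theorem Queryable.eval_fin {E : Type} [MeasurableSpace E] {n : ℕ} {z : Fin n → E → Fin p → ℝ}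
    (hz : ∀ i, Measurable (z i)) : Queryable n E fun Φ e i => Φ (z i e) := by
  induction n with
  | zero =>
    exact ⟨fun _ i => i.elim0, measurable_pi_lambda _ fun i => i.elim0,
      fun _ _ => funext fun i => i.elim0⟩
  | succ n ih =>
    have h1 := ih fun i => hz i.castSucc
    have h2 := (Queryable.eval (hz (Fin.last n))).comp
      (measurable_fst (α := E) (β := Fin n → ℝ))
    have h3 := h1.bind (h2.map (g := fun a : (E × (Fin n → ℝ)) × ℝ =>
      (Fin.snoc a.1.2 a.2 : Fin (n + 1) → ℝ)) ?_)
    · rw [add_comm 1 n] at h3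
      convert h3 using 3 with Φ e
      ext i
      induction i using Fin.lastCases with
      | last => simp
      | cast i => simp
    · refine measurable_pi_lambda _ fun i => ?_
      induction i using Fin.lastCases with
      | last => simpa using measurable_snd
      | cast i =>
        simp only [Fin.snoc_castSucc]
        fun_prop

theorem Queryable.eval_fintype {E : Type} [MeasurableSpace E] {ι : Type} [Fintype ι]
    {z : ι → E → Fin p → ℝ} (hz : ∀ i, Measurable (z i)) :
    Queryable (Fintype.card ι) E fun Φ e i => Φ (z i e) := by
  have h1 := Queryable.eval_fin (z := fun k => z ((Fintype.equivFin ι).symm k)) fun k => hz _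
  have h2 := h1.map (g := fun a : E × (Fin (Fintype.card ι) → ℝ) =>
    fun i => a.2 (Fintype.equivFin ι i)) (by fun_prop)
  simpa using h2

/-- The answers of the oracle to the queries of a procedure with the given steps. -/
def runAnswers (s : List ℝ → (Fin p → ℝ) ⊕ β) (Φ : (Fin p → ℝ) → ℝ) : ℕ → List ℝ
  | 0 => []
  | n + 1 =>
    match s (runAnswers s Φ n) with
    | Sum.inl z => runAnswers s Φ n ++ [Φ z]
    | Sum.inr _ => runAnswers s Φ n

theorem runAnswers_succ {α : Type} {s : List ℝ → (Fin p → ℝ) ⊕ α} {Φ : (Fin p → ℝ) → ℝ} {z : Fin p → ℝ}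
    (h : s [] = .inl z) (n : ℕ) :
    runAnswers s Φ (n + 1) = Φ z :: runAnswers (fun l => s (Φ z :: l)) Φ n := by
  induction n with
  | zero => simp [runAnswers, h]
  | succ n ih =>
    rw [runAnswers, ih, runAnswers]
    cases hs : s (Φ z :: runAnswers (fun l => s (Φ z :: l)) Φ n) <;> simp

/-- The first answer is absorbed into the environment, and the remaining answers are passed on. The
second clause of the conclusion makes `N` the first time at which an output occurs. -/
theorem Queryable.exists_step {N : ℕ} : ∀ {E : Type} [MeasurableSpace E]
    {F : ((Fin p → ℝ) → ℝ) → E → β}, Queryable N E F →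
      ∃ step : E → List ℝ → (Fin p → ℝ) ⊕ β,
        (∀ n, Measurable fun a : E × (Fin n → ℝ) => step a.1 (List.ofFn a.2)) ∧
        ∀ Φ e, step e (runAnswers (step e) Φ N) = .inr (F Φ e) ∧
          ∀ n < N, (step e (runAnswers (step e) Φ n)).isLeft := by
  induction N with
  | zero =>
    rintro E _ F ⟨g, hg, h⟩
    refine ⟨fun e _ => .inr (g e), fun n => measurable_inr.comp (hg.comp measurable_fst),
      fun Φ e => ⟨by rw [h], by simp⟩⟩
  | succ N ih =>
    rintro E _ F ⟨z, hz, H, hH, h⟩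
    obtain ⟨step, h1, h2⟩ := ih hH
    refine ⟨fun e l => l.casesOn (.inl (z e)) fun r l => step (e, r) l, ?_, ?_⟩
    · rintro (_ | n)
      · exact measurable_inl.comp (hz.comp measurable_fst)
      · simp only [List.ofFn_succ]
        exact (h1 n).comp (f := fun a : E × (Fin (n + 1) → ℝ) => ((a.1, a.2 0),
          fun i : Fin n => a.2 i.succ)) (by fun_prop)
    · intro Φ e
      have hrun : ∀ n, runAnswers (fun l : List ℝ => (l.casesOn (.inl (z e))
          fun r l => step (e, r) l : (Fin p → ℝ) ⊕ β)) Φ (n + 1) =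
            Φ (z e) :: runAnswers (step (e, Φ (z e))) Φ n := fun n => runAnswers_succ rfl n
      refine ⟨?_, ?_⟩
      · rw [hrun, h]
        exact (h2 Φ _).1
      · rintro (_ | n) hn
        · rfl
        · rw [hrun]
          exact (h2 Φ _).2 n (by omega)

theorem OracleProcedure.numQueries_le_and_output_eq [Inhabited β] (A : OracleProcedure p β)
    {Φ : (Fin p → ℝ) → ℝ} {x : Fin p → ℝ} {ω : A.Seed} {N : ℕ} {b : β}
    (hN : A.step x ω (runAnswers (A.step x ω) Φ N) = .inr b)
    (hlt : ∀ n < N, (A.step x ω (runAnswers (A.step x ω) Φ n)).isLeft) :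
    A.numQueries Φ x ω ≤ N ∧ A.output Φ x ω = b := by
  have hans : ∀ n, A.answers Φ x ω n = runAnswers (A.step x ω) Φ n := by
    intro n
    induction n with
    | zero => rfl
    | succ n ih =>
      rw [OracleProcedure.answers, runAnswers, ih]
  have hres : ∀ n, A.result Φ x ω n = (A.step x ω (runAnswers (A.step x ω) Φ n)).getRight? :=
    fun n => by rw [OracleProcedure.result, hans]
  have hN : A.result Φ x ω N = some b := by rw [hres, hN]; rfl
  have hlt : ∀ n < N, ¬ (A.result Φ x ω n).isSome := fun n hn => by
    rw [hres, Sum.isSome_getRight?_iff_isRight, Sum.not_isRight]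
    exact hlt n hn
  constructor
  · exact iInf₂_le N (by rw [hN]; rfl)
  · classical
    have hex : ∃ n, (A.result Φ x ω n).isSome := ⟨N, by rw [hN]; rfl⟩
    rw [OracleProcedure.output, dif_pos hex]
    apply Option.some_injective
    rw [Option.some_get, ← hN]
    congr 1
    refine (Nat.find_eq_iff hex).mpr ⟨by rw [hN]; rfl, hlt⟩

/-- An oracle procedure which computes a given functional. -/
theorem Queryable.exists_oracleProcedure [Inhabited β] {N : ℕ} {Ω : Type} [mΩ : MeasurableSpace Ω]
    (P : Measure Ω) [hP : IsProbabilityMeasure P]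
    {F : ((Fin p → ℝ) → ℝ) → (Fin p → ℝ) × Ω → β} (hF : Queryable N ((Fin p → ℝ) × Ω) F) :
    ∃ (step : (Fin p → ℝ) → Ω → List ℝ → (Fin p → ℝ) ⊕ β)
      (hstep : ∀ n : ℕ, Measurable
        fun a : (Fin p → ℝ) × Ω × (Fin n → ℝ) => step a.1 a.2.1 (List.ofFn a.2.2)),
      ∀ Φ x ω, (OracleProcedure.mk Ω mΩ P hP step hstep).numQueries Φ x ω ≤ N ∧
        (OracleProcedure.mk Ω mΩ P hP step hstep).output Φ x ω = F Φ (x, ω) := by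
  obtain ⟨step, h1, h2⟩ := hF.exists_step
  exact ⟨fun x ω => step (x, ω), fun n => (h1 n).comp (f := fun a :
    (Fin p → ℝ) × Ω × (Fin n → ℝ) => ((a.1, a.2.1), a.2.2)) (by fun_prop), fun Φ x ω =>
      OracleProcedure.numQueries_le_and_output_eq _ (h2 Φ (x, ω)).1 (h2 Φ (x, ω)).2⟩

end Queryable

end Knockoff

namespace Knockoff

/-! ### Sampling a run of Metro with Gaussian proposals -/

section Sampling

variable {p : ℕ} {σ : Equiv.Perm (Fin p)}

/-- The distribution of a vector of independent standard normal variables. -/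
noncomputable def stdNormal (p : ℕ) : Measure (Fin p → ℝ) :=
  volume.withDensity fun z => ∏ i, gaussianPDF 0 1 (z i)

instance isProbabilityMeasure_stdNormal : IsProbabilityMeasure (stdNormal p) := ⟨by
  rw [stdNormal, withDensity_apply _ .univ, Measure.restrict_univ]
  have h1 : ∀ z : Fin p → ℝ, ∏ i, gaussianPDF 0 1 (z i) =
      ENNReal.ofReal (∏ i, gaussianPDFReal 0 1 (z i)) := fun z => by
    rw [ENNReal.ofReal_prod_of_nonneg fun i _ => gaussianPDFReal_nonneg _ _ _]
    rfl
  simp only [h1]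
  rw [← ofReal_integral_eq_lintegral_ofReal]
  · rw [integral_fintype_prod_volume_eq_prod (fun _ : Fin p => gaussianPDFReal 0 1)]
    simp [integral_gaussianPDFReal_eq_one]
  · exact Integrable.fintype_prod (f := fun _ : Fin p => gaussianPDFReal 0 1)
      fun _ => integrable_gaussianPDFReal _ _
  · exact Filter.Eventually.of_forall fun z =>
      Finset.prod_nonneg fun i _ => gaussianPDFReal_nonneg _ _ _⟩

theorem lintegral_affine_gaussianPDF {h : ℝ → ℝ≥0∞} (hh : Measurable h) (m : ℝ) {v : ℝ≥0}
    (hv : v ≠ 0) : ∫⁻ t, h (m + NNReal.sqrt v * t) * gaussianPDF 0 1 t =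
      ∫⁻ t, h t * gaussianPDF m v t := by
  have h1 : (gaussianReal 0 1).map (fun t => m + NNReal.sqrt v * t) = gaussianReal m v := by
    have h2 : (fun t : ℝ => m + NNReal.sqrt v * t) =
        (fun t => m + t) ∘ fun t => (NNReal.sqrt v : ℝ) * t := rfl
    rw [h2, ← Measure.map_map (by fun_prop) (by fun_prop), gaussianReal_map_const_mul,
      gaussianReal_map_const_add]
    congr 1
    · simp
    · ext
      simp
  have h3 : ∀ (m : ℝ) (v : ℝ≥0) (g : ℝ → ℝ≥0∞), Measurable g → v ≠ 0 →
      ∫⁻ t, g t ∂(gaussianReal m v) = ∫⁻ t, g t * gaussianPDF m v t := by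
    intro m v g hg hv
    rw [gaussianReal_of_var_ne_zero _ hv,
      lintegral_withDensity_eq_lintegral_mul _ (measurable_gaussianPDF _ _) hg]
    simp only [Pi.mul_apply, mul_comm]
  rw [← h3 m v h hh hv, ← h1, lintegral_map hh (by fun_prop), h3 _ _ _ _ one_ne_zero]
  fun_prop

/-- Transform independent standard normal variables into the proposals, one coordinate after
another; `m n` is the mean and `v n` the variance of the proposal of step `n`. -/
noncomputable def sampleProposals (σ : Equiv.Perm (Fin p)) (m : Fin p → (Fin p → ℝ) → ℝ)
    (v : Fin p → ℝ≥0) (z : Fin p → ℝ) : ℕ → Fin p → ℝ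
  | 0 => z
  | n + 1 =>
    if h : n < p then
      Function.update (sampleProposals σ m v z n) (σ ⟨n, h⟩)
        (m ⟨n, h⟩ (sampleProposals σ m v z n) +
          NNReal.sqrt (v ⟨n, h⟩) * sampleProposals σ m v z n (σ ⟨n, h⟩))
    else sampleProposals σ m v z n

theorem measurable_sampleProposals {E : Type*} [MeasurableSpace E]
    {m : E → Fin p → (Fin p → ℝ) → ℝ} {v : E → Fin p → ℝ≥0} {z : E → Fin p → ℝ}
    (hm : ∀ n, Measurable fun a : E × (Fin p → ℝ) => m a.1 n a.2)
    (hv : ∀ n, Measurable fun e => v e n) (hz : Measurable z) (n : ℕ) :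
    Measurable fun e => sampleProposals σ (m e) (v e) (z e) n := by
  induction n with
  | zero => exact hz
  | succ n ih =>
    by_cases h : n < p
    · simp only [sampleProposals, dif_pos h]
      refine measurable_update'.comp (ih.prodMk ?_)
      have h1 := (hm ⟨n, h⟩).comp (measurable_id.prodMk ih)
      have h2 : Measurable fun e => ((NNReal.sqrt (v e ⟨n, h⟩) : ℝ≥0) : ℝ) :=
        (NNReal.continuous_sqrt.measurable.comp (hv ⟨n, h⟩)).coe_nnreal_real
      exact h1.add (h2.mul ((measurable_pi_apply _).comp ih))
    · simpa only [sampleProposals, dif_neg h] using ih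

/-- The joint density of the first `n` proposals and of the remaining standard normal variables. -/
noncomputable def partialDensity (σ : Equiv.Perm (Fin p)) (m : Fin p → (Fin p → ℝ) → ℝ)
    (v : Fin p → ℝ≥0) (n : ℕ) (z : Fin p → ℝ) : ℝ≥0∞ :=
  ∏ k : Fin p, if k.val < n then gaussianPDF (m k z) (v k) (z (σ k))
    else gaussianPDF 0 1 (z (σ k))

theorem measurable_partialDensity {m : Fin p → (Fin p → ℝ) → ℝ} {v : Fin p → ℝ≥0}
    (hm : ∀ n, Measurable (m n)) (n : ℕ) : Measurable (partialDensity σ m v n) := by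
  refine Finset.measurable_prod _ fun k _ => ?_
  split_ifs
  · exact measurable_uncurry_gaussianPDF.comp
      ((hm k).prodMk (measurable_const.prodMk (measurable_pi_apply _)))
  · exact (measurable_gaussianPDF _ _).comp (measurable_pi_apply _)

/-- The coordinate `σ n` is integrated out first. By causality the means of the steps up to `n` do
not depend on it, so only an affine change of variables in one normal variable remains. -/
theorem lintegral_partialDensity_succ {m : Fin p → (Fin p → ℝ) → ℝ} {v : Fin p → ℝ≥0}
    (hm : ∀ n, Measurable (m n)) (hv : ∀ n, v n ≠ 0)
    (hcausal : ∀ n y y', (∀ k < n, y (σ k) = y' (σ k)) → m n y = m n y')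
    {h : (Fin p → ℝ) → ℝ≥0∞} (hh : Measurable h) (n : Fin p) :
    ∫⁻ z, h (Function.update z (σ n) (m n z + NNReal.sqrt (v n) * z (σ n))) *
      partialDensity σ m v n z = ∫⁻ z, h z * partialDensity σ m v (n + 1) z := by
  have hupd : ∀ k ≤ n, ∀ z t, m k (Function.update z (σ n) t) = m k z := fun k hk z t =>
    hcausal k _ _ fun j hj => Function.update_of_ne (σ.injective.ne (hj.trans_le hk).ne) _ _
  refine lintegral_eq_of_lmarginal_eq (μ := fun _ => volume) {σ n} ?_ ?_ ?_
  · refine Measurable.mul (hh.comp (measurable_update'.comp (measurable_id.prodMk ?_)))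
      (measurable_partialDensity hm _)
    exact (hm n).add (measurable_const.mul (measurable_pi_apply _))
  · exact hh.mul (measurable_partialDensity hm _)
  rw [lmarginal_singleton, lmarginal_singleton]
  ext z
  set C : ℝ≥0∞ := ∏ k ∈ Finset.univ.erase n, if k.val < n.val
    then gaussianPDF (m k z) (v k) (z (σ k)) else gaussianPDF 0 1 (z (σ k)) with hC
  have h1 : ∀ t, partialDensity σ m v n (Function.update z (σ n) t) = gaussianPDF 0 1 t * C := by
    intro t
    rw [partialDensity, ← Finset.mul_prod_erase _ _ (Finset.mem_univ n), if_neg (lt_irrefl _),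
      Function.update_self]
    congr 1
    refine Finset.prod_congr rfl fun k hk => ?_
    have hkn := Finset.ne_of_mem_erase hk
    rw [Function.update_of_ne (σ.injective.ne hkn)]
    split_ifs with hlt
    · rw [hupd k (Fin.le_def.mpr hlt.le)]
    · rfl
  have h2 : ∀ t, partialDensity σ m v (n + 1) (Function.update z (σ n) t) =
      gaussianPDF (m n z) (v n) t * C := by
    intro t
    rw [partialDensity, ← Finset.mul_prod_erase _ _ (Finset.mem_univ n), if_pos (Nat.lt_succ_self _),
      Function.update_self, hupd n le_rfl]
    congr 1
    refine Finset.prod_congr rfl fun k hk => ?_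
    have hkn := Finset.ne_of_mem_erase hk
    rw [Function.update_of_ne (σ.injective.ne hkn)]
    have hne : k.val ≠ n.val := fun e => hkn (Fin.ext e)
    by_cases hlt : k.val < n.val
    · rw [if_pos hlt, if_pos (by omega), hupd k (Fin.le_def.mpr hlt.le)]
    · rw [if_neg hlt, if_neg (by omega)]
  simp only [h1, h2, hupd n le_rfl, Function.update_idem, Function.update_self, ← mul_assoc]
  have hm1 : Measurable fun t => h (Function.update z (σ n) t) :=
    hh.comp (measurable_update z)
  rw [lintegral_mul_const, lintegral_mul_const, lintegral_affine_gaussianPDF hm1 _ (hv n)]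
  · exact hm1.mul (measurable_gaussianPDF _ _)
  · exact (hm1.comp (by fun_prop)).mul (measurable_gaussianPDF _ _)

theorem lintegral_sampleProposals {m : Fin p → (Fin p → ℝ) → ℝ} {v : Fin p → ℝ≥0}
    (hm : ∀ n, Measurable (m n)) (hv : ∀ n, v n ≠ 0)
    (hcausal : ∀ n y y', (∀ k < n, y (σ k) = y' (σ k)) → m n y = m n y')
    {h : (Fin p → ℝ) → ℝ≥0∞} (hh : Measurable h) :
    ∫⁻ z, h (sampleProposals σ m v z p) ∂(stdNormal p) =
      ∫⁻ y, h y * ∏ n, gaussianPDF (m n y) (v n) (y (σ n)) := by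
  have key : ∀ n ≤ p, ∀ h : (Fin p → ℝ) → ℝ≥0∞, Measurable h →
      ∫⁻ z, h (sampleProposals σ m v z n) * partialDensity σ m v 0 z =
        ∫⁻ z, h z * partialDensity σ m v n z := by
    intro n
    induction n with
    | zero => intro _ h _; rfl
    | succ n ih =>
      intro hn h hh
      have hmeas : Measurable fun z : Fin p → ℝ => h (Function.update z (σ ⟨n, hn⟩)
          (m ⟨n, hn⟩ z + NNReal.sqrt (v ⟨n, hn⟩) * z (σ ⟨n, hn⟩))) :=
        hh.comp (measurable_update'.comp (measurable_id.prodMk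
          ((hm _).add (measurable_const.mul (measurable_pi_apply _)))))
      have h1 := ih (by omega) _ hmeas
      have h2 := lintegral_partialDensity_succ hm hv hcausal hh ⟨n, hn⟩
      simp only [sampleProposals, dif_pos (show n < p from hn)]
      exact h1.trans h2
  have hms : Measurable fun z => h (sampleProposals σ m v z p) :=
    hh.comp (measurable_sampleProposals (m := fun _ : Fin p → ℝ => m) (v := fun _ => v)
      (fun n => (hm n).comp measurable_snd) (fun _ => measurable_const) measurable_id p)
  have hmp : Measurable fun z : Fin p → ℝ => ∏ i, gaussianPDF 0 1 (z i) :=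
    Finset.measurable_prod _ fun i _ => (measurable_gaussianPDF 0 1).comp (measurable_pi_apply i)
  rw [stdNormal, lintegral_withDensity_eq_lintegral_mul _ hmp hms]
  refine Eq.trans (lintegral_congr fun z => ?_)
    ((key p le_rfl h hh).trans (lintegral_congr fun z => ?_))
  · simp only [Pi.mul_apply, partialDensity, Nat.not_lt_zero, if_false]
    rw [mul_comm, Equiv.prod_comp σ fun i => gaussianPDF 0 1 (z i)]
  · simp [partialDensity]

/-! ### Sampling the acceptances -/

/-- Set the bits of `U` one after another, the bit of step `n` being `1` with probability `α n U`
if the entries of `V` are uniformly distributed. -/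
noncomputable def sampleBits (σ : Equiv.Perm (Fin p)) (α : Fin p → (Fin p → Bool) → ℝ)
    (V : Fin p → ℝ) : ℕ → Fin p → Bool
  | 0 => fun _ => false
  | n + 1 =>
    if h : n < p then
      Function.update (sampleBits σ α V n) (σ ⟨n, h⟩)
        (decide (V (σ ⟨n, h⟩) < α ⟨n, h⟩ (sampleBits σ α V n)))
    else sampleBits σ α V n

theorem sampleBits_apply {α : Fin p → (Fin p → Bool) → ℝ} {V : Fin p → ℝ} {n : ℕ} (k : Fin p)
    (hk : k.val < n) :
    sampleBits σ α V n (σ k) = decide (V (σ k) < α k (sampleBits σ α V k)) := by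
  induction n with
  | zero => omega
  | succ n ih =>
    by_cases h : n < p
    · rw [sampleBits, dif_pos h]
      rcases Nat.lt_succ_iff_lt_or_eq.mp hk with hlt | heq
      · rw [Function.update_of_ne (σ.injective.ne (Fin.ne_of_lt hlt)), ih hlt]
      · have : k = ⟨n, h⟩ := Fin.ext heq
        subst this
        rw [Function.update_self]
    · rw [sampleBits, dif_neg h, ih (by omega)]

/-- By causality the probabilities along the run may be evaluated at the target `u`. The event thus
becomes a product of conditions on the separate entries of `V`, and its probability factorizes. -/
theorem sampleBits_eq_iff {α : Fin p → (Fin p → Bool) → ℝ}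
    (hα : ∀ n u u', (∀ k < n, u (σ k) = u' (σ k)) → α n u = α n u') {V : Fin p → ℝ}
    {u : Fin p → Bool} :
    sampleBits σ α V p = u ↔ ∀ n, u (σ n) = decide (V (σ n) < α n u) := by
  constructor
  · rintro rfl n
    rw [sampleBits_apply n n.isLt]
    congr 2
    refine hα n _ _ fun k hk => ?_
    rw [sampleBits_apply k hk, sampleBits_apply k k.isLt]
  · intro h
    have key : ∀ n ≤ p, ∀ k : Fin p, k.val < n → sampleBits σ α V n (σ k) = u (σ k) := by
      intro n
      induction n using Nat.strong_induction_on with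
      | _ n ih =>
        intro hn k hk
        rw [sampleBits_apply k hk, h k, hα k _ u fun j hj => ih k hk (by omega) j hj]
    ext j
    have := key p le_rfl (σ.symm j) (σ.symm j).isLt
    rwa [Equiv.apply_symm_apply] at this

theorem sampleBits_congr {α α' : Fin p → (Fin p → Bool) → ℝ} (h : ∀ n u, α n u = α' n u)
    (V : Fin p → ℝ) (n : ℕ) : sampleBits σ α V n = sampleBits σ α' V n := by
  rw [show α = α' from funext fun n => funext fun u => h n u]

theorem measurable_sampleBits {E : Type*} [MeasurableSpace E]
    {α : E → Fin p → (Fin p → Bool) → ℝ} {V : E → Fin p → ℝ}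
    (hα : ∀ n, Measurable fun a : E × (Fin p → Bool) => α a.1 n a.2) (hV : Measurable V) (n : ℕ) :
    Measurable fun e => sampleBits σ (α e) (V e) n := by
  induction n with
  | zero => exact measurable_const
  | succ n ih =>
    by_cases h : n < p
    · simp only [sampleBits, dif_pos h]
      refine measurable_update'.comp (ih.prodMk ?_)
      have h1 := (hα ⟨n, h⟩).comp (measurable_id.prodMk ih)
      have h2 := (measurable_pi_apply (σ ⟨n, h⟩)).comp hV
      refine measurable_to_bool ?_
      convert measurableSet_lt h2 h1 using 1
      ext e
      exact decide_eq_true_iff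
    · simpa only [sampleBits, dif_neg h] using ih

/-- The distribution of a vector of independent variables, uniformly distributed on `[0, 1]`. -/
noncomputable def stdUniform (p : ℕ) : Measure (Fin p → ℝ) :=
  Measure.pi fun _ => volume.restrict (Set.Icc 0 1)

instance isProbabilityMeasure_stdUniform : IsProbabilityMeasure (stdUniform p) := by
  have : IsProbabilityMeasure ((volume : Measure ℝ).restrict (Set.Icc 0 1)) := ⟨by simp⟩
  unfold stdUniform
  infer_instance

theorem restrict_Icc_setOf_lt {a : ℝ} (h0 : 0 ≤ a) (h1 : a ≤ 1) (b : Bool) :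
    (volume : Measure ℝ).restrict (Set.Icc 0 1) {t | b = decide (t < a)} =
      ENNReal.ofReal (if b then a else 1 - a) := by
  cases b
  · have hset : {t : ℝ | false = decide (t < a)} = Set.Ici a := by ext; simp
    rw [hset, Measure.restrict_apply measurableSet_Ici]
    have : Set.Ici a ∩ Set.Icc 0 1 = Set.Icc a 1 := by
      ext t; simp only [Set.mem_inter_iff, Set.mem_Ici, Set.mem_Icc]
      exact ⟨fun h => ⟨h.1, h.2.2⟩, fun h => ⟨h.1, h0.trans h.1, h.2⟩⟩
    rw [this, Real.volume_Icc]
    simp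
  · have hset : {t : ℝ | true = decide (t < a)} = Set.Iio a := by ext; simp
    rw [hset, Measure.restrict_apply measurableSet_Iio]
    have : Set.Iio a ∩ Set.Icc 0 1 = Set.Ico 0 a := by
      ext t; simp only [Set.mem_inter_iff, Set.mem_Iio, Set.mem_Icc, Set.mem_Ico]
      exact ⟨fun h => ⟨h.2.1, h.1⟩, fun h => ⟨h.2, h.1, h.2.le.trans h1⟩⟩
    rw [this, Real.volume_Ico]
    simp

theorem lintegral_sampleBits {α : Fin p → (Fin p → Bool) → ℝ}
    (hα : ∀ n u u', (∀ k < n, u (σ k) = u' (σ k)) → α n u = α n u')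
    (h0 : ∀ n u, 0 ≤ α n u) (h1 : ∀ n u, α n u ≤ 1) (h : (Fin p → Bool) → ℝ≥0∞) :
    ∫⁻ V, h (sampleBits σ α V p) ∂(stdUniform p) =
      ∑ u, h u * ENNReal.ofReal (∏ n, if u (σ n) then α n u else 1 - α n u) := by
  have hm : Measurable fun V => sampleBits σ α V p :=
    measurable_sampleBits (E := Fin p → ℝ) (α := fun _ => α) (V := id)
      (fun n => (measurable_of_finite (α n)).comp measurable_snd) measurable_id p
  rw [← lintegral_map (measurable_of_finite h) hm, lintegral_fintype]
  refine Finset.sum_congr rfl fun u _ => ?_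
  congr 1
  rw [Measure.map_apply hm (measurableSet_singleton u)]
  have hset : (fun V => sampleBits σ α V p) ⁻¹' {u} =
      Set.univ.pi fun i => {t : ℝ | u i = decide (t < α (σ.symm i) u)} := by
    ext V
    simp only [Set.mem_preimage, Set.mem_singleton_iff, sampleBits_eq_iff hα, Set.mem_pi,
      Set.mem_univ, true_imp_iff, Set.mem_ofPred_eq]
    exact ⟨fun h i => by simpa using h (σ.symm i), fun h n => by simpa using h (σ n)⟩
  rw [hset, stdUniform, Measure.pi_pi, ENNReal.ofReal_prod_of_nonneg]
  · rw [← Equiv.prod_comp σ]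
    refine Finset.prod_congr rfl fun n _ => ?_
    rw [Equiv.symm_apply_apply, restrict_Icc_setOf_lt (h0 n u) (h1 n u)]
  · intro n _
    split_ifs
    · exact h0 n u
    · exact sub_nonneg.mpr (h1 n u)

end Sampling

end Knockoff

namespace Knockoff

/-! ### The law of the sampled run -/

section RunLaw

variable {p : ℕ} {Φ : (Fin p → ℝ) → ℝ} {σ : Equiv.Perm (Fin p)}

/-- The proposals and acceptances sampled with the seeds `z` and `V` for the input `x`. -/
noncomputable def sampleRun (Φ : (Fin p → ℝ) → ℝ) (σ : Equiv.Perm (Fin p))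
    (q : Fin p → (Fin p → ℝ) → (Fin p → ℝ) → (Fin p → Bool) → ℝ → ℝ)
    (m : Fin p → (Fin p → ℝ) → (Fin p → ℝ) → ℝ) (v : Fin p → ℝ≥0) (x z V : Fin p → ℝ) :
    (Fin p → ℝ) × (Fin p → Bool) :=
  let y := sampleProposals σ (fun n => m n x) v z p
  (y, sampleBits σ (fun n => acceptProb σ q (metroDensity Φ σ q n) n x y) V p)

variable {q : Fin p → (Fin p → ℝ) → (Fin p → ℝ) → (Fin p → Bool) → ℝ → ℝ}
  {m : Fin p → (Fin p → ℝ) → (Fin p → ℝ) → ℝ} {v : Fin p → ℝ≥0}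

theorem acceptProb_causal (hq : IsFaithfulProposal σ q) (n : Fin p) (x y : Fin p → ℝ)
    {u u' : Fin p → Bool} (h : ∀ k < n, u (σ k) = u' (σ k)) :
    acceptProb σ q (metroDensity Φ σ q n) n x y u =
      acceptProb σ q (metroDensity Φ σ q n) n x y u' := by
  have h1 : ∀ z, metroDensity Φ σ q n z y u = metroDensity Φ σ q n z y u' := fun z =>
    metroDensity_causal hq n z fun k hk => ⟨rfl, h k hk⟩
  have h2 : ∀ z, q n z y u = q n z y u' := fun z =>
    hq.causal n z y y u u' fun k hk => ⟨rfl, h k hk⟩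
  simp only [acceptProb, h1, h2]

theorem measurable_sampleRun (hΦ : Measurable Φ) (hq : IsFaithfulProposal σ q)
    (hm : ∀ n, Measurable fun a : (Fin p → ℝ) × (Fin p → ℝ) => m n a.1 a.2) :
    Measurable fun a : (Fin p → ℝ) × (Fin p → ℝ) × (Fin p → ℝ) =>
      sampleRun Φ σ q m v a.1 a.2.1 a.2.2 := by
  have hy : Measurable fun a : (Fin p → ℝ) × (Fin p → ℝ) × (Fin p → ℝ) =>
      sampleProposals σ (fun n => m n a.1) v a.2.1 p :=
    measurable_sampleProposals (m := fun (a : (Fin p → ℝ) × (Fin p → ℝ) × (Fin p → ℝ)) n =>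
      m n a.1) (v := fun _ => v) (fun n => (hm n).comp (f := fun a :
        ((Fin p → ℝ) × (Fin p → ℝ) × (Fin p → ℝ)) × (Fin p → ℝ) => (a.1.1, a.2)) (by fun_prop))
      (fun _ => measurable_const) (by fun_prop) p
  refine hy.prodMk (measurable_sampleBits (fun n => ?_) (by fun_prop) p)
  have h := measurable_acceptProb (E := Unit) (σ := σ) (r := fun _ => q)
    (g := fun _ => metroDensity Φ σ q n) n ((hq.measurable n).comp measurable_snd)
    ((measurable_metroDensity_const hΦ hq n).comp measurable_snd)
  exact h.comp (f := fun a : ((Fin p → ℝ) × (Fin p → ℝ) × (Fin p → ℝ)) × (Fin p → Bool) =>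
    ((), a.1.1, sampleProposals σ (fun n => m n a.1.1) v a.1.2.1 p, a.2))
    (measurable_const.prodMk ((by fun_prop : Measurable fun a :
      ((Fin p → ℝ) × (Fin p → ℝ) × (Fin p → ℝ)) × (Fin p → Bool) => a.1.1).prodMk
        ((hy.comp measurable_fst).prodMk measurable_snd)))

/-- The means of the proposals do not involve the acceptances, so drawing all proposals before all
acceptances gives the same joint density: the product in `metroDensity_eq_prod` is merely reordered.
-/
theorem map_sampleRun (hΦ : ∀ x, 0 ≤ Φ x) (hΦm : Measurable Φ) (hq : IsFaithfulProposal σ q)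
    (hqm : ∀ n x y u t, q n x y u t = gaussianPDFReal (m n x y) (v n) t)
    (hm : ∀ n, Measurable fun a : (Fin p → ℝ) × (Fin p → ℝ) => m n a.1 a.2)
    (hv : ∀ n, v n ≠ 0)
    (hcausal : ∀ n x y y', (∀ k < n, y (σ k) = y' (σ k)) → m n x y = m n x y') :
    ((law Φ).prod ((stdNormal p).prod (stdUniform p))).map
      (fun a => (a.1, sampleRun Φ σ q m v a.1 a.2.1 a.2.2)) = metroLaw Φ σ q := by
  have hrun := measurable_sampleRun (v := v) hΦm hq hm
  have hg := (measurable_metroDensity_const hΦm hq p).ennreal_ofReal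
  refine Measure.ext_of_lintegral _ fun h hh => ?_
  rw [lintegral_map hh (measurable_fst.prodMk hrun), law, metroLaw, Measure.prod_smul_left,
    lintegral_smul_measure, lintegral_smul_measure,
    lintegral_withDensity_eq_lintegral_mul _ hg hh]
  congr 1
  have hc : Measurable fun a : (Fin p → ℝ) × (Fin p → ℝ) × (Fin p → ℝ) =>
    h (a.1, sampleRun Φ σ q m v a.1 a.2.1 a.2.2) := hh.comp (measurable_fst.prodMk hrun)
  have hc' : Measurable fun x => ∫⁻ w, h (x, sampleRun Φ σ q m v x w.1 w.2)
    ∂((stdNormal p).prod (stdUniform p)) := hc.lintegral_prod_right'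
  rw [lintegral_prod _ hc.aemeasurable,
    lintegral_withDensity_eq_lintegral_mul _ hΦm.ennreal_ofReal hc',
    lintegral_prod _ (hg.mul hh).aemeasurable]
  refine lintegral_congr fun x => ?_
  have hhx : Measurable fun a : (Fin p → ℝ) × (Fin p → Bool) => h (x, a) :=
    hh.comp measurable_prodMk_left
  have hrx : Measurable fun a : (Fin p → ℝ) × (Fin p → ℝ) =>
    h (x, sampleRun Φ σ q m v x a.1 a.2) := hc.comp measurable_prodMk_left
  have hgx : Measurable fun a : (Fin p → ℝ) × (Fin p → Bool) =>
    ((fun b : (Fin p → ℝ) × (Fin p → ℝ) × (Fin p → Bool) =>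
      ENNReal.ofReal (metroDensity Φ σ q p b.1 b.2.1 b.2.2)) * h) (x, a) :=
    (hg.mul hh).comp measurable_prodMk_left
  have hmx : ∀ n, Measurable (m n x) := fun n => (hm n).comp measurable_prodMk_left
  rw [Pi.mul_apply, lintegral_prod _ hrx.aemeasurable, lintegral_prod _ hgx.aemeasurable]
  let b : (Fin p → ℝ) → (Fin p → Bool) → ℝ := fun y u => ∏ n, if u (σ n)
    then acceptProb σ q (metroDensity Φ σ q n) n x y u
    else 1 - acceptProb σ q (metroDensity Φ σ q n) n x y u
  have hb0 : ∀ y u, 0 ≤ b y u := fun y u => Finset.prod_nonneg fun n _ => by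
    split_ifs
    · exact acceptProb_nonneg hq.nonneg (metroDensity_nonneg hΦ hq.nonneg n) n x y u
    · exact sub_nonneg.mpr (acceptProb_le_one _ n x y u)
  have hinner : ∀ z, ∫⁻ V, h (x, sampleRun Φ σ q m v x z V) ∂(stdUniform p) =
      (fun y => ∑ u, h (x, y, u) * ENNReal.ofReal (b y u))
        (sampleProposals σ (fun n => m n x) v z p) := fun z =>
    lintegral_sampleBits (fun n u u' huu' => acceptProb_causal hq n x _ huu')
      (fun n u => acceptProb_nonneg hq.nonneg (metroDensity_nonneg hΦ hq.nonneg n) n x _ u)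
      (fun n u => acceptProb_le_one _ n x _ u)
      fun u => h (x, sampleProposals σ (fun n => m n x) v z p, u)
  have hbm : ∀ u, Measurable fun y => b y u := fun u => by
    refine Finset.measurable_prod _ fun n _ => ?_
    have h1 := (measurable_acceptProb (E := Unit) (σ := σ) (r := fun _ => q)
      (g := fun _ => metroDensity Φ σ q n) n ((hq.measurable n).comp measurable_snd)
      ((measurable_metroDensity_const hΦm hq n).comp measurable_snd)).comp
      (f := fun y : Fin p → ℝ => ((), x, y, u)) (by fun_prop)
    split_ifs
    · exact h1
    · exact measurable_const.sub h1
  have hsum : Measurable fun y => ∑ u, h (x, y, u) * ENNReal.ofReal (b y u) :=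
    Finset.measurable_sum _ fun u _ =>
      (hhx.comp (measurable_id.prodMk measurable_const)).mul (hbm u).ennreal_ofReal
  simp only [hinner]
  rw [lintegral_sampleProposals hmx hv (fun n y y' => hcausal n x y y') hsum,
    ← lintegral_const_mul]
  · refine lintegral_congr fun y => ?_
    rw [lintegral_count, tsum_fintype, Finset.sum_mul, Finset.mul_sum]
    refine Finset.sum_congr rfl fun u _ => ?_
    rw [Pi.mul_apply, metroDensity_eq_prod, ENNReal.ofReal_mul (hΦ x), Finset.prod_mul_distrib,
      ENNReal.ofReal_mul (Finset.prod_nonneg fun n _ => hq.nonneg _ _ _ _ _),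
      ENNReal.ofReal_prod_of_nonneg fun n _ => hq.nonneg _ _ _ _ _]
    simp only [hqm]
    have : ∀ n : Fin p, ENNReal.ofReal (gaussianPDFReal (m n x y) (v n) (y (σ n))) =
      gaussianPDF (m n x y) (v n) (y (σ n)) := fun n => rfl
    simp only [this]
    ring
  · refine hsum.mul (Finset.measurable_prod _ fun n _ => ?_)
    exact measurable_uncurry_gaussianPDF.comp
      ((hmx n).prodMk (measurable_const.prodMk (measurable_pi_apply _)))

end RunLaw

end Knockoff

namespace Knockoff

/-! ### Conditioning of Gaussian vectors -/

section Conditioning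

variable {ι : Type*} [Fintype ι] {Γ : Matrix ι ι ℝ} {P : ι → Prop} {z w : ι → ℝ} {i₀ : ι}

open Classical in
/-- The solution, supported on `P`, of those equations of the system `Γ w = z` which have their
index in `P`. -/
noncomputable def restrictedSolve (Γ : Matrix ι ι ℝ) (P : ι → Prop) (z : ι → ℝ) : ι → ℝ := fun i =>
  if h : P i then ((Γ.submatrix Subtype.val Subtype.val : Matrix {i // P i} {i // P i} ℝ)⁻¹ *ᵥ
    fun i => z i.1) ⟨i, h⟩ else 0

theorem restrictedSolve_of_not {i : ι} (h : ¬ P i) : restrictedSolve Γ P z i = 0 := by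
  rw [restrictedSolve, dif_neg h]

theorem restrictedSolve_congr {z' : ι → ℝ} (h : ∀ i, P i → z i = z' i) :
    restrictedSolve Γ P z = restrictedSolve Γ P z' := by
  have : (fun i : {i // P i} => z i.1) = fun i => z' i.1 := funext fun i => h i.1 i.2
  funext i
  simp only [restrictedSolve, this]

open Classical in
theorem dotProduct_eq_sum_subtype {a : ι → ℝ} (h : ∀ i, ¬ P i → w i = 0) :
    a ⬝ᵥ w = ∑ i : {i // P i}, a i.1 * w i.1 := by
  rw [← Finset.sum_subtype (Finset.univ.filter P) (by simp) fun i => a i * w i, Finset.sum_filter]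
  refine Finset.sum_congr rfl fun i _ => ?_
  split_ifs with hi
  · rfl
  · rw [h i hi, mul_zero]

theorem mulVec_restrictedSolve (hΓ : Γ.PosDef) {i : ι} (hi : P i) :
    (Γ *ᵥ restrictedSolve Γ P z) i = z i := by
  classical
  have hA : (Γ.submatrix Subtype.val Subtype.val : Matrix {i // P i} {i // P i} ℝ).PosDef :=
    hΓ.submatrix Subtype.val_injective
  have h := congrFun (Matrix.mulVec_mulVec (fun i : {i // P i} => z i.1)
    (Γ.submatrix Subtype.val Subtype.val : Matrix {i // P i} {i // P i} ℝ)
    (Γ.submatrix Subtype.val Subtype.val : Matrix {i // P i} {i // P i} ℝ)⁻¹) ⟨i, hi⟩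
  rw [Matrix.mul_nonsing_inv _ ((Matrix.isUnit_iff_isUnit_det _).mp hA.isUnit),
    Matrix.one_mulVec] at h
  rw [← h, Matrix.mulVec, dotProduct_eq_sum_subtype fun i hi => restrictedSolve_of_not hi]
  rw [Matrix.mulVec, dotProduct]
  refine Finset.sum_congr rfl fun k _ => ?_
  rw [restrictedSolve, dif_pos k.2]
  simp only [Matrix.submatrix_apply]

theorem dotProduct_eq_of_eqOn {a b : ι → ℝ} (h0 : ∀ i, ¬ P i → w i = 0)
    (h : ∀ i, P i → a i = b i) : a ⬝ᵥ w = b ⬝ᵥ w :=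
  Finset.sum_congr rfl fun i _ => by
    by_cases hi : P i
    · rw [h i hi]
    · rw [h0 i hi, mul_zero, mul_zero]

theorem eq_zero_of_dotProduct_mulVec (hΓ : Γ.PosDef) (h : w ⬝ᵥ (Γ *ᵥ w) = 0) : w = 0 := by
  by_contra hne
  have := hΓ.dotProduct_mulVec_pos hne
  simp at this
  linarith

/-- The difference of two solutions vanishes off `P` and its image under `Γ` vanishes on `P`, so its
quadratic form is zero. Extending solutions by zero avoids changing index types as the set of
conditioned coordinates grows. -/
theorem eq_restrictedSolve (hΓ : Γ.PosDef) (h0 : ∀ i, ¬ P i → w i = 0)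
    (h1 : ∀ i, P i → (Γ *ᵥ w) i = z i) : w = restrictedSolve Γ P z := by
  rw [← sub_eq_zero]
  have hs : ∀ i, ¬ P i → (w - restrictedSolve Γ P z) i = 0 := fun i hi => by
    simp [h0 i hi, restrictedSolve_of_not hi]
  refine eq_zero_of_dotProduct_mulVec hΓ ?_
  rw [dotProduct_comm, dotProduct_eq_of_eqOn (b := 0) hs, zero_dotProduct]
  intro i hi
  rw [Matrix.mulVec_sub, Pi.sub_apply, h1 i hi, mulVec_restrictedSolve hΓ hi, sub_self,
    Pi.zero_apply]

theorem restrictedSolve_comp (hΓ : Γ.PosDef) (π : Equiv.Perm ι)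
    (hπ : ∀ i k, Γ (π i) (π k) = Γ i k) (hP : ∀ i, P (π i) ↔ P i) :
    restrictedSolve Γ P (z ∘ π) = restrictedSolve Γ P z ∘ π := by
  refine (eq_restrictedSolve hΓ (fun i hi => restrictedSolve_of_not (by rwa [hP])) ?_).symm
  intro i hi
  have h := mulVec_restrictedSolve (z := z) hΓ ((hP i).mpr hi)
  rw [Function.comp_apply, ← h, Matrix.mulVec, Matrix.mulVec, dotProduct, dotProduct]
  exact Fintype.sum_equiv π _ _ fun k =>
    congrArg (· * restrictedSolve Γ P z (π k)) (hπ i k).symm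

/-- The conditional mean of `Z i₀` given `Z i = z i` for all `i` in `P`. -/
noncomputable def condMean (Γ : Matrix ι ι ℝ) (P : ι → Prop) (i₀ : ι) (z : ι → ℝ) : ℝ :=
  (fun i => Γ i i₀) ⬝ᵥ restrictedSolve Γ P z

/-- The conditional variance of `Z i₀` given `Z i` for all `i` in `P`. -/
noncomputable def condVar (Γ : Matrix ι ι ℝ) (P : ι → Prop) (i₀ : ι) : ℝ :=
  Γ i₀ i₀ - (fun i => Γ i i₀) ⬝ᵥ restrictedSolve Γ P fun i => Γ i i₀

theorem posDef_symm_apply {ι : Type*} {Γ : Matrix ι ι ℝ} (hΓ : Γ.PosDef) (i k : ι) : Γ i k = Γ k i := by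
  simpa using (hΓ.isHermitian.apply k i)

theorem mulVec_apply_eq (hΓ : Γ.PosDef) (w : ι → ℝ) (i : ι) :
    (Γ *ᵥ w) i = (fun k => Γ k i) ⬝ᵥ w :=
  Finset.sum_congr rfl fun k _ => congrArg (· * w k) (posDef_symm_apply hΓ i k)

theorem posDef_dotProduct_mulVec_comm (hΓ : Γ.PosDef) (v w : ι → ℝ) :
    v ⬝ᵥ (Γ *ᵥ w) = w ⬝ᵥ (Γ *ᵥ v) := by
  rw [Matrix.dotProduct_mulVec, dotProduct_comm]
  congr 1
  funext i
  exact Finset.sum_congr rfl fun k _ =>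
    (mul_comm _ _).trans (congrArg (· * v k) (posDef_symm_apply hΓ k i))

theorem dotProduct_restrictedSolve_comm (hΓ : Γ.PosDef) (z z' : ι → ℝ) :
    z ⬝ᵥ restrictedSolve Γ P z' = z' ⬝ᵥ restrictedSolve Γ P z := by
  have key : ∀ z z' : ι → ℝ, z ⬝ᵥ restrictedSolve Γ P z' =
      restrictedSolve Γ P z' ⬝ᵥ (Γ *ᵥ restrictedSolve Γ P z) := fun z z' => by
    rw [dotProduct_comm _ (Γ *ᵥ _)]
    exact dotProduct_eq_of_eqOn (fun i hi => restrictedSolve_of_not hi)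
      fun i hi => (mulVec_restrictedSolve hΓ hi).symm
  rw [key, key, posDef_dotProduct_mulVec_comm hΓ]

/-- The conditional variance is the value of the quadratic form `Γ` at the unit vector of `i₀` minus
the vector of regression coefficients, which is supported on `P`. -/
theorem condVar_pos (hΓ : Γ.PosDef) (hi₀ : ¬ P i₀) : 0 < condVar Γ P i₀ := by
  classical
  set b := restrictedSolve Γ P fun i => Γ i i₀ with hb
  have hv : (Pi.single i₀ 1 - b : ι → ℝ) ≠ 0 := fun h => by
    have := congrFun h i₀
    simp [hb, restrictedSolve_of_not hi₀] at this
  have h := hΓ.dotProduct_mulVec_pos hv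
  have h1 : (Γ *ᵥ b) i₀ = (fun k => Γ k i₀) ⬝ᵥ b := mulVec_apply_eq hΓ b i₀
  have h2 : b ⬝ᵥ (Γ *ᵥ b) = (fun k => Γ k i₀) ⬝ᵥ b := by
    rw [dotProduct_comm]
    exact dotProduct_eq_of_eqOn (fun i hi => restrictedSolve_of_not hi)
      fun i hi => mulVec_restrictedSolve hΓ hi
  have h3 : Γ *ᵥ (Pi.single i₀ 1) = fun i => Γ i i₀ := by
    funext i; simp
  rw [star_trivial, Matrix.mulVec_sub, dotProduct_sub, sub_dotProduct, sub_dotProduct, h2, h3,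
    single_one_dotProduct, single_one_dotProduct, h1, dotProduct_comm b] at h
  rw [condVar]
  linarith

theorem condMean_congr {z' : ι → ℝ} (h : ∀ i, P i → z i = z' i) :
    condMean Γ P i₀ z = condMean Γ P i₀ z' := by
  rw [condMean, condMean, restrictedSolve_congr h]

theorem condMean_comp (hΓ : Γ.PosDef) (π : Equiv.Perm ι)
    (hπ : ∀ i k, Γ (π i) (π k) = Γ i k) (hP : ∀ i, P (π i) ↔ P i) (h0 : π i₀ = i₀) :
    condMean Γ P i₀ (z ∘ π) = condMean Γ P i₀ z := by
  rw [condMean, condMean, restrictedSolve_comp hΓ π hπ hP]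
  refine Fintype.sum_equiv π _ _ fun k => congrArg (· * restrictedSolve Γ P z (π k)) ?_
  have := hπ k i₀
  rw [h0] at this
  exact this.symm

/-- The exponent of the Gaussian density of the coordinates in `P`. -/
noncomputable def energy (Γ : Matrix ι ι ℝ) (P : ι → Prop) (z : ι → ℝ) : ℝ :=
  z ⬝ᵥ restrictedSolve Γ P z

theorem energy_comp (hΓ : Γ.PosDef) (π : Equiv.Perm ι)
    (hπ : ∀ i k, Γ (π i) (π k) = Γ i k) (hP : ∀ i, P (π i) ↔ P i) :
    energy Γ P (z ∘ π) = energy Γ P z := by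
  rw [energy, energy, restrictedSolve_comp hΓ π hπ hP]
  exact Fintype.sum_equiv π _ _ fun k => rfl

/-- Completion of the square. With `b` the regression coefficients and `r` the residual divided by
the conditional variance, the new solution is the old one minus `r • b` plus `r` at `i₀`. -/
theorem energy_insert (hΓ : Γ.PosDef) (hi₀ : ¬ P i₀) {Q : ι → Prop}
    (hQ : ∀ i, Q i ↔ P i ∨ i = i₀) :
    energy Γ Q z = energy Γ P z + (z i₀ - condMean Γ P i₀ z) ^ 2 / condVar Γ P i₀ := by
  classical
  have hvar := condVar_pos hΓ hi₀
  set b := restrictedSolve Γ P fun i => Γ i i₀ with hb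
  set r := (z i₀ - condMean Γ P i₀ z) / condVar Γ P i₀ with hr
  have hr' : r * condVar Γ P i₀ = z i₀ - condMean Γ P i₀ z := by
    rw [hr, div_mul_cancel₀ _ hvar.ne']
  have h3 : Γ *ᵥ (Pi.single i₀ 1) = fun i => Γ i i₀ := by
    funext i; simp
  have hsol : restrictedSolve Γ P z - r • b + r • Pi.single i₀ 1 = restrictedSolve Γ Q z := by
    refine eq_restrictedSolve hΓ (fun i hi => ?_) fun i hi => ?_
    · rw [hQ, not_or] at hi
      simp [hb, restrictedSolve_of_not hi.1, hi.2]
    · rw [Matrix.mulVec_add, Matrix.mulVec_sub, Matrix.mulVec_smul, Matrix.mulVec_smul, h3]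
      simp only [Pi.add_apply, Pi.sub_apply, Pi.smul_apply, smul_eq_mul]
      rcases (hQ i).mp hi with hi | rfl
      · rw [mulVec_restrictedSolve hΓ hi, hb, mulVec_restrictedSolve hΓ hi]
        ring
      · rw [mulVec_apply_eq hΓ, mulVec_apply_eq hΓ, ← condMean]
        have : condVar Γ P i = Γ i i - (fun k => Γ k i) ⬝ᵥ b := rfl
        rw [this] at hr'
        linarith
  have hzb : z ⬝ᵥ b = condMean Γ P i₀ z := by
    rw [hb, dotProduct_restrictedSolve_comm hΓ, condMean]
  rw [energy, ← hsol, dotProduct_add, dotProduct_sub, dotProduct_smul, dotProduct_smul, hzb,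
    dotProduct_single_one, energy, smul_eq_mul, smul_eq_mul, hr]
  field_simp
  ring

/-- A marginal density times a conditional density is the larger marginal density, up to a constant
which does not depend on `z`. -/
theorem gaussianPDFReal_condMean (hΓ : Γ.PosDef) (hi₀ : ¬ P i₀) {Q : ι → Prop}
    (hQ : ∀ i, Q i ↔ P i ∨ i = i₀) :
    Real.exp (-energy Γ P z / 2) *
        gaussianPDFReal (condMean Γ P i₀ z) (condVar Γ P i₀).toNNReal (z i₀) =
      (√(2 * Real.pi * condVar Γ P i₀))⁻¹ * Real.exp (-energy Γ Q z / 2) := by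
  have hvar := condVar_pos hΓ hi₀
  rw [gaussianPDFReal, Real.coe_toNNReal _ hvar.le, mul_left_comm, ← Real.exp_add,
    energy_insert hΓ hi₀ hQ]
  congr 2
  field_simp
  ring

/-! ### Measurable dependence of conditional means and variances on the covariance matrix. -/

theorem measurable_inv_apply {E κ : Type*} [MeasurableSpace E] [Fintype κ] [DecidableEq κ]
    {M : E → Matrix κ κ ℝ} (hM : ∀ i k, Measurable fun e => M e i k) (i k : κ) :
    Measurable fun e => (M e)⁻¹ i k := by
  have hdet : ∀ {N : E → Matrix κ κ ℝ}, (∀ i k, Measurable fun e => N e i k) →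
      Measurable fun e => (N e).det := fun hN => by
    simp only [Matrix.det_apply]
    exact Finset.measurable_sum _ fun τ _ =>
      (Finset.measurable_prod _ fun i _ => hN _ _).const_smul _
  simp only [Matrix.inv_def, Matrix.smul_apply, Ring.inverse_eq_inv', smul_eq_mul,
    Matrix.adjugate_apply]
  refine (hdet hM).inv.mul (hdet fun a b => ?_)
  simp only [Matrix.updateRow_apply]
  split_ifs
  · exact measurable_const
  · exact hM _ _

theorem measurable_restrictedSolve {E : Type*} [MeasurableSpace E] {M : E → Matrix ι ι ℝ}
    (hM : ∀ i k, Measurable fun e => M e i k) {z : E → ι → ℝ}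
    (hz : ∀ i, Measurable fun e => z e i) (i : ι) :
    Measurable fun e => restrictedSolve (M e) P (z e) i := by
  classical
  by_cases hi : P i
  · simp only [restrictedSolve, dif_pos hi, Matrix.mulVec, dotProduct]
    exact Finset.measurable_sum _ fun k _ => (measurable_inv_apply (fun _ _ => hM _ _) _ _).mul
      (hz _)
  · simp only [restrictedSolve, dif_neg hi]
    exact measurable_const

theorem measurable_condMean {E : Type*} [MeasurableSpace E] {M : E → Matrix ι ι ℝ}
    (hM : ∀ i k, Measurable fun e => M e i k) {z : E → ι → ℝ}
    (hz : ∀ i, Measurable fun e => z e i) (i₀ : ι) :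
    Measurable fun e => condMean (M e) P i₀ (z e) :=
  Finset.measurable_sum _ fun k _ => (hM _ _).mul (measurable_restrictedSolve hM hz k)

theorem measurable_condVar {E : Type*} [MeasurableSpace E] {M : E → Matrix ι ι ℝ}
    (hM : ∀ i k, Measurable fun e => M e i k) (i₀ : ι) :
    Measurable fun e => condVar (M e) P i₀ :=
  (hM _ _).sub (Finset.measurable_sum _ fun k _ =>
    (hM _ _).mul (measurable_restrictedSolve hM (fun _ => hM _ _) k))

end Conditioning

end Knockoff

namespace Knockoff

/-! ### Covariance-guided proposals -/

section CovGuided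

variable {p : ℕ} {S : Matrix (Fin p) (Fin p) ℝ} {s : Fin p → ℝ} {σ : Equiv.Perm (Fin p)}

/-- The coordinates which are conditioned on in step `n`. -/
def condSet (σ : Equiv.Perm (Fin p)) (n : ℕ) : Fin p ⊕ Fin p → Prop := fun i =>
  ∀ j, i = Sum.inr j → (σ.symm j).val < n

theorem condSet_inl (n : ℕ) (j : Fin p) : condSet σ n (Sum.inl j) := fun k hk => by
  cases hk

theorem condSet_inr (n : ℕ) (j : Fin p) : condSet σ n (Sum.inr j) ↔ (σ.symm j).val < n :=
  ⟨fun h => h j rfl, fun h k hk => by rwa [← Sum.inr_injective hk]⟩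

theorem not_condSet (n : Fin p) : ¬ condSet σ n (Sum.inr (σ n)) := by
  simp [condSet_inr]

theorem condSet_succ (n : Fin p) (i : Fin p ⊕ Fin p) :
    condSet σ (n + 1) i ↔ condSet σ n i ∨ i = Sum.inr (σ n) := by
  rcases i with j | j
  · simp [condSet_inl]
  · rw [condSet_inr, condSet_inr, Sum.inr.injEq, ← Equiv.symm_apply_eq, Fin.ext_iff]
    omega

/-- The mean of the covariance-guided proposal. -/
noncomputable def covGuidedMean (S : Matrix (Fin p) (Fin p) ℝ) (s : Fin p → ℝ)
    (σ : Equiv.Perm (Fin p)) (n : Fin p) (x y : Fin p → ℝ) : ℝ :=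
  condMean (Gam S s) (condSet σ n) (Sum.inr (σ n)) (Sum.elim x y)

/-- The variance of the covariance-guided proposal. -/
noncomputable def covGuidedVar (S : Matrix (Fin p) (Fin p) ℝ) (s : Fin p → ℝ)
    (σ : Equiv.Perm (Fin p)) (n : Fin p) : ℝ :=
  condVar (Gam S s) (condSet σ n) (Sum.inr (σ n))

/-- The instances are arbitrary arguments because those in `covGuided` need not be the classical
ones in `restrictedSolve`. -/
theorem dotProduct_inv_mulVec_eq {ι : Type*} [Fintype ι] (Γ : Matrix ι ι ℝ) (P : ι → Prop)
    {_ : Fintype {i // P i}} {_ : DecidableEq {i // P i}} (a z : ι → ℝ) :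
    (fun i : {i // P i} => a i.1) ⬝ᵥ
      ((Γ.submatrix Subtype.val Subtype.val : Matrix {i // P i} {i // P i} ℝ)⁻¹ *ᵥ
        fun i => z i.1) = a ⬝ᵥ restrictedSolve Γ P z := by
  classical
  rw [dotProduct_eq_sum_subtype fun i hi => restrictedSolve_of_not hi, dotProduct]
  refine Finset.sum_congr (by ext; simp) fun i _ => ?_
  rw [restrictedSolve, dif_pos i.2]
  congr!

theorem covGuided_eq (n : Fin p) (x y : Fin p → ℝ) (t : ℝ) : covGuided S s σ n x y t =
    gaussianPDFReal (covGuidedMean S s σ n x y) (covGuidedVar S s σ n).toNNReal t := by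
  rw [covGuided, covGuidedMean, covGuidedVar, condMean, condVar]
  congr 1
  · exact dotProduct_inv_mulVec_eq (Gam S s) (condSet σ n)
      (fun i => Gam S s i (Sum.inr (σ n))) (Sum.elim x y)
  · congr 2
    exact dotProduct_inv_mulVec_eq (Gam S s) (condSet σ n)
      (fun i => Gam S s i (Sum.inr (σ n))) fun i => Gam S s i (Sum.inr (σ n))

theorem covGuidedVar_pos (hΓ : (Gam S s).PosDef) (n : Fin p) : 0 < covGuidedVar S s σ n :=
  condVar_pos hΓ (not_condSet n)

theorem covGuidedMean_causal (n : Fin p) (x : Fin p → ℝ) {y y' : Fin p → ℝ}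
    (h : ∀ k < n, y (σ k) = y' (σ k)) :
    covGuidedMean S s σ n x y = covGuidedMean S s σ n x y' := by
  refine condMean_congr fun i hi => ?_
  rcases i with j | j
  · rfl
  · have := h (σ.symm j) ((condSet_inr _ _).mp hi)
    simpa using this

/-- The matrix `diag s` changes only the covariances of the pairs exchanged by the swaps. This
symmetry gives both faithfulness of the proposals and acceptance in the Gaussian case. -/
theorem Gam_swap (j : Fin p) (i k : Fin p ⊕ Fin p) :
    Gam S s (Equiv.swap (Sum.inl j) (Sum.inr j) i) (Equiv.swap (Sum.inl j) (Sum.inr j) k) =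
      Gam S s i k := by
  rcases i with a | a <;> rcases k with b | b <;> by_cases ha : a = j <;> by_cases hb : b = j <;>
    simp [Gam, Equiv.swap_apply_def, ha, hb, Matrix.diagonal_apply,
      eq_comm (a := j)]

theorem elim_comp_swap (j : Fin p) (x y : Fin p → ℝ) :
    Sum.elim x y ∘ Equiv.swap (Sum.inl j) (Sum.inr j) =
      Sum.elim (Function.update x j (y j)) (Function.update y j (x j)) := by
  funext i
  rcases i with a | a <;> by_cases ha : a = j <;> simp [Equiv.swap_apply_def, ha]

theorem condSet_swap {n : ℕ} {j : Fin p} (hj : (σ.symm j).val < n) (i : Fin p ⊕ Fin p) :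
    condSet σ n (Equiv.swap (Sum.inl j) (Sum.inr j) i) ↔ condSet σ n i := by
  rcases i with a | a <;> by_cases ha : a = j <;>
    simp [Equiv.swap_apply_def, ha, condSet_inl, condSet_inr, hj]

theorem covGuidedMean_swap (hΓ : (Gam S s).PosDef) {n k : Fin p} (hk : k < n) (x y : Fin p → ℝ) :
    covGuidedMean S s σ n (Function.update x (σ k) (y (σ k)))
      (Function.update y (σ k) (x (σ k))) = covGuidedMean S s σ n x y := by
  rw [covGuidedMean, ← elim_comp_swap, covGuidedMean]
  refine condMean_comp hΓ _ (Gam_swap _) (condSet_swap (by simpa using hk)) ?_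
  rw [Equiv.swap_apply_of_ne_of_ne] <;> simp [hk.ne']

theorem measurable_Gam {E : Type*} [MeasurableSpace E] {S : E → Matrix (Fin p) (Fin p) ℝ}
    {s : E → Fin p → ℝ} (hS : ∀ i k, Measurable fun e => S e i k) (hs : Measurable s)
    (i k : Fin p ⊕ Fin p) : Measurable fun e => Gam (S e) (s e) i k := by
  have hd : ∀ a b, Measurable fun e => (S e - Matrix.diagonal (s e)) a b := fun a b => by
    simp only [Matrix.sub_apply, Matrix.diagonal_apply]
    refine (hS a b).sub ?_
    split_ifs
    · exact (measurable_pi_apply a).comp hs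
    · exact measurable_const
  rcases i with a | a <;> rcases k with b | b
  · exact hS a b
  · exact hd a b
  · exact hd a b
  · exact hS a b

theorem measurable_covGuidedMean {E : Type*} [MeasurableSpace E] {S : E → Matrix (Fin p) (Fin p) ℝ}
    {s x y : E → Fin p → ℝ} (hS : ∀ i k, Measurable fun e => S e i k) (hs : Measurable s)
    (hx : Measurable x) (hy : Measurable y) (n : Fin p) :
    Measurable fun e => covGuidedMean (S e) (s e) σ n (x e) (y e) := by
  refine measurable_condMean (fun i k => measurable_Gam hS hs i k) (fun i => ?_) _
  rcases i with j | j
  · exact (measurable_pi_apply j).comp hx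
  · exact (measurable_pi_apply j).comp hy

theorem isFaithfulProposal_covGuided (hΓ : (Gam S s).PosDef) :
    IsFaithfulProposal σ fun n x y _ t => covGuided S s σ n x y t where
  measurable n := by
    simp only [covGuided_eq]
    have h : Measurable fun a : (Fin p → ℝ) × (Fin p → ℝ) × (Fin p → Bool) × ℝ =>
      covGuidedMean S s σ n a.1 a.2.1 := measurable_covGuidedMean
        (S := fun _ => S) (s := fun _ => s) (fun _ _ => measurable_const) measurable_const
        measurable_fst measurable_snd.fst n
    have ht : Measurable fun a : (Fin p → ℝ) × (Fin p → ℝ) × (Fin p → Bool) × ℝ => a.2.2.2 :=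
      measurable_snd.snd.snd
    simp only [gaussianPDFReal]
    exact (((ht.sub h).pow_const 2).neg.div_const _).exp.const_mul _
  nonneg n x y u t := by
    rw [covGuided_eq]
    exact gaussianPDFReal_nonneg _ _ _
  lintegral_eq_one n x y u := by
    simp only [covGuided_eq]
    exact lintegral_gaussianPDFReal_eq_one _
      (Real.toNNReal_pos.mpr (covGuidedVar_pos hΓ n)).ne'
  causal n x y y' u u' h := by
    funext t
    rw [covGuided_eq, covGuided_eq, covGuidedMean_causal n x fun k hk => (h k hk).1]
  faithful n x y u k hk _ := by
    funext t
    rw [covGuided_eq, covGuided_eq, covGuidedMean_swap hΓ hk]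

theorem covGuided_pos (hΓ : (Gam S s).PosDef) (n : Fin p) (x y : Fin p → ℝ) (t : ℝ) :
    0 < covGuided S s σ n x y t := by
  rw [covGuided_eq]
  exact gaussianPDFReal_pos _ _ _ (Real.toNNReal_pos.mpr (covGuidedVar_pos hΓ n)).ne'

/-- Before the first step only `x` is conditioned on, and the solution is `S⁻¹ x` on the first
block. -/
theorem energy_condSet_zero (hΓ : (Gam S s).PosDef) (hS : S.PosDef) (x y : Fin p → ℝ) :
    energy (Gam S s) (condSet σ 0) (Sum.elim x y) = x ⬝ᵥ (S⁻¹ *ᵥ x) := by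
  have h : Sum.elim (S⁻¹ *ᵥ x) 0 =
      restrictedSolve (Gam S s) (condSet σ 0) (Sum.elim x y) := by
    refine eq_restrictedSolve hΓ (fun i hi => ?_) fun i hi => ?_
    · rcases i with j | j
      · exact absurd (condSet_inl 0 j) hi
      · rfl
    · rcases i with j | j
      · rw [Gam, Matrix.fromBlocks_mulVec]
        simp [Matrix.mulVec_mulVec,
          Matrix.mul_nonsing_inv _ ((Matrix.isUnit_iff_isUnit_det _).mp hS.isUnit)]
      · simp [condSet_inr] at hi
  rw [energy, ← h, sumElim_dotProduct_sumElim]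
  simp

/-- In the Gaussian case, a run of Metro accepts all covariance-guided proposals. -/
theorem exists_metroDensity_covGuided (hΓ : (Gam S s).PosDef) (hS : S.PosDef) {W : ℝ} (hW : 0 < W)
    {Φ : (Fin p → ℝ) → ℝ} (hΦ : ∀ x, Φ x = W * Real.exp (-(x ⬝ᵥ (S⁻¹ *ᵥ x)) / 2)) (n : ℕ)
    (hn : n ≤ p) : ∃ c : ℝ, 0 < c ∧ ∀ x y u,
      metroDensity Φ σ (fun n x y _ t => covGuided S s σ n x y t) n x y u =
        if ∀ k : Fin p, k.val < n → u (σ k) = true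
          then c * Real.exp (-energy (Gam S s) (condSet σ n) (Sum.elim x y) / 2) else 0 := by
  have hΦ0 : ∀ x, 0 ≤ Φ x := fun x => by rw [hΦ]; positivity
  have hq := isFaithfulProposal_covGuided (σ := σ) hΓ
  induction n with
  | zero =>
    refine ⟨W, hW, fun x y u => ?_⟩
    rw [if_pos (by simp), energy_condSet_zero hΓ hS]
    exact hΦ x
  | succ n ih =>
    obtain ⟨c, hc, ih⟩ := ih (by omega)
    let m : Fin p := ⟨n, hn⟩
    have hvar := covGuidedVar_pos (σ := σ) hΓ m
    set c' := c * (√(2 * Real.pi * covGuidedVar S s σ m))⁻¹ with hc'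
    have hc'0 : 0 < c' := by positivity
    have hA : ∀ (x y : Fin p → ℝ) (u : Fin p → Bool),
        (∀ k : Fin p, k.val < n → u (σ k) = true) →
        metroDensity Φ σ (fun n x y _ t => covGuided S s σ n x y t) n x y u *
          covGuided S s σ m x y (y (σ m)) =
        c' * Real.exp (-energy (Gam S s) (condSet σ (n + 1)) (Sum.elim x y) / 2) := by
      intro x y u hu
      have h := gaussianPDFReal_condMean (z := Sum.elim x y) hΓ (not_condSet (σ := σ) m)
        (condSet_succ m)
      rw [ih, if_pos hu, covGuided_eq, mul_assoc]
      rw [Sum.elim_inr] at h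
      exact (congrArg (c * ·) h).trans (mul_assoc _ _ _).symm
    have hB : ∀ (x y : Fin p → ℝ) (u : Fin p → Bool),
        (∀ k : Fin p, k.val < n → u (σ k) = true) →
        metroDensity Φ σ (fun n x y _ t => covGuided S s σ n x y t) n
            (Function.update x (σ m) (y (σ m))) y u *
          covGuided S s σ m (Function.update x (σ m) (y (σ m))) y (x (σ m)) =
        c' * Real.exp (-energy (Gam S s) (condSet σ (n + 1)) (Sum.elim x y) / 2) := by
      intro x y u hu
      have hne : ∀ k : Fin p, k.val < n → σ k ≠ σ m := fun k hk h => by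
        rw [σ.injective h] at hk
        exact lt_irrefl _ hk
      -- The reverse flow is the forward flow of the swapped pair. The energy is invariant under the
      -- swap, and the factors do not see that `y` has changed at the current coordinate.
      have h := hA (Function.update x (σ m) (y (σ m))) (Function.update y (σ m) (x (σ m))) u hu
      rw [← elim_comp_swap, energy_comp hΓ _ (Gam_swap _)
        (condSet_swap (by simp [m])), Function.update_self] at h
      rw [← h]
      congr 1
      · exact metroDensity_causal hq n _ fun k hk =>
          ⟨by rw [Function.update_of_ne (hne k hk)], rfl⟩
      · rw [covGuided_eq, covGuided_eq]
        congr 1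
        exact covGuidedMean_causal m _ fun k hk => by rw [Function.update_of_ne (hne k hk)]
    refine ⟨c', hc'0, fun x y u => ?_⟩
    by_cases hu : ∀ k : Fin p, k.val < n → u (σ k) = true
    · have h1 := hA x y u hu
      have h2 := hB x y u hu
      have hpos : 0 < c' * Real.exp (-energy (Gam S s) (condSet σ (n + 1)) (Sum.elim x y) / 2) := by
        positivity
      have hacc : acceptProb σ (fun n x y _ t => covGuided S s σ n x y t)
          (metroDensity Φ σ (fun n x y _ t => covGuided S s σ n x y t) n) m x y u = 1 := by
        rw [acceptProb]
        rw [mul_comm (covGuided S s σ m _ y _), h2, mul_comm (covGuided S s σ m x y _), h1, div_self hpos.ne', min_self]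
      have hsucc := metroDensity_succ (Φ := Φ) (σ := σ)
        (q := fun n x y _ t => covGuided S s σ n x y t) m x y u
      rw [show n + 1 = m.val + 1 from rfl, hsucc, hacc, sub_self]
      by_cases hum : u (σ m) = true
      · rw [if_pos hum, mul_one, if_pos]
        · exact h1
        · intro k hk
          rcases Nat.lt_succ_iff_lt_or_eq.mp hk with hk | hk
          · exact hu k hk
          · rwa [show k = m from Fin.ext hk]
      · rw [if_neg hum, mul_zero, mul_zero, if_neg fun h => hum (h m (Nat.lt_succ_self n))]
    · have hsucc := metroDensity_succ (Φ := Φ) (σ := σ)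
        (q := fun n x y _ t => covGuided S s σ n x y t) m x y u
      rw [show n + 1 = m.val + 1 from rfl, hsucc, ih, if_neg hu, zero_mul,
        if_neg fun h => hu fun k hk => h k (Nat.lt_succ_of_lt hk)]

/-! ### The choice of `s`. -/

/-- The form at `(a, b)` is that of `S` at `a + b` minus `2 c (a ⬝ᵥ b)`. The assumed bound makes it
at least `c (a ⬝ᵥ a + b ⬝ᵥ b)`. -/
theorem posDef_Gam (hS : S.PosDef) {c : ℝ} (hc : 0 < c)
    (h : ∀ a : Fin p → ℝ, c * (a ⬝ᵥ a) ≤ a ⬝ᵥ (S *ᵥ a)) : (Gam S fun _ => c).PosDef := by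
  have hherm : (Gam S fun _ => c).IsHermitian := by
    have h1 := hS.isHermitian
    have h2 : (Matrix.diagonal fun _ : Fin p => c).IsHermitian := by simp
    exact Matrix.IsHermitian.fromBlocks h1 (h1.sub h2) h1
  refine Matrix.PosDef.of_dotProduct_mulVec_pos hherm fun v hv => ?_
  obtain ⟨a, b, rfl⟩ : ∃ a b, v = Sum.elim a b := ⟨v ∘ Sum.inl, v ∘ Sum.inr, by simp⟩
  rw [star_trivial, Gam, Matrix.fromBlocks_mulVec, sumElim_dotProduct_sumElim]
  have hd : ∀ w : Fin p → ℝ, Matrix.diagonal (fun _ => c) *ᵥ w = c • w := fun w => by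
    funext i; simp [Matrix.mulVec_diagonal]
  have key := h (a + b)
  have hab : a ⬝ᵥ (S *ᵥ b) = b ⬝ᵥ (S *ᵥ a) := posDef_dotProduct_mulVec_comm hS a b
  have hab' : a ⬝ᵥ b = b ⬝ᵥ a := dotProduct_comm a b
  simp only [Sum.elim_comp_inl, Sum.elim_comp_inr, Matrix.sub_mulVec, hd, dotProduct_add,
    dotProduct_sub, dotProduct_smul, smul_eq_mul, Matrix.mulVec_add, add_dotProduct] at key ⊢
  have h2 : 0 < a ⬝ᵥ a + b ⬝ᵥ b := by
    have ha := dotProduct_self_star_nonneg a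
    have hb := dotProduct_self_star_nonneg b
    rw [star_trivial] at ha hb
    refine lt_of_le_of_ne (add_nonneg ha hb) fun h => hv ?_
    have ha0 : a ⬝ᵥ a = 0 := by linarith
    have hb0 : b ⬝ᵥ b = 0 := by linarith
    rw [dotProduct_self_eq_zero] at ha0 hb0
    rw [ha0, hb0]
    simp
  nlinarith [mul_pos hc h2]

/-- Cauchy–Schwarz for the inner product `P`, applied to `P⁻¹ a` and the unit vectors, bounds `a i ^
2` by `P i i` times the form; then sum over `i`. So the inverse trace is a lower bound for the form
of `P⁻¹` which depends measurably on `P` and requires no eigenvalues. -/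
theorem dotProduct_le_trace_mul {P : Matrix (Fin p) (Fin p) ℝ} (hP : P.PosDef) (a : Fin p → ℝ) :
    a ⬝ᵥ a ≤ P.trace * (a ⬝ᵥ (P⁻¹ *ᵥ a)) := by
  set e := P⁻¹ *ᵥ a with he
  have ha : P *ᵥ e = a := by
    rw [he, Matrix.mulVec_mulVec, Matrix.mul_nonsing_inv _
      ((Matrix.isUnit_iff_isUnit_det _).mp hP.isUnit), Matrix.one_mulVec]
  rw [Matrix.trace, Finset.sum_mul]
  refine Finset.sum_le_sum fun i _ => ?_
  have hPi : 0 < P i i := hP.diag_pos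
  have h := hP.posSemidef.dotProduct_mulVec_nonneg (e - (a i / P i i) • Pi.single i 1)
  have h1 : Pi.single i 1 ⬝ᵥ (P *ᵥ e) = a i := by rw [ha, single_one_dotProduct]
  have h2 : e ⬝ᵥ (P *ᵥ Pi.single i 1) = a i := by rw [posDef_dotProduct_mulVec_comm hP, h1]
  have h3 : (Pi.single i 1 : Fin p → ℝ) ⬝ᵥ (P *ᵥ Pi.single i 1) = P i i := by
    rw [single_one_dotProduct]; simp
  rw [star_trivial, Matrix.mulVec_sub, Matrix.mulVec_smul, dotProduct_sub, sub_dotProduct,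
    sub_dotProduct, smul_dotProduct, smul_dotProduct, dotProduct_smul, dotProduct_smul, h1, h2, h3,
    ha, dotProduct_comm e] at h
  simp only [smul_eq_mul] at h
  have h4 : a i / P i i * P i i = a i := div_mul_cancel₀ _ hPi.ne'
  rw [h4] at h
  have h5 : a i * a i ≤ P i i * (a ⬝ᵥ e) := by
    have : a i * a i = P i i * (a i / P i i * a i) := by rw [← mul_assoc, mul_comm (P i i), h4]
    rw [this]
    exact mul_le_mul_of_nonneg_left (by linarith) hPi.le
  exact h5

theorem posDef_Gam_inv (hp : 0 < p) {P : Matrix (Fin p) (Fin p) ℝ} (hP : P.PosDef) :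
    0 < P.trace⁻¹ ∧ (Gam P⁻¹ fun _ => P.trace⁻¹).PosDef := by
  have : Nonempty (Fin p) := ⟨⟨0, hp⟩⟩
  have htr : 0 < P.trace := hP.trace_pos
  refine ⟨inv_pos.mpr htr, posDef_Gam hP.inv (inv_pos.mpr htr) fun a => ?_⟩
  rw [inv_mul_le_iff₀ htr]
  exact dotProduct_le_trace_mul hP a

end CovGuided

/-! ### Recovering a precision matrix from evaluations of the density -/

section Precision

variable {p : ℕ}

/-- The points `0`, `e_i` and `e_i + e_j`. -/
def precisionPoint : Option (Fin p ⊕ Fin p × Fin p) → Fin p → ℝ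
  | none => 0
  | some (Sum.inl i) => Pi.single i 1
  | some (Sum.inr a) => Pi.single a.1 1 + Pi.single a.2 1

/-- The polarization of `-2 log (Φ v / Φ 0)`, where `a` contains the values of `Φ` at the points
`precisionPoint`. -/
noncomputable def polarization (a : Option (Fin p ⊕ Fin p × Fin p) → ℝ) :
    Matrix (Fin p) (Fin p) ℝ := fun i j =>
  (Real.log (a (some (Sum.inl i)) / a none) + Real.log (a (some (Sum.inl j)) / a none) -
    Real.log (a (some (Sum.inr (i, j))) / a none))

open Classical in
/-- The precision matrix for a Gaussian density with values `a` at the points `precisionPoint`. -/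
noncomputable def precision (a : Option (Fin p ⊕ Fin p × Fin p) → ℝ) : Matrix (Fin p) (Fin p) ℝ :=
  if (polarization a).PosDef then polarization a else 1

theorem posDef_precision (a : Option (Fin p ⊕ Fin p × Fin p) → ℝ) : (precision a).PosDef := by
  rw [precision]
  split_ifs with h
  · exact h
  · exact Matrix.PosDef.one

theorem precision_gaussian {P : Matrix (Fin p) (Fin p) ℝ} (hP : P.PosDef) {W : ℝ} (hW : 0 < W)
    {Φ : (Fin p → ℝ) → ℝ} (hΦ : ∀ x, Φ x = W * Real.exp (-(x ⬝ᵥ (P *ᵥ x)) / 2)) :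
    precision (fun k => Φ (precisionPoint k)) = P := by
  have hlog : ∀ x, Real.log (Φ x / Φ (precisionPoint none)) = -(x ⬝ᵥ (P *ᵥ x)) / 2 := fun x => by
    rw [hΦ, hΦ, precisionPoint, zero_dotProduct, neg_zero, zero_div, Real.exp_zero, mul_one,
      mul_div_cancel_left₀ _ hW.ne', Real.log_exp]
  have h : polarization (fun k => Φ (precisionPoint k)) = P := by
    funext i j
    simp only [polarization, hlog]
    simp only [precisionPoint, Matrix.mulVec_add, dotProduct_add, add_dotProduct,
      single_one_dotProduct, Matrix.mulVec_single_one, Matrix.col_apply]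
    rw [posDef_symm_apply hP j i]
    ring
  rw [precision, h, if_pos hP]

/-- Positive definite matrices are the positive semidefinite ones, a closed set, with nonzero
determinant. -/
theorem measurableSet_posDef {E : Type*} [MeasurableSpace E] {M : E → Matrix (Fin p) (Fin p) ℝ}
    (hM : ∀ i k, Measurable fun e => M e i k) : MeasurableSet {e | (M e).PosDef} := by
  have hdet : Measurable fun e => (M e).det := by
    simp only [Matrix.det_apply]
    exact Finset.measurable_sum _ fun τ _ =>
      (Finset.measurable_prod _ fun i _ => hM _ _).const_smul _
  have hM' : Measurable fun e => (fun i k => M e i k : Fin p → Fin p → ℝ) :=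
    measurable_pi_lambda _ fun i => measurable_pi_lambda _ fun k => hM i k
  have hclosed : IsClosed {N : Fin p → Fin p → ℝ | ∀ x : Fin p → ℝ,
      0 ≤ ∑ i, x i * ∑ k, N i k * x k} := by
    rw [Set.ofPred_forall]
    exact isClosed_iInter fun x => isClosed_le continuous_const (by fun_prop)
  have hsymm : IsClosed {N : Fin p → Fin p → ℝ | ∀ i k, N k i = N i k} := by
    simp only [Set.ofPred_forall]
    exact isClosed_iInter fun i => isClosed_iInter fun k =>
      isClosed_eq (by fun_prop) (by fun_prop)
  have heq : {e | (M e).PosDef} = (fun e => (fun i k => M e i k : Fin p → Fin p → ℝ)) ⁻¹'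
      ({N | ∀ i k, N k i = N i k} ∩ {N | ∀ x : Fin p → ℝ, 0 ≤ ∑ i, x i * ∑ k, N i k * x k}) ∩
        {e | (M e).det ≠ 0} := by
    ext e
    have hherm : (M e).IsHermitian ↔ ∀ i k, M e k i = M e i k :=
      Matrix.IsHermitian.ext_iff
    constructor
    · intro h
      exact ⟨⟨hherm.mp h.isHermitian, fun x => by
        have := h.posSemidef.dotProduct_mulVec_nonneg x
        rw [star_trivial] at this
        exact this⟩,
        h.posSemidef.posDef_iff_det_ne_zero.mp h⟩
    · rintro ⟨⟨h1, h2⟩, h3⟩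
      have : (M e).PosSemidef := Matrix.PosSemidef.of_dotProduct_mulVec_nonneg (hherm.mpr h1)
        fun x => by rw [star_trivial]; exact h2 x
      exact this.posDef_iff_det_ne_zero.mpr h3
  rw [heq]
  exact (hM' (hsymm.inter hclosed).measurableSet).inter (hdet (measurableSet_singleton 0).compl)

theorem measurable_precision {E : Type*} [MeasurableSpace E]
    {a : E → Option (Fin p ⊕ Fin p × Fin p) → ℝ} (ha : Measurable a) (i k : Fin p) :
    Measurable fun e => precision (a e) i k := by
  have hk : ∀ k, Measurable fun e => a e k := fun k => (measurable_pi_apply k).comp ha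
  have h : ∀ i k, Measurable fun e => polarization (a e) i k := fun i k =>
    (((hk _).div (hk _)).log.add ((hk _).div (hk _)).log).sub ((hk _).div (hk _)).log
  classical
  have : (fun e => precision (a e) i k) = fun e =>
      if e ∈ {e | (polarization (a e)).PosDef} then polarization (a e) i k
        else (1 : Matrix (Fin p) (Fin p) ℝ) i k := by
    funext e
    by_cases he : (polarization (a e)).PosDef <;> simp [precision, he]
  rw [this]
  exact Measurable.ite (measurableSet_posDef h) (h i k) measurable_const

theorem measurable_inv_trace {E : Type*} [MeasurableSpace E] {M : E → Matrix (Fin p) (Fin p) ℝ}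
    (hM : ∀ i k, Measurable fun e => M e i k) : Measurable fun e => (M e).trace⁻¹ :=
  (Finset.measurable_sum _ fun i _ => hM i i).inv

end Precision

/-- If only full acceptance has positive density, the knockoff is the proposal, and `x j = y j`
describes a null set. -/
theorem ae_ne_knockoff_metroLaw {p : ℕ} {Φ : (Fin p → ℝ) → ℝ} (hΦ : Measurable Φ)
    {σ : Equiv.Perm (Fin p)} {q : Fin p → (Fin p → ℝ) → (Fin p → ℝ) → (Fin p → Bool) → ℝ → ℝ}
    (hq : IsFaithfulProposal σ q)
    (h : ∀ x y u, metroDensity Φ σ q p x y u ≠ 0 → ∀ j, u j = true) :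
    ∀ᵐ a ∂(metroLaw Φ σ q), ∀ j, a.1 j ≠ knockoff a.1 a.2.1 a.2.2 j := by
  rw [metroLaw]
  refine Measure.ae_smul_measure ?_ _
  rw [ae_withDensity_iff (measurable_metroDensity_const hΦ hq p).ennreal_ofReal]
  have hne : ∀ j, ∀ᵐ a ∂((volume : Measure (Fin p → ℝ)).prod
      ((volume : Measure (Fin p → ℝ)).prod (Measure.count : Measure (Fin p → Bool)))),
      a.1 j ≠ a.2.1 j := by
    intro j
    rw [ae_iff]
    simp only [not_not]
    have hm : MeasurableSet {a : (Fin p → ℝ) × (Fin p → ℝ) × (Fin p → Bool) | a.1 j = a.2.1 j} :=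
      measurableSet_eq_fun (by fun_prop) (by fun_prop)
    rw [Measure.measure_prod_null hm]
    refine Filter.Eventually.of_forall fun x => ?_
    have hv : (volume : Measure (Fin p → ℝ)) {y | y j = x j} = 0 := by
      rw [volume_pi]
      exact Measure.pi_hyperplane (fun _ : Fin p => (volume : Measure ℝ)) j (x j)
    have h2 := Measure.quasiMeasurePreserving_fst
      (μ := (volume : Measure (Fin p → ℝ))) (ν := (Measure.count : Measure (Fin p → Bool)))
    have hset : Prod.mk x ⁻¹' {a : (Fin p → ℝ) × (Fin p → ℝ) × (Fin p → Bool) | a.1 j = a.2.1 j} =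
        Prod.fst ⁻¹' {y : Fin p → ℝ | y j = x j} := Set.ext fun a => eq_comm
    exact (congrArg _ hset).trans (h2.preimage_null hv)
  filter_upwards [ae_all_iff.mpr hne] with a ha h0 j
  have hu := h a.1 a.2.1 a.2.2 (fun h1 => h0 (by rw [h1, ENNReal.ofReal_zero])) j
  rw [knockoff, if_pos hu]
  exact ha j

end Knockoff

namespace Knockoff

/-! ### Tabulating the density -/

section Table

variable {p : ℕ} {G : SimpleGraph (Fin p)} {Φ : (Fin p → ℝ) → ℝ} {σ : Equiv.Perm (Fin p)}

/-- The identity holds factor by factor. A clique containing `k` meets `A` and `B` in the same set,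
since its other vertices are neighbours of `k`; a clique without `k` does not notice the insertion.
The product form remains valid where `Φ` vanishes. -/
theorem IsGraphicalDensity.mul_eq_mul (hΦ : IsGraphicalDensity G Φ) (x y : Fin p → ℝ) {k : Fin p}
    {L A B : Finset (Fin p)} (hkA : k ∉ A) (hkB : k ∉ B)
    (hL : ∀ j ∈ A ∪ B, G.Adj k j → j ∈ L) (h : A ∩ L = B ∩ L) :
    Φ ((insert k A).piecewise y x) * Φ (B.piecewise y x) =
      Φ ((insert k B).piecewise y x) * Φ (A.piecewise y x) := by
  obtain ⟨φ, -, -, hφ⟩ := hΦ.factors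
  simp only [hφ]
  rw [← Finset.prod_mul_distrib, ← Finset.prod_mul_distrib]
  refine Finset.prod_congr rfl fun c hc => ?_
  by_cases hk : k ∈ c
  · have hclique : G.IsClique (c : Set (Fin p)) := by
      classical
      exact (Finset.mem_filter.mp hc).2.1
    have hAB : ∀ j ∈ c, j ≠ k → (j ∈ A ↔ j ∈ B) := fun j hj hjk => by
      have hadj : G.Adj k j := hclique hk hj hjk.symm
      constructor
      · intro hjA
        have : j ∈ A ∩ L := Finset.mem_inter.mpr ⟨hjA, hL j (Finset.mem_union_left _ hjA) hadj⟩
        rw [h] at this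
        exact (Finset.mem_inter.mp this).1
      · intro hjB
        have : j ∈ B ∩ L := Finset.mem_inter.mpr ⟨hjB, hL j (Finset.mem_union_right _ hjB) hadj⟩
        rw [← h] at this
        exact (Finset.mem_inter.mp this).1
    have h1 : c.restrict ((insert k A).piecewise y x) = c.restrict ((insert k B).piecewise y x) := by
      funext j
      by_cases hjk : j.1 = k
      · simp [Finset.piecewise, hjk]
      · simp [Finset.piecewise, hjk, hAB j j.2 hjk]
    have h2 : c.restrict (A.piecewise y x) = c.restrict (B.piecewise y x) := by
      funext j
      by_cases hjk : j.1 = k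
      · simp [Finset.piecewise, hjk, hkA, hkB]
      · simp [Finset.piecewise, hAB j j.2 hjk]
    rw [h1, h2]
  · have h1 : ∀ A : Finset (Fin p), c.restrict ((insert k A).piecewise y x) =
        c.restrict (A.piecewise y x) := fun A => by
      funext j
      have hjk : j.1 ≠ k := fun h => hk (h ▸ j.2)
      simp [Finset.piecewise, hjk]
    rw [h1, h1, mul_comm]

/-- The coordinates which are processed after step `n`. -/
def laterSet (σ : Equiv.Perm (Fin p)) (n : ℕ) : Finset (Fin p) :=
  Finset.univ.filter fun j => n < (σ.symm j).val

open Classical in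
/-- A set of later coordinates, with intersection `B` with `L`, at which the table is nonzero. -/
noncomputable def representative (σ : Equiv.Perm (Fin p)) (L : Finset (Fin p)) (n : Fin p)
    (ζ : Finset (Fin p) → Bool) (B : Finset (Fin p)) : Finset (Fin p) :=
  if h : ∃ R, ζ R = true ∧ R ⊆ laterSet σ n ∧ R ∩ L = B then h.choose else ∅

theorem representative_spec {L : Finset (Fin p)} {n : Fin p} {ζ : Finset (Fin p) → Bool}
    {A : Finset (Fin p)} (hζ : ζ A = true) (hA : A ⊆ laterSet σ n) :
    ζ (representative σ L n ζ (A ∩ L)) = true ∧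
      representative σ L n ζ (A ∩ L) ⊆ laterSet σ n ∧
      representative σ L n ζ (A ∩ L) ∩ L = A ∩ L := by
  have h : ∃ R, ζ R = true ∧ R ⊆ laterSet σ n ∧ R ∩ L = A ∩ L := ⟨A, hζ, hA, rfl⟩
  rw [representative, dif_pos h]
  exact h.choose_spec

/-- The query points of step `n`. -/
noncomputable def stagePoint (σ : Equiv.Perm (Fin p)) (L : Finset (Fin p)) (n : Fin p)
    (x y : Fin p → ℝ) (F : Finset (Fin p) → ℝ) (B : Finset (Fin p)) : Fin p → ℝ :=
  (insert (σ n) (representative σ L n (fun A => decide (F A ≠ 0)) B)).piecewise y x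

/-- The extension of the table `F` to sets containing `σ n`, where `a` contains the values of the
density at the points `stagePoint`. -/
noncomputable def stageUpdate (σ : Equiv.Perm (Fin p)) (L : Finset (Fin p)) (n : Fin p)
    (F : Finset (Fin p) → ℝ) (a : L.powerset → ℝ) : Finset (Fin p) → ℝ := fun A =>
  if σ n ∈ A then
    if F (A.erase (σ n)) ≠ 0 then
      F (A.erase (σ n)) * a ⟨A.erase (σ n) ∩ L, Finset.mem_powerset.mpr Finset.inter_subset_right⟩ /
        F (representative σ L n (fun A => decide (F A ≠ 0)) (A.erase (σ n) ∩ L))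
    else 0
  else F A

/-- The table of the values of `Φ` at the points `A.piecewise y x`, after `m` steps. -/
noncomputable def table (Φ : (Fin p → ℝ) → ℝ) (σ : Equiv.Perm (Fin p))
    (L : Fin p → Finset (Fin p)) (x y : Fin p → ℝ) : ℕ → Finset (Fin p) → ℝ
  | 0 => fun _ => Φ x
  | m + 1 =>
    if h : m < p then
      stageUpdate σ (L (Fin.rev ⟨m, h⟩)) (Fin.rev ⟨m, h⟩) (table Φ σ L x y m) fun B =>
        Φ (stagePoint σ (L (Fin.rev ⟨m, h⟩)) (Fin.rev ⟨m, h⟩) x y (table Φ σ L x y m) B)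
    else table Φ σ L x y m

theorem stageUpdate_of_notMem {L : Finset (Fin p)} {n : Fin p} {F : Finset (Fin p) → ℝ}
    {a : L.powerset → ℝ} {A : Finset (Fin p)} (h : σ n ∉ A) : stageUpdate σ L n F a A = F A := by
  rw [stageUpdate, if_neg h]

theorem notMem_of_subset_laterSet {A : Finset (Fin p)} {n : ℕ} (hA : A ⊆ laterSet σ n) {m : Fin p}
    (hm : m.val ≤ n) : σ m ∉ A := fun h => by
  have := hA h
  simp [laterSet] at this
  omega

/-- The ratio belonging to the intersection with `L` has been measured at the representative, where
the table is nonzero, and is transferred to `A`. The conclusion also covers the case that the new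
value is zero. -/
theorem stageUpdate_insert (hΦ : IsGraphicalDensity G Φ) {x y : Fin p → ℝ} {n : Fin p}
    {L : Finset (Fin p)} (hL : ∀ k, n < k → G.Adj (σ n) (σ k) → σ k ∈ L)
    {F : Finset (Fin p) → ℝ}
    (hF : ∀ A ⊆ laterSet σ n, F A ≠ 0 → F A = Φ (A.piecewise y x))
    {A : Finset (Fin p)} (hA : A ⊆ laterSet σ n) (hA0 : F A ≠ 0) :
    stageUpdate σ L n F (fun B => Φ (stagePoint σ L n x y F B)) (insert (σ n) A) =
      Φ ((insert (σ n) A).piecewise y x) := by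
  have hnA := notMem_of_subset_laterSet hA le_rfl
  obtain ⟨h1, h2, h3⟩ := representative_spec (L := L) (ζ := fun A => decide (F A ≠ 0))
    (by simpa using hA0) hA
  have hR0 := of_decide_eq_true h1
  rw [stageUpdate, if_pos (Finset.mem_insert_self _ _)]
  simp only [Finset.erase_insert hnA]
  rw [if_pos hA0, stagePoint]
  set R := representative σ L n (fun A => decide (F A ≠ 0)) (A ∩ L) with hR
  have key := hΦ.mul_eq_mul x y (L := L) hnA (notMem_of_subset_laterSet h2 le_rfl)
    (fun j hj hadj => by
      have hj : j ∈ laterSet σ n := (Finset.union_subset hA h2) hj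
      have := hL (σ.symm j) (by simpa [laterSet] using hj) (by simpa using hadj)
      simpa using this) h3.symm
  rw [hF A hA hA0, hF R h2 hR0] at *
  rw [div_eq_iff hR0, key, mul_comm]

/-- Only nonzero entries are claimed to be correct: a zero may have been entered because a
predecessor vanished. -/
theorem table_eq_of_ne_zero (hΦ : IsGraphicalDensity G Φ) {x y : Fin p → ℝ}
    {L : Fin p → Finset (Fin p)} (hL : ∀ n k, n < k → G.Adj (σ n) (σ k) → σ k ∈ L n) (m : ℕ)
    (hm : m ≤ p) (A : Finset (Fin p)) (hA : ∀ j ∈ A, p ≤ (σ.symm j).val + m)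
    (h0 : table Φ σ L x y m A ≠ 0) : table Φ σ L x y m A = Φ (A.piecewise y x) := by
  induction m generalizing A with
  | zero =>
    have : A = ∅ := Finset.eq_empty_of_forall_notMem fun j hj => by
      have := hA j hj
      omega
    rw [this, Finset.piecewise_empty, table]
  | succ m ih =>
    have hm' : m < p := hm
    rw [table, dif_pos hm'] at h0 ⊢
    set n : Fin p := Fin.rev ⟨m, hm'⟩ with hn
    have hnv : n.val = p - (m + 1) := Fin.val_rev _
    have ih' : ∀ A ⊆ laterSet σ n, table Φ σ L x y m A ≠ 0 →
        table Φ σ L x y m A = Φ (A.piecewise y x) := fun A hA h0 =>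
      ih hm'.le A (fun j hj => by
        have := hA hj
        simp only [laterSet, Finset.mem_filter, Finset.mem_univ, true_and] at this
        omega) h0
    have hsub : A.erase (σ n) ⊆ laterSet σ n := fun j hj => by
      have h1 := hA j (Finset.mem_of_mem_erase hj)
      have h2 : σ.symm j ≠ n := fun h => Finset.ne_of_mem_erase hj (by rw [← h]; simp)
      have h3 : (σ.symm j).val ≠ n.val := fun h => h2 (Fin.ext h)
      simp only [laterSet, Finset.mem_filter, Finset.mem_univ, true_and]
      omega
    by_cases hnA : σ n ∈ A
    · have hA0 : table Φ σ L x y m (A.erase (σ n)) ≠ 0 := fun h => h0 (by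
        rw [stageUpdate, if_pos hnA, if_neg (not_not.mpr h)])
      have := stageUpdate_insert hΦ (hL n) ih' hsub hA0
      rwa [Finset.insert_erase hnA] at this
    · rw [stageUpdate_of_notMem hnA] at h0 ⊢
      rw [Finset.erase_eq_of_notMem hnA] at hsub
      exact ih' A hsub h0

/-- The coordinates are treated from the last to the first, and a stage alters only entries of sets
containing its own coordinate. -/
theorem table_eq_of_le {x y : Fin p → ℝ} {L : Fin p → Finset (Fin p)} {A : Finset (Fin p)}
    {m m' : ℕ} (hmm' : m ≤ m') (hm' : m' ≤ p) (hA : ∀ j ∈ A, p ≤ (σ.symm j).val + m) :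
    table Φ σ L x y m' A = table Φ σ L x y m A := by
  induction m', hmm' using Nat.le_induction with
  | base => rfl
  | succ k hk ih =>
    have hk' : k < p := hm'
    rw [table, dif_pos hk', stageUpdate_of_notMem, ih hk'.le]
    intro h
    have := hA _ h
    rw [Equiv.symm_apply_apply, Fin.val_rev] at this
    simp only at this
    omega

theorem table_empty {x y : Fin p → ℝ} {L : Fin p → Finset (Fin p)} :
    table Φ σ L x y p ∅ = Φ x := by
  rw [table_eq_of_le (Nat.zero_le p) le_rfl (by simp), table]

theorem table_succ {x y : Fin p → ℝ} {L : Fin p → Finset (Fin p)} {m : ℕ} (hm : m < p) {n : Fin p}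
    (hn : Fin.rev ⟨m, hm⟩ = n) : table Φ σ L x y (m + 1) =
      stageUpdate σ (L n) n (table Φ σ L x y m) fun B =>
        Φ (stagePoint σ (L n) n x y (table Φ σ L x y m) B) := by
  subst hn
  rw [table, dif_pos hm]

theorem table_insert (hΦ : IsGraphicalDensity G Φ) {x y : Fin p → ℝ}
    {L : Fin p → Finset (Fin p)} (hL : ∀ n k, n < k → G.Adj (σ n) (σ k) → σ k ∈ L n) (n : Fin p)
    {A : Finset (Fin p)} (hA : A ⊆ laterSet σ n) (h0 : table Φ σ L x y p A ≠ 0) :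
    table Φ σ L x y p (insert (σ n) A) = Φ ((insert (σ n) A).piecewise y x) := by
  have hlater : ∀ A ⊆ laterSet σ n, ∀ j ∈ A, p ≤ (σ.symm j).val + (p - (n.val + 1)) :=
    fun A hA j hj => by
      have := hA hj
      simp only [laterSet, Finset.mem_filter, Finset.mem_univ, true_and] at this
      omega
  have hm : p - (n.val + 1) < p := by have := n.isLt; omega
  have hrev : Fin.rev ⟨p - (n.val + 1), hm⟩ = n := by
    ext; rw [Fin.val_rev]; have := n.isLt; simp only; omega
  rw [table_eq_of_le (m := p - (n.val + 1)) (by omega) le_rfl (hlater A hA)] at h0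
  rw [table_eq_of_le (m := p - (n.val + 1) + 1) (by omega) le_rfl, table_succ hm hrev]
  · exact stageUpdate_insert hΦ (hL n) (fun A hA h0 =>
      table_eq_of_ne_zero hΦ hL _ hm.le A (hlater A hA) h0) hA h0
  · intro j hj
    rcases Finset.mem_insert.mp hj with rfl | hj
    · rw [Equiv.symm_apply_apply]
      omega
    · have := hlater A hA j hj
      omega

/-- The density read off from a table. -/
noncomputable def tableDensity (F : Finset (Fin p) → ℝ) (x z : Fin p → ℝ) : ℝ :=
  F (Finset.univ.filter fun j => z j ≠ x j)

theorem metroDensity_eq_zero {q : Fin p → (Fin p → ℝ) → (Fin p → ℝ) → (Fin p → Bool) → ℝ → ℝ}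
    {x : Fin p → ℝ} (h : Φ x = 0) (n : ℕ) (y : Fin p → ℝ) (u : Fin p → Bool) :
    metroDensity Φ σ q n x y u = 0 := by
  induction n with
  | zero => exact h
  | succ n ih =>
    by_cases hn : n < p
    · rw [show n + 1 = (⟨n, hn⟩ : Fin p).val + 1 from rfl, metroDensity_succ, ih, zero_mul]
    · rw [metroDensity_succ_of_not_lt hn, ih]

theorem tableDensity_self {x y : Fin p → ℝ} {L : Fin p → Finset (Fin p)} :
    tableDensity (table Φ σ L x y p) x x = Φ x := by
  simp [tableDensity, table_empty]

/-- This is the move made by the recursion for the density of Metro: from a correct nonzero entry, a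
coordinate earlier than all those already moved is set to its proposal. The resulting entry is
correct even if it is zero. -/
theorem tableDensity_update (hΦ : IsGraphicalDensity G Φ) {x y z : Fin p → ℝ}
    {L : Fin p → Finset (Fin p)} (hL : ∀ n k, n < k → G.Adj (σ n) (σ k) → σ k ∈ L n) (n : Fin p)
    (hz : ∀ k ≤ n, z (σ k) = x (σ k)) (hz' : ∀ j, z j = x j ∨ z j = y j)
    (h : tableDensity (table Φ σ L x y p) x z = Φ z) (h0 : Φ z ≠ 0) :
    tableDensity (table Φ σ L x y p) x (Function.update z (σ n) (y (σ n))) =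
      Φ (Function.update z (σ n) (y (σ n))) := by
  set A := Finset.univ.filter fun j => z j ≠ x j with hA
  -- In this case the update changes neither the point nor the index set under which it is looked
  -- up.
  by_cases hy : y (σ n) = x (σ n)
  · rw [hy, ← hz n le_rfl, Function.update_eq_self, h]
  have hAsub : A ⊆ laterSet σ n := fun j hj => by
    simp only [hA, laterSet, Finset.mem_filter, Finset.mem_univ, true_and] at hj ⊢
    by_contra hlt
    exact hj (by simpa using hz (σ.symm j) (by rw [Fin.le_def]; omega))
  have hins : (Finset.univ.filter fun j => Function.update z (σ n) (y (σ n)) j ≠ x j) =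
      insert (σ n) A := by
    ext j
    by_cases hj : j = σ n <;> simp [hj, hy, hA]
  have hpt : (insert (σ n) A).piecewise y x = Function.update z (σ n) (y (σ n)) := by
    funext j
    by_cases hj : j = σ n
    · simp [hj, Finset.piecewise]
    · by_cases hjx : z j = x j
      · simp [Finset.piecewise, hj, hA, hjx]
      · simp [Finset.piecewise, hj, hA, hjx, ((hz' j).resolve_left hjx).symm]
  rw [tableDensity, hins, table_insert hΦ hL n hAsub, hpt]
  rwa [← h] at h0

/-- At a zero of `Φ` both densities vanish at every step, so entries reached through it are never
used. Elsewhere `tableDensity_update` keeps the invariant that the current entry is correct. -/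
theorem metroDensity_tableDensity (hΦ : IsGraphicalDensity G Φ) {x y : Fin p → ℝ}
    {L : Fin p → Finset (Fin p)} (hL : ∀ n k, n < k → G.Adj (σ n) (σ k) → σ k ∈ L n)
    {q : Fin p → (Fin p → ℝ) → (Fin p → ℝ) → (Fin p → Bool) → ℝ → ℝ} (u : Fin p → Bool) (n : ℕ)
    (z : Fin p → ℝ) (hz : ∀ k : Fin p, k.val < n → z (σ k) = x (σ k))
    (hz' : ∀ j, z j = x j ∨ z j = y j)
    (h : tableDensity (table Φ σ L x y p) x z = Φ z) :
    metroDensity (tableDensity (table Φ σ L x y p) x) σ q n z y u = metroDensity Φ σ q n z y u := by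
  induction n generalizing z with
  | zero => exact h
  | succ n ih =>
    by_cases hn : n < p
    · by_cases h0 : Φ z = 0
      · rw [metroDensity_eq_zero h0, metroDensity_eq_zero (h.trans h0)]
      · rw [show n + 1 = (⟨n, hn⟩ : Fin p).val + 1 from rfl, metroDensity_succ, metroDensity_succ,
          ih z (fun k hk => hz k (hk.trans n.lt_succ_self)) hz' h]
        have hup := tableDensity_update hΦ hL ⟨n, hn⟩
          (fun k hk => hz k (Nat.lt_succ_of_le hk)) hz' h h0
        have h1 := ih (Function.update z (σ ⟨n, hn⟩) (y (σ ⟨n, hn⟩))) (fun k hk => by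
          rw [Function.update_of_ne, hz k (hk.trans n.lt_succ_self)]
          intro heq
          rw [σ.injective heq] at hk
          exact lt_irrefl _ hk) (fun j => by
            by_cases hj : j = σ ⟨n, hn⟩
            · rw [hj, Function.update_self]
              exact Or.inr rfl
            · rw [Function.update_of_ne hj]
              exact hz' j) hup
        simp only [acceptProb, h1, ih z (fun k hk => hz k (hk.trans n.lt_succ_self)) hz' h]
    · rw [metroDensity_succ_of_not_lt hn, metroDensity_succ_of_not_lt hn]
      exact ih z (fun k hk => hz k (hk.trans n.lt_succ_self)) hz' h

theorem acceptProb_tableDensity (hΦ : IsGraphicalDensity G Φ) {x y : Fin p → ℝ}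
    {L : Fin p → Finset (Fin p)} (hL : ∀ n k, n < k → G.Adj (σ n) (σ k) → σ k ∈ L n)
    {q : Fin p → (Fin p → ℝ) → (Fin p → ℝ) → (Fin p → Bool) → ℝ → ℝ} (u : Fin p → Bool)
    (n : Fin p) :
    acceptProb σ q (metroDensity (tableDensity (table Φ σ L x y p) x) σ q n) n x y u =
      acceptProb σ q (metroDensity Φ σ q n) n x y u := by
  have hx := tableDensity_self (Φ := Φ) (σ := σ) (x := x) (y := y) (L := L)
  by_cases h0 : Φ x = 0
  -- Both denominators are zero here, and division by zero gives the same value on both sides.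
  · simp only [acceptProb, metroDensity_eq_zero h0, metroDensity_eq_zero (hx.trans h0), mul_zero,
      div_zero]
  · have h1 := metroDensity_tableDensity hΦ hL (q := q) u n x (fun _ _ => rfl) (fun _ => Or.inl rfl)
      hx
    have h2 := metroDensity_tableDensity hΦ hL (q := q) u n
      (Function.update x (σ n) (y (σ n))) (fun k hk => by
        rw [Function.update_of_ne]
        intro heq
        rw [σ.injective heq] at hk
        exact lt_irrefl _ hk) (fun j => by
          by_cases hj : j = σ n
          · rw [hj, Function.update_self]
            exact Or.inr rfl
          · rw [Function.update_of_ne hj]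
            exact Or.inl rfl)
      (tableDensity_update hΦ hL n (fun _ _ => rfl) (fun _ => Or.inl rfl) hx h0)
    simp only [acceptProb, h1, h2]

end Table

end Knockoff

namespace Knockoff

/-! ### The procedure -/

section Procedure

variable {p : ℕ} {E : Type} [MeasurableSpace E]

theorem measurable_apply_discrete {κ : Type*} [Fintype κ] {F : E → κ → ℝ}
    (hF : ∀ k, Measurable fun e => F e k) {g : E → κ} (hg : ∀ k, MeasurableSet {e | g e = k}) :
    Measurable fun e => F e (g e) := by
  classical
  have h : (fun e => F e (g e)) = fun e => ∑ k, if e ∈ {e | g e = k} then F e k else 0 := by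
    funext e
    simp
  rw [h]
  exact Finset.measurable_sum _ fun k _ => Measurable.ite (hg k) (hF k) measurable_const

theorem measurable_support {κ : Type*} {F : E → κ → ℝ} (hF : ∀ k, Measurable fun e => F e k) :
    Measurable fun e k => decide (F e k ≠ 0) := by
  refine measurable_pi_lambda _ fun k => ?_
  have h : Measurable fun t : ℝ => decide (t ≠ 0) :=
    measurable_to_bool (by
      have : (fun t : ℝ => decide (t ≠ 0)) ⁻¹' {true} = {0}ᶜ := by ext; simp
      rw [this]
      exact (measurableSet_singleton 0).compl)
  exact h.comp (hF k)

/-- The chosen set depends on the table only through its pattern of zeros, which takes finitely many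
values, so the arbitrary choice does no harm to measurability. -/
theorem measurableSet_representative (σ : Equiv.Perm (Fin p)) (L : Finset (Fin p)) (n : Fin p)
    (B : Finset (Fin p)) {F : E → Finset (Fin p) → ℝ} (hF : ∀ k, Measurable fun e => F e k)
    (T : Set (Finset (Fin p))) :
    MeasurableSet {e | representative σ L n (fun A => decide (F e A ≠ 0)) B ∈ T} :=
  measurable_support hF (MeasurableSet.of_discrete (s := {ζ | representative σ L n ζ B ∈ T}))

theorem measurable_stagePoint (σ : Equiv.Perm (Fin p)) (L : Finset (Fin p)) (n : Fin p)
    (B : Finset (Fin p)) {x y : E → Fin p → ℝ} (hx : Measurable x) (hy : Measurable y)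
    {F : E → Finset (Fin p) → ℝ} (hF : ∀ k, Measurable fun e => F e k) :
    Measurable fun e => stagePoint σ L n (x e) (y e) (F e) B := by
  refine measurable_pi_lambda _ fun j => ?_
  simp only [stagePoint, Finset.piecewise]
  exact Measurable.ite (measurableSet_representative σ L n B hF {R | j ∈ insert (σ n) R})
    ((measurable_pi_apply j).comp hy) ((measurable_pi_apply j).comp hx)

theorem measurable_stageUpdate (σ : Equiv.Perm (Fin p)) (L : Finset (Fin p)) (n : Fin p)
    {F : E → Finset (Fin p) → ℝ} (hF : ∀ k, Measurable fun e => F e k)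
    {a : E → L.powerset → ℝ} (ha : Measurable a) :
    Measurable fun e => stageUpdate σ L n (F e) (a e) := by
  refine measurable_pi_lambda _ fun A => ?_
  simp only [stageUpdate]
  split_ifs
  · refine Measurable.ite ((hF _) (measurableSet_singleton 0).compl) ?_ measurable_const
    refine ((hF _).mul ((measurable_pi_apply _).comp ha)).div ?_
    exact measurable_apply_discrete hF fun R =>
      measurableSet_representative σ L n _ hF {R}
  · exact hF A

theorem measurable_tableDensity {F : E → Finset (Fin p) → ℝ} (hF : ∀ k, Measurable fun e => F e k)
    {x z : E → Fin p → ℝ} (hx : Measurable x) (hz : Measurable z) :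
    Measurable fun e => tableDensity (F e) (x e) (z e) := by
  refine measurable_apply_discrete hF fun R => ?_
  have : {e | (Finset.univ.filter fun j => z e j ≠ x e j) = R} =
      ⋂ j, {e | z e j ≠ x e j ↔ j ∈ R} := by
    ext e
    simp [Finset.ext_iff]
  rw [this]
  refine MeasurableSet.iInter fun j => ?_
  have hne : MeasurableSet {e | z e j ≠ x e j} :=
    (measurableSet_eq_fun ((measurable_pi_apply j).comp hz) ((measurable_pi_apply j).comp hx)).compl
  by_cases hj : j ∈ R
  · simpa only [hj, iff_true] using hne
  · have : {e | z e j ≠ x e j ↔ j ∈ R} = {e | z e j ≠ x e j}ᶜ := by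
      ext e
      simp [hj]
    rw [this]
    exact hne.compl

/-- One query is spent on `Φ x`, and each stage asks one for every subset of the later neighbours.
-/
theorem queryable_table (σ : Equiv.Perm (Fin p)) (L : Fin p → Finset (Fin p)) {w : ℕ}
    (hw : ∀ n, (L n).card ≤ w) {x y : E → Fin p → ℝ} (hx : Measurable x) (hy : Measurable y)
    (m : ℕ) : Queryable (1 + m * 2 ^ w) E fun Φ e => table Φ σ L (x e) (y e) m := by
  induction m with
  | zero =>
    rw [zero_mul, add_zero]
    exact (Queryable.eval hx).map (g := fun a : E × ℝ => fun _ : Finset (Fin p) => a.2)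
      (by fun_prop)
  | succ m ih =>
    by_cases h : m < p
    · set n : Fin p := Fin.rev ⟨m, h⟩ with hn
      have hF : ∀ k, Measurable fun e : E × (Finset (Fin p) → ℝ) => e.2 k := fun k => by fun_prop
      have h1 := Queryable.eval_fintype (p := p) (ι := (L n).powerset)
        (E := E × (Finset (Fin p) → ℝ)) fun B => measurable_stagePoint σ (L n) n B.1
          (hx.comp measurable_fst) (hy.comp measurable_fst) hF
      have h2 := h1.map (g := fun a : (E × (Finset (Fin p) → ℝ)) × ((L n).powerset → ℝ) =>
        stageUpdate σ (L n) n a.1.2 a.2) (measurable_stageUpdate σ (L n) n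
          (fun k => by fun_prop) measurable_snd)
      have hcard : Fintype.card (L n).powerset ≤ 2 ^ w := by
        rw [Fintype.card_coe, Finset.card_powerset]
        exact Nat.pow_le_pow_right two_pos (hw n)
      have h3 := (ih.bind (h2.mono hcard)).mono
        (show 2 ^ w + (1 + m * 2 ^ w) ≤ 1 + (m + 1) * 2 ^ w by ring_nf; rfl)
      simp only [table_succ h hn.symm]
      exact h3
    · simp only [table, dif_neg h]
      exact ih.mono (by gcongr; omega)

/-- The proposals for the precision matrix `P`. -/
noncomputable def guidedProposal (σ : Equiv.Perm (Fin p)) (P : Matrix (Fin p) (Fin p) ℝ) :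
    Fin p → (Fin p → ℝ) → (Fin p → ℝ) → (Fin p → Bool) → ℝ → ℝ :=
  fun n x y _ t => covGuided P⁻¹ (fun _ => P.trace⁻¹) σ n x y t

/-- The means of the proposals for the precision matrix `P`. -/
noncomputable def guidedMean (σ : Equiv.Perm (Fin p)) (P : Matrix (Fin p) (Fin p) ℝ) :
    Fin p → (Fin p → ℝ) → (Fin p → ℝ) → ℝ :=
  covGuidedMean P⁻¹ (fun _ => P.trace⁻¹) σ

/-- The variances of the proposals for the precision matrix `P`. -/
noncomputable def guidedVar (σ : Equiv.Perm (Fin p)) (P : Matrix (Fin p) (Fin p) ℝ) (n : Fin p) :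
    ℝ≥0 := (covGuidedVar P⁻¹ (fun _ => P.trace⁻¹) σ n).toNNReal

theorem guidedProposal_eq (σ : Equiv.Perm (Fin p)) (P : Matrix (Fin p) (Fin p) ℝ) (n : Fin p)
    (x y : Fin p → ℝ) (u : Fin p → Bool) (t : ℝ) : guidedProposal σ P n x y u t =
      gaussianPDFReal (guidedMean σ P n x y) (guidedVar σ P n) t :=
  covGuided_eq n x y t

variable {P : E → Matrix (Fin p) (Fin p) ℝ}

theorem measurable_guidedMean (σ : Equiv.Perm (Fin p))
    (hP : ∀ i k, Measurable fun e => P e i k) {x y : E → Fin p → ℝ} (hx : Measurable x)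
    (hy : Measurable y) (n : Fin p) : Measurable fun e => guidedMean σ (P e) n (x e) (y e) :=
  measurable_covGuidedMean (measurable_inv_apply hP)
    (measurable_pi_lambda _ fun _ => measurable_inv_trace hP) hx hy n

theorem measurable_guidedVar (σ : Equiv.Perm (Fin p))
    (hP : ∀ i k, Measurable fun e => P e i k) (n : Fin p) :
    Measurable fun e => guidedVar σ (P e) n :=
  (measurable_condVar (measurable_Gam (measurable_inv_apply hP)
    (measurable_pi_lambda _ fun _ => measurable_inv_trace hP)) _).real_toNNReal

theorem measurable_guidedProposal (σ : Equiv.Perm (Fin p))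
    (hP : ∀ i k, Measurable fun e => P e i k) {x y : E → Fin p → ℝ} (hx : Measurable x)
    (hy : Measurable y) {u : E → Fin p → Bool} {t : E → ℝ} (ht : Measurable t) (n : Fin p) :
    Measurable fun e => guidedProposal σ (P e) n (x e) (y e) (u e) (t e) := by
  have hm := measurable_guidedMean σ hP hx hy n
  have hv := (measurable_guidedVar σ hP n).coe_nnreal_real
  simp only [guidedProposal_eq, gaussianPDFReal]
  exact ((hv.const_mul _).sqrt.inv).mul (((ht.sub hm).pow_const 2).neg.div (hv.const_mul 2)).exp

/-- The proposals and acceptances, sampled with the seeds `z` and `V` for the input `x`. -/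
noncomputable def algorithm (Φ : (Fin p → ℝ) → ℝ) (σ : Equiv.Perm (Fin p))
    (L : Fin p → Finset (Fin p)) (x z V : Fin p → ℝ) : (Fin p → ℝ) × (Fin p → Bool) :=
  let P := precision fun k => Φ (precisionPoint k)
  let y := sampleProposals σ (fun n => guidedMean σ P n x) (guidedVar σ P) z p
  (y, sampleBits σ (fun n => acceptProb σ (guidedProposal σ P)
    (metroDensity (tableDensity (table Φ σ L x y p) x) σ (guidedProposal σ P) n) n x y) V p)

/-- Replacing `Φ` by the table changes no acceptance probability, so the procedure simulates the
true Metro run. -/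
theorem algorithm_eq_sampleRun {G : SimpleGraph (Fin p)} {Φ : (Fin p → ℝ) → ℝ}
    (hΦ : IsGraphicalDensity G Φ) {σ : Equiv.Perm (Fin p)} {L : Fin p → Finset (Fin p)}
    (hL : ∀ n k, n < k → G.Adj (σ n) (σ k) → σ k ∈ L n) (x z V : Fin p → ℝ) :
    algorithm Φ σ L x z V = sampleRun Φ σ
      (guidedProposal σ (precision fun k => Φ (precisionPoint k)))
      (guidedMean σ (precision fun k => Φ (precisionPoint k)))
      (guidedVar σ (precision fun k => Φ (precisionPoint k))) x z V := by
  rw [algorithm, sampleRun]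
  simp only [Prod.mk.injEq, true_and]
  exact sampleBits_congr (fun n u => acceptProb_tableDensity hΦ hL u n) V p

/-- Inputs and seeds of the procedure, together with the values at the points `precisionPoint`. -/
abbrev AlgorithmState (p : ℕ) : Type :=
  ((Fin p → ℝ) × (Fin p → ℝ) × (Fin p → ℝ)) × (Option (Fin p ⊕ Fin p × Fin p) → ℝ)

theorem queryable_algorithm (σ : Equiv.Perm (Fin p)) (L : Fin p → Finset (Fin p)) {w : ℕ}
    (hw : ∀ n, (L n).card ≤ w) :
    Queryable (1 + p * 2 ^ w + (p + p * p + 1))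
      ((Fin p → ℝ) × (Fin p → ℝ) × (Fin p → ℝ)) fun Φ e => algorithm Φ σ L e.1 e.2.1 e.2.2 := by
  have h1 := Queryable.eval_fintype (p := p) (E := (Fin p → ℝ) × (Fin p → ℝ) × (Fin p → ℝ)) (z := fun k _ => precisionPoint k)
    fun k => measurable_const
  have hP : ∀ i k, Measurable fun e : AlgorithmState p => precision e.2 i k :=
    measurable_precision measurable_snd
  have hy : Measurable fun e : AlgorithmState p => sampleProposals σ
      (fun n => guidedMean σ (precision e.2) n e.1.1) (guidedVar σ (precision e.2)) e.1.2.1 p :=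
    measurable_sampleProposals (m := fun (e : AlgorithmState p) n => guidedMean σ (precision e.2) n e.1.1)
      (v := fun e : AlgorithmState p => guidedVar σ (precision e.2))
      (fun n => measurable_guidedMean σ (P := fun a : AlgorithmState p × (Fin p → ℝ) => precision a.1.2)
        (fun i k => (hP i k).comp measurable_fst) (by fun_prop) (by fun_prop) n)
      (fun n => measurable_guidedVar σ hP n) (by fun_prop) p
  have h2 := queryable_table σ L hw (x := fun e : AlgorithmState p => e.1.1) (by fun_prop) hy p
  have h3 := h2.map (g := fun a : AlgorithmState p × (Finset (Fin p) → ℝ) =>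
    (sampleProposals σ (fun n => guidedMean σ (precision a.1.2) n a.1.1.1)
        (guidedVar σ (precision a.1.2)) a.1.1.2.1 p,
      sampleBits σ (fun n => acceptProb σ (guidedProposal σ (precision a.1.2))
        (metroDensity (tableDensity a.2 a.1.1.1) σ (guidedProposal σ (precision a.1.2)) n) n
          a.1.1.1 (sampleProposals σ (fun n => guidedMean σ (precision a.1.2) n a.1.1.1)
            (guidedVar σ (precision a.1.2)) a.1.1.2.1 p)) a.1.1.2.2 p)) ?_
  · have h4 := h1.bind h3
    simpa [algorithm] using h4
  · refine (hy.comp measurable_fst).prodMk (measurable_sampleBits (fun n => ?_) (by fun_prop) p)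
    have hr : ∀ n, Measurable fun a : (AlgorithmState p × (Finset (Fin p) → ℝ)) × (Fin p → ℝ) × (Fin p → ℝ) ×
        (Fin p → Bool) × ℝ =>
          guidedProposal σ (precision a.1.1.2) n a.2.1 a.2.2.1 a.2.2.2.1 a.2.2.2.2 := fun n =>
      measurable_guidedProposal σ (fun i k => (hP i k).comp (f := fun a : (AlgorithmState p × (Finset (Fin p) → ℝ))
        × (Fin p → ℝ) × (Fin p → ℝ) × (Fin p → Bool) × ℝ => a.1.1) (by fun_prop))
        (by fun_prop) (by fun_prop) (by fun_prop) n
    have hg := measurable_metroDensity (E := AlgorithmState p × (Finset (Fin p) → ℝ)) (σ := σ)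
      (Ψ := fun e => tableDensity e.2 e.1.1.1) (r := fun e => guidedProposal σ (precision e.1.2))
      (measurable_tableDensity (fun k => by fun_prop) (by fun_prop) (by fun_prop)) hr n
    have ha := measurable_acceptProb (σ := σ) (r := fun e : AlgorithmState p × (Finset (Fin p) → ℝ) =>
      guidedProposal σ (precision e.1.2)) (g := fun e => metroDensity (tableDensity e.2 e.1.1.1) σ
        (guidedProposal σ (precision e.1.2)) n) n (hr n) hg
    exact ha.comp (f := fun a : (AlgorithmState p × (Finset (Fin p) → ℝ)) × (Fin p → Bool) =>
      (a.1, a.1.1.1.1, sampleProposals σ (fun n => guidedMean σ (precision a.1.1.2) n a.1.1.1.1)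
        (guidedVar σ (precision a.1.1.2)) a.1.1.1.2.1 p, a.2))
      (measurable_fst.prodMk ((by fun_prop : Measurable fun a :
        (AlgorithmState p × (Finset (Fin p) → ℝ)) × (Fin p → Bool) => a.1.1.1.1).prodMk
          ((hy.comp (measurable_fst.comp measurable_fst)).prodMk measurable_snd)))

/-! ### The upper bound. -/

theorem upper_bound {G : SimpleGraph (Fin p)} (hp : 0 < p) (hG : IsChordal G) :
    ∃ (σ : Equiv.Perm (Fin p)) (A : OracleProcedure p ((Fin p → ℝ) × (Fin p → Bool))),
      ∀ Φ : (Fin p → ℝ) → ℝ, IsGraphicalDensity G Φ →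
        (∀ x ω, A.numQueries Φ x ω ≤ ((4 * (p ^ 2 + p * 2 ^ treewidth G) : ℕ) : ℕ∞)) ∧
        ∃ q : Fin p → (Fin p → ℝ) → (Fin p → ℝ) → (Fin p → Bool) → ℝ → ℝ,
          IsFaithfulProposal σ q ∧
          (∀ n x y u t, 0 < q n x y u t) ∧
          (A.runLaw Φ).map (fun a => (a.1, A.output Φ a.1 a.2)) = metroLaw Φ σ q ∧
          PairwiseExchangeable ((A.runLaw Φ).map fun a =>
            (a.1, knockoff a.1 (A.output Φ a.1 a.2).1 (A.output Φ a.1 a.2).2)) ∧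
          ∀ (S : Matrix (Fin p) (Fin p) ℝ) (W : ℝ), S.PosDef → 0 < W →
            (∀ x, Φ x = W * Real.exp (-(x ⬝ᵥ (S⁻¹ *ᵥ x)) / 2)) →
            (∃ s : Fin p → ℝ, (∀ j, 0 < s j) ∧ (Gam S s).PosDef ∧
              ∀ n x y u t, q n x y u t = covGuided S s σ n x y t) ∧
            ∀ᵐ a ∂(A.runLaw Φ), ∀ j,
              a.1 j ≠ knockoff a.1 (A.output Φ a.1 a.2).1 (A.output Φ a.1 a.2).2 j := by
  obtain ⟨σ, hσ⟩ := hG.exists_elimination_order hp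
  choose L hw hL using hσ
  obtain ⟨step, hstep, hA⟩ := (queryable_algorithm σ L hw).exists_oracleProcedure
    ((stdNormal p).prod (stdUniform p))
  refine ⟨σ, ⟨(Fin p → ℝ) × (Fin p → ℝ), inferInstance, (stdNormal p).prod (stdUniform p),
    inferInstance, step, hstep⟩, fun Φ hΦ => ⟨fun x ω => ((hA Φ x ω).1).trans ?_, ?_⟩⟩
  · have h2 : 1 ≤ 2 ^ treewidth G := Nat.one_le_two_pow
    refine Nat.cast_le.mpr ?_
    -- The exact count is `p ^ 2 + p + 2 + p * 2 ^ w`; the terms of lower order are absorbed because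
    -- `p` is positive.
    nlinarith [Nat.zero_le (p * 2 ^ treewidth G)]
  set A : OracleProcedure p ((Fin p → ℝ) × (Fin p → Bool)) :=
    ⟨(Fin p → ℝ) × (Fin p → ℝ), inferInstance, (stdNormal p).prod (stdUniform p),
      inferInstance, step, hstep⟩ with hAdef
  set P := precision fun k => Φ (precisionPoint k) with hPdef
  have hP : P.PosDef := posDef_precision _
  obtain ⟨htr, hΓ⟩ := posDef_Gam_inv hp hP
  have hq : IsFaithfulProposal σ (guidedProposal σ P) := isFaithfulProposal_covGuided hΓ
  have hΦm := hΦ.measurable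
  have hΦ0 := hΦ.nonneg
  have hout : ∀ x ω, A.output Φ x ω =
      sampleRun Φ σ (guidedProposal σ P) (guidedMean σ P) (guidedVar σ P) x ω.1 ω.2 := fun x ω =>
    (hA Φ x ω).2.trans (algorithm_eq_sampleRun hΦ hL x ω.1 ω.2)
  have hm : ∀ n, Measurable fun a : (Fin p → ℝ) × (Fin p → ℝ) => guidedMean σ P n a.1 a.2 :=
    measurable_guidedMean σ (P := fun _ => P) (fun _ _ => measurable_const) measurable_fst
      measurable_snd
  have houtm : Measurable fun a : (Fin p → ℝ) × A.Seed => (a.1, A.output Φ a.1 a.2) :=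
    measurable_fst.prodMk (A.measurable_output hΦm)
  have hlaw : (A.runLaw Φ).map (fun a => (a.1, A.output Φ a.1 a.2)) =
      metroLaw Φ σ (guidedProposal σ P) := by
    simp only [hout]
    exact map_sampleRun hΦ0 hΦm hq (guidedProposal_eq σ P) hm
      (fun n => (Real.toNNReal_pos.mpr (covGuidedVar_pos hΓ n)).ne')
      fun n x y y' h => covGuidedMean_causal n x h
  refine ⟨guidedProposal σ P, hq, fun n x y u t => covGuided_pos hΓ n x y t, hlaw, ?_,
    fun S W hS hW hgauss => ⟨?_, ?_⟩⟩
  · have h := pairwiseExchangeable_metroLaw hΦ0 hΦm hq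
    rw [← hlaw, Measure.map_map measurable_knockoff houtm] at h
    exact h
  · have hPS : P = S⁻¹ := precision_gaussian hS.inv hW hgauss
    have hSP : P⁻¹ = S := by
      rw [hPS, Matrix.nonsing_inv_nonsing_inv _ ((Matrix.isUnit_iff_isUnit_det _).mp hS.isUnit)]
    rw [hSP] at hΓ
    refine ⟨fun _ => P.trace⁻¹, fun _ => htr, hΓ, fun n x y u t => ?_⟩
    rw [guidedProposal, hSP]
  · have hPS : P = S⁻¹ := precision_gaussian hS.inv hW hgauss
    have hSP : P⁻¹ = S := by
      rw [hPS, Matrix.nonsing_inv_nonsing_inv _ ((Matrix.isUnit_iff_isUnit_det _).mp hS.isUnit)]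
    have hae := ae_ne_knockoff_metroLaw hΦm hq fun x y u h0 j => by
      obtain ⟨c, -, hc⟩ := exists_metroDensity_covGuided (σ := σ) hΓ hP.inv hW
        (by rwa [hSP]) p le_rfl
      by_contra hj
      refine h0 ((hc x y u).trans (if_neg fun hall => hj ?_))
      simpa using hall (σ.symm j) (σ.symm j).isLt
    rw [← hlaw] at hae
    exact ae_of_ae_map houtm.aemeasurable hae

end Procedure

end Knockoff
theorem mainTheorem7 :
    -- Upper bound, with a universal constant `C`.
    (∃ C : ℕ, ∀ (p : ℕ) (G : SimpleGraph (Fin p)), 0 < p → Knockoff.IsChordal G →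
      ∃ (σ : Equiv.Perm (Fin p))
        (A : Knockoff.OracleProcedure p ((Fin p → ℝ) × (Fin p → Bool))),
        ∀ Φ : (Fin p → ℝ) → ℝ, Knockoff.IsGraphicalDensity G Φ →
          -- the number of queries
          (∀ x ω, A.numQueries Φ x ω ≤ ((C * (p ^ 2 + p * 2 ^ Knockoff.treewidth G) : ℕ) : ℕ∞)) ∧
          -- the procedure is a run of Metro and produces knockoffs
          ∃ q : Fin p → (Fin p → ℝ) → (Fin p → ℝ) → (Fin p → Bool) → ℝ → ℝ,
            Knockoff.IsFaithfulProposal σ q ∧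
            (∀ n x y u t, 0 < q n x y u t) ∧
            (A.runLaw Φ).map (fun a => (a.1, A.output Φ a.1 a.2)) = Knockoff.metroLaw Φ σ q ∧
            Knockoff.PairwiseExchangeable ((A.runLaw Φ).map fun a =>
              (a.1, Knockoff.knockoff a.1 (A.output Φ a.1 a.2).1 (A.output Φ a.1 a.2).2)) ∧
            -- the zero-mean Gaussian case
            ∀ (S : Matrix (Fin p) (Fin p) ℝ) (W : ℝ), S.PosDef → 0 < W →
              (∀ x, Φ x = W * Real.exp (-(x ⬝ᵥ (S⁻¹ *ᵥ x)) / 2)) →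
              (∃ s : Fin p → ℝ, (∀ j, 0 < s j) ∧ (Knockoff.Gam S s).PosDef ∧
                ∀ n x y u t, q n x y u t = Knockoff.covGuided S s σ n x y t) ∧
              ∀ᵐ a ∂(A.runLaw Φ), ∀ j,
                a.1 j ≠
                  Knockoff.knockoff a.1 (A.output Φ a.1 a.2).1 (A.output Φ a.1 a.2).2 j) ∧
    -- Lower bound, for every procedure which is valid for the graph `G` and the support `D`.
    (∀ (p : ℕ) (G : SimpleGraph (Fin p)) (D : Set (Fin p → ℝ))
      (A : Knockoff.OracleProcedure p (Fin p → ℝ)), 0 < p → Knockoff.IsChordal G →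
      (∀ Φ : (Fin p → ℝ) → ℝ, Knockoff.IsGraphicalDensity G Φ → Function.support Φ = D →
        (∀ᵐ a ∂(A.runLaw Φ), A.numQueries Φ a.1 a.2 < ⊤) ∧
        Knockoff.PairwiseExchangeable
          ((A.runLaw Φ).map fun a => (a.1, A.output Φ a.1 a.2))) →
      ∀ Φ : (Fin p → ℝ) → ℝ, Knockoff.IsGraphicalDensity G Φ → Function.support Φ = D →
        ∀ ε : ENNReal, 0 < ε →
          (A.runLaw Φ) {a | ∀ j, a.1 j ≠ A.output Φ a.1 a.2 j} = ε →
          ε ≤ (A.runLaw Φ)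
            {a | ((2 ^ Knockoff.treewidth G - 1 : ℕ) : ℕ∞) ≤ A.numQueries Φ a.1 a.2}) := by
  refine ⟨⟨4, fun p G hp hG => Knockoff.upper_bound hp hG⟩, ?_⟩
  rintro p G D A hp hG hA Φ hΦ hD ε - rfl
  -- The almost sure implication in `lower_bound` is an inclusion of events up to a null set.
  exact measure_mono_ae (Knockoff.lower_bound hp hG A hA hΦ hD)
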